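/- Let $Q\in\{8,10,12\}$ and $s>Q/4$. Let $\mathbf k_j=(\cos\frac{2\pi (j-1)}{Q},\sin\frac{2\pi (j-1)}{Q})$, $1\le j\le Q$, let $\Gamma=\{\sum_j m_j\mathbf k_j: m\in\mathbb N^Q\}\subset\mathbb R^2$ be the quasilattice, and for $\mathbf k\in\Gamma$ let $N_{\mathbf k}=\min\{\sum_j m_j:\ m\in\mathbb N^Q,\ \sum_j m_j\mathbf k_j=\mathbf k\}$. For real $t$ let $\mathcal H_t$ be the space of (formal) quasiperiodic functions $U(\mathbf x)=\sum_{\mathbf k\in\Gamma}U_{\mathbf k}e^{i\mathbf k\cdot\mathbf x}$, $U_{\mathbf k}\in\mathbb C$, with $\|U\|_t^2=\sum_{\mathbf k\in\Gamma}(1+N_{\mathbf k}^2)^t|U_{\mathbf k}|^2<\infty$. The product on $\mathcal H_s$ is $(UV)_{\mathbf k}=\sum_{\mathbf p+\mathbf q=\mathbf k}U_{\mathbf p}V_{\mathbf q}$ (it is well defined, since $s>Q/4$), and $(1+\Delta)^2:\mathcal H_s\to\mathcal H_{s-4}$ multiplies the coefficient $U_{\mathbf k}$ by $(1-|\mathbf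 k|^2)^2$. With $\beta=3(Q-1)$, there is exactly one formal solution $$U=\sqrt{\mu/\beta}\,\sum_{n\ge0}\mu^nU^{(n)}$$ of $(1+\Delta)^2U-\mu U+U^3=0$ (order by order in $\mu^{1/2}$) such that all $U^{(n)}\in\mathcal H_s$ are invariant under the rotation by $2\pi/Q$ and $U^{(0)}=\sum_{j=1}^Qe^{i\mathbf k_j\cdot\mathbf x}$. It is of Gevrey type: there are $K,\gamma>0$ such that $$\|U^{(n)}\|_s\le\gamma K^n(n!)^4\quad\text{for all }n\ge0 .\qquad(1)$$ Let $K>0$ be any number for which (1) holds with some $\gamma>0$, and let $D=\{\zeta\in\mathbb C:|\zeta|<K^{-1/4}\}$. For analytic $f,g:D\to\mathcal H_s$ with $f(0)=g(0)=0$, $f=\sum_{n\ge1}f_n\zeta^n$, $g=\sum_{n\ge1}g_n\zeta^n$, put $$(\mathcal Kf)(\zeta)=\sum_{n\ge1}\frac{n!}{(n+4)!}\,\zeta^{n+4}f_n,\qquad (f*g)(\zeta)=\sum_{n\ge1}\ \sum_{1\le k\le n-1}\frac{k!\,(n-k)!}{n!}\,f_kg_{n-k}\,\zeta^n .$$ These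 series converge in $D$ and define analytic functions $D\to\mathcal H_s$ vanishing at $0$. The series defining the Borel transform $$\widehat U(\zeta)=\sum_{n\ge0}\frac{\zeta^{4n+2}}{(4n+2)!}\,\beta^{-1/2}U^{(n)}$$ converges in $D$; $\widehat U$ is analytic in $D$ with values in $\mathcal H_s$ invariant under the rotation by $2\pi/Q$, vanishes at $\zeta=0$, and satisfies in $D$ (as an equation in $\mathcal H_{s-4}$) $$(1+\Delta)^2V-\mathcal KV+V*V*V=0 .$$ Up to the symmetry $V\mapsto-V$ it is the only solution of this kind other than $V=0$: the analytic functions $V:D\to\mathcal H_s$ with rotation invariant values and $V(0)=0$ that satisfy this equation in $D$ are exactly $0$, $\widehat U$ and $-\widehat U$. -/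

import Mathlib

open scoped Nat

namespace QuasiPattern

/-! The plane `ℝ²` is identified with `ℂ` (as a real Euclidean plane) throughout. -/

/-- The wave vectors `(cos (2πj/Q), sin (2πj/Q))`, `j = 0, …, Q - 1`. -/
noncomputable def waveVec (Q : ℕ) (j : Fin Q) : ℂ :=
  ⟨Real.cos (2 * Real.pi * (j : ℕ) / Q), Real.sin (2 * Real.pi * (j : ℕ) / Q)⟩

/-- The combination `∑ m_j k_j` of the wave vectors with natural coefficients. -/
noncomputable def waveSum (Q : ℕ) (m : Fin Q → ℕ) : ℂ := ∑ j, (m j : ℂ) * waveVec Q j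

theorem waveSum_add (Q : ℕ) (m m' : Fin Q → ℕ) :
    waveSum Q (m + m') = waveSum Q m + waveSum Q m' := by
  simp [waveSum, add_mul, Finset.sum_add_distrib]

/-- The quasilattice `Γ` of all combinations of the wave vectors with natural coefficients. -/
noncomputable def quasilattice (Q : ℕ) : AddSubmonoid ℂ where
  carrier := Set.range (waveSum Q)
  zero_mem' := ⟨0, by simp [waveSum]⟩
  add_mem' := by
    rintro _ _ ⟨m, rfl⟩ ⟨m', rfl⟩
    exact ⟨m + m', waveSum_add Q m m'⟩

/-- The order `N_k` of a point `k` of the quasilattice. -/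
noncomputable def order (Q : ℕ) (k : ℂ) : ℕ :=
  sInf {n | ∃ m : Fin Q → ℕ, waveSum Q m = k ∧ ∑ j, m j = n}

theorem exists_order_eq {Q : ℕ} (k : quasilattice Q) :
    ∃ m : Fin Q → ℕ, waveSum Q m = k ∧ ∑ j, m j = order Q k := by
  obtain ⟨m, hm⟩ := k.2
  exact Nat.sInf_mem (s := {n | ∃ m : Fin Q → ℕ, waveSum Q m = k ∧ ∑ j, m j = n})
    ⟨_, m, hm, rfl⟩

theorem order_add_le {Q : ℕ} (k l : quasilattice Q) :
    order Q ((k : ℂ) + l) ≤ order Q k + order Q l := by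
  obtain ⟨m, hm, hm'⟩ := exists_order_eq k
  obtain ⟨n, hn, hn'⟩ := exists_order_eq l
  refine Nat.sInf_le ⟨m + n, by rw [waveSum_add, hm, hn], ?_⟩
  simp [Finset.sum_add_distrib, hm', hn']

theorem norm_waveVec (Q : ℕ) (j : Fin Q) : ‖waveVec Q j‖ = 1 := by
  rw [← sq_eq_sq₀ (norm_nonneg _) zero_le_one, Complex.sq_norm, Complex.normSq_apply, waveVec]
  nlinarith [Real.sin_sq_add_cos_sq (2 * Real.pi * (j : ℕ) / Q)]

theorem norm_le_order {Q : ℕ} (k : quasilattice Q) : ‖(k : ℂ)‖ ≤ order Q k := by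
  obtain ⟨m, hm, hm'⟩ := exists_order_eq k
  rw [← hm', ← hm, waveSum]
  refine (norm_sum_le _ _).trans ?_
  simp [norm_waveVec]

theorem waveVec_mem (Q : ℕ) (j : Fin Q) : waveVec Q j ∈ quasilattice Q :=
  ⟨Pi.single j 1, by simp [waveSum, Pi.single_apply]⟩

/-- The weight `(1 + N_k²)^s`. -/
noncomputable def weight (Q : ℕ) (s : ℝ) (k : ℂ) : ℝ := (1 + (order Q k : ℝ) ^ 2) ^ s

theorem weight_pos (Q : ℕ) (s : ℝ) (k : ℂ) : 0 < weight Q s k := by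
  unfold weight; positivity

/-- Families of Fourier coefficients `(U_k)_{k ∈ Γ}` with `∑ (1 + N_k²)^s |U_k|² < ∞`. -/
noncomputable def hSubmodule (Q : ℕ) (s : ℝ) : Submodule ℂ (quasilattice Q → ℂ) where
  carrier := {u | Summable fun k : quasilattice Q => weight Q s k * ‖u k‖ ^ 2}
  zero_mem' := by simp [summable_zero]
  add_mem' := by
    intro u v hu hv
    refine Summable.of_nonneg_of_le (fun k => ?_) (fun k => ?_) ((hu.add hv).mul_left 2)
    · have := weight_pos Q s k; positivity
    · have h1 : ‖u k + v k‖ ^ 2 ≤ 2 * (‖u k‖ ^ 2 + ‖v k‖ ^ 2) := by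
        nlinarith [norm_add_le (u k) (v k), norm_nonneg (u k + v k), sq_nonneg (‖u k‖ - ‖v k‖)]
      have := mul_le_mul_of_nonneg_left h1 (weight_pos Q s k).le
      simp only [Pi.add_apply]
      linarith
  smul_mem' := by
    intro c u hu
    refine (hu.mul_left (‖c‖ ^ 2)).congr fun k => ?_
    simp [mul_pow]; ring

/-- The space `𝓗_s` of (formal) quasiperiodic functions `U(x) = ∑_{k ∈ Γ} U_k exp(i k·x)`,
represented by their Fourier coefficients. -/
def QPSpace (Q : ℕ) (s : ℝ) : Type := hSubmodule Q s

variable {Q : ℕ} {s : ℝ}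

noncomputable instance : AddCommGroup (QPSpace Q s) := inferInstanceAs (AddCommGroup (hSubmodule Q s))

noncomputable instance : Module ℂ (QPSpace Q s) := inferInstanceAs (Module ℂ (hSubmodule Q s))

/-- The Fourier coefficient `U_k`. -/
def QPSpace.coeff (u : QPSpace Q s) (k : quasilattice Q) : ℂ := u.1 k

/-- The norm of `𝓗_s`: `‖U‖_s² = ∑ (1 + N_k²)^s |U_k|²`. -/
noncomputable instance : Norm (QPSpace Q s) :=
  ⟨fun u => √(∑' k : quasilattice Q, weight Q s k * ‖u.coeff k‖ ^ 2)⟩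

theorem QPSpace.summable (u : QPSpace Q s) :
    Summable fun k : quasilattice Q => weight Q s k * ‖u.coeff k‖ ^ 2 := u.2

theorem QPSpace.norm_def (u : QPSpace Q s) :
    ‖u‖ = √(∑' k : quasilattice Q, weight Q s k * ‖u.coeff k‖ ^ 2) := rfl

theorem QPSpace.ext {u v : QPSpace Q s} (h : ∀ k, u.coeff k = v.coeff k) : u = v :=
  Subtype.ext (funext h)

theorem QPSpace.normCore : NormedSpace.Core ℂ (QPSpace Q s) where
  norm_nonneg u := Real.sqrt_nonneg _
  norm_smul c u := by
    have : ∀ k : quasilattice Q, weight Q s k * ‖(c • u).coeff k‖ ^ 2 =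
        ‖c‖ ^ 2 * (weight Q s k * ‖u.coeff k‖ ^ 2) := fun k => by
      rw [show (c • u).coeff k = c * u.coeff k from rfl, norm_mul]; ring
    rw [QPSpace.norm_def, QPSpace.norm_def, tsum_congr this, tsum_mul_left,
      Real.sqrt_mul (by positivity), Real.sqrt_sq (norm_nonneg c)]
  norm_triangle u v := by
    have hw : ∀ (x : QPSpace Q s) (k : quasilattice Q),
        (√(weight Q s k) * ‖x.coeff k‖) ^ (2 : ℝ) = weight Q s k * ‖x.coeff k‖ ^ 2 :=
      fun x k => by
        rw [Real.rpow_two, mul_pow, Real.sq_sqrt (weight_pos Q s k).le]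
    have hnn : ∀ (x : QPSpace Q s) (k : quasilattice Q), 0 ≤ √(weight Q s k) * ‖x.coeff k‖ :=
      fun x k => by positivity
    obtain ⟨h1, h2⟩ := Real.Lp_add_le_tsum_of_nonneg (p := 2) (by norm_num) (hnn u) (hnn v)
      (by simpa only [hw] using u.summable) (by simpa only [hw] using v.summable)
    simp only [hw, ← Real.sqrt_eq_rpow] at h2
    rw [QPSpace.norm_def, QPSpace.norm_def, QPSpace.norm_def]
    refine le_trans (Real.sqrt_le_sqrt ?_) h2
    refine (u + v).summable.tsum_le_tsum (fun k => ?_) h1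
    rw [Real.rpow_two, ← mul_add, mul_pow, Real.sq_sqrt (weight_pos Q s k).le]
    have := weight_pos Q s k
    have := norm_add_le (u.coeff k) (v.coeff k)
    rw [show (u + v).coeff k = u.coeff k + v.coeff k from rfl]
    gcongr
  norm_eq_zero_iff u := by
    have hnn : ∀ k : quasilattice Q, 0 ≤ weight Q s k * ‖u.coeff k‖ ^ 2 := fun k => by
      have := weight_pos Q s k; positivity
    constructor
    · intro h
      rw [QPSpace.norm_def, Real.sqrt_eq_zero (tsum_nonneg hnn)] at h
      have h0 := (hasSum_zero_iff_of_nonneg hnn).1 (h ▸ u.summable.hasSum)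
      refine QPSpace.ext fun k => ?_
      have hk : weight Q s k * ‖u.coeff k‖ ^ 2 = 0 := congrFun h0 k
      have : u.coeff k = 0 := by simpa [(weight_pos Q s k).ne'] using hk
      rw [this]; rfl
    · rintro rfl
      have : ∀ k : quasilattice Q, weight Q s k * ‖(0 : QPSpace Q s).coeff k‖ ^ 2 = 0 :=
        fun k => by rw [show (0 : QPSpace Q s).coeff k = 0 from rfl]; simp
      rw [QPSpace.norm_def, tsum_congr this]; simp

noncomputable instance : NormedAddCommGroup (QPSpace Q s) :=
  NormedAddCommGroup.ofCore QPSpace.normCore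

noncomputable instance : NormedSpace ℂ (QPSpace Q s) := NormedSpace.ofCore QPSpace.normCore

open Classical in
/-- The Fourier mode `exp(i k·x)`. -/
noncomputable def mode (s : ℝ) (k : quasilattice Q) : QPSpace Q s :=
  ⟨Pi.single k 1, summable_of_ne_finset_zero (s := {k}) fun l hl => by
    simp [Finset.notMem_singleton.1 hl]⟩

/-- The operator `(1 + Δ)²` from `𝓗_s` to `𝓗_{s-4}`, which multiplies the coefficient of
`exp(i k·x)` by `(1 - |k|²)²`. -/
noncomputable def linOp (u : QPSpace Q s) : QPSpace Q (s - 4) :=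
  ⟨fun k => (((1 - ‖(k : ℂ)‖ ^ 2) ^ 2 : ℝ) : ℂ) * u.coeff k, by
    refine Summable.of_nonneg_of_le (fun k => ?_) (fun k => ?_) u.summable
    · have := weight_pos Q (s - 4) k; positivity
    · have hN : (0 : ℝ) < 1 + (order Q k : ℝ) ^ 2 := by positivity
      have hk : ‖(k : ℂ)‖ ^ 2 ≤ (order Q k : ℝ) ^ 2 :=
        pow_le_pow_left₀ (norm_nonneg _) (norm_le_order k) 2
      have h1 : |1 - ‖(k : ℂ)‖ ^ 2| ≤ 1 + (order Q k : ℝ) ^ 2 := by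
        rw [abs_le]; constructor <;> nlinarith [sq_nonneg ‖(k : ℂ)‖]
      have h2 : weight Q s k = weight Q (s - 4) k * (1 + (order Q k : ℝ) ^ 2) ^ 4 := by
        rw [weight, weight, ← Real.rpow_natCast _ 4, ← Real.rpow_add hN]; norm_num
      have h3 : |1 - ‖(k : ℂ)‖ ^ 2| ^ 4 ≤ (1 + (order Q k : ℝ) ^ 2) ^ 4 :=
        pow_le_pow_left₀ (abs_nonneg _) h1 4
      have := weight_pos Q (s - 4) k
      rw [norm_mul, Complex.norm_real, Real.norm_eq_abs, abs_pow, mul_pow, ← pow_mul, h2,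
        ← mul_assoc]
      gcongr⟩

/-- The inclusion of `𝓗_s` in `𝓗_{s-4}`. -/
noncomputable def emb (u : QPSpace Q s) : QPSpace Q (s - 4) :=
  ⟨u.coeff, by
    refine Summable.of_nonneg_of_le (fun k => ?_) (fun k => ?_) u.summable
    · have := weight_pos Q (s - 4) k; positivity
    · have : weight Q (s - 4) k ≤ weight Q s k := by
        refine Real.rpow_le_rpow_of_exponent_le ?_ (by linarith)
        nlinarith [sq_nonneg (order Q k : ℝ)]
      gcongr⟩

/-- The standing assumptions on the order `Q` of the quasilattice and on the exponent `s`. -/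
def Admissible (Q : ℕ) (s : ℝ) : Prop := Even Q ∧ 8 ≤ Q ∧ (Q : ℝ) / 4 < s

theorem waveVec_natAdd {d : ℕ} (j : Fin d) :
    waveVec (d + d) (Fin.natAdd d j) = -waveVec (d + d) (Fin.castAdd d j) := by
  have hd : (d : ℝ) ≠ 0 := by
    have := j.pos; positivity
  have : 2 * Real.pi * ((d + (j : ℕ) : ℕ) : ℝ) / ((d + d : ℕ) : ℝ) =
      2 * Real.pi * (j : ℕ) / ((d + d : ℕ) : ℝ) + Real.pi := by
    push_cast; field_simp; ring
  apply Complex.ext <;>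
    simp only [waveVec, Fin.val_natAdd, Fin.val_castAdd, this, Real.cos_add_pi, Real.sin_add_pi,
      Complex.neg_re, Complex.neg_im]

theorem summable_inv_weight (h : Admissible Q s) :
    Summable fun k : quasilattice Q => (weight Q s k)⁻¹ := by
  obtain ⟨⟨d, rfl⟩, -, hs⟩ := h
  have hd : (0 : ℝ) ≤ d := Nat.cast_nonneg d
  push_cast at hs
  have hs0 : 0 < s := by linarith
  have hex : ∀ k : quasilattice (d + d), ∃ z : Fin d → ℤ,
      (k : ℂ) = ∑ j, (z j : ℂ) * waveVec (d + d) (Fin.castAdd d j) ∧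
      ∀ j, |z j| ≤ order (d + d) k := by
    intro k
    obtain ⟨m, hm, hm'⟩ := exists_order_eq k
    refine ⟨fun j => (m (Fin.castAdd d j) : ℤ) - m (Fin.natAdd d j), ?_, fun j => ?_⟩
    · rw [← hm, waveSum, Fin.sum_univ_add, ← Finset.sum_add_distrib]
      refine Finset.sum_congr rfl fun j _ => ?_
      rw [waveVec_natAdd]; push_cast; ring
    · have h1 : m (Fin.castAdd d j) ≤ ∑ i : Fin d, m (Fin.castAdd d i) :=
        Finset.single_le_sum (f := fun i : Fin d => m (Fin.castAdd d i)) (by simp) (by simp)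
      have h2 : m (Fin.natAdd d j) ≤ ∑ i : Fin d, m (Fin.natAdd d i) :=
        Finset.single_le_sum (f := fun i : Fin d => m (Fin.natAdd d i)) (by simp) (by simp)
      rw [Fin.sum_univ_add] at hm'
      show |(m (Fin.castAdd d j) : ℤ) - m (Fin.natAdd d j)| ≤ order (d + d) k
      rw [abs_le]; constructor <;> omega
  choose z hz hz' using hex
  let b := Pi.basisFun ℝ (Fin d)
  let L := Submodule.span ℤ (Set.range b)
  have hmem : ∀ k, (fun j => ((z k j : ℤ) : ℝ)) ∈ L := by
    intro k
    have : (fun j => ((z k j : ℤ) : ℝ)) = ∑ j, z k j • b j := by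
      ext i; simp [b, Pi.single_apply]
    rw [this]
    exact Submodule.sum_mem _ fun j _ => Submodule.smul_mem _ _ (Submodule.subset_span ⟨j, rfl⟩)
  let f : quasilattice (d + d) → L := fun k => ⟨_, hmem k⟩
  have hf : Function.Injective f := by
    intro k l hkl
    have h1 : z k = z l := by
      ext j
      have h2 : ((z k j : ℤ) : ℝ) = ((z l j : ℤ) : ℝ) := congrFun (congrArg Subtype.val hkl) j
      exact_mod_cast h2
    exact Subtype.ext (by rw [hz k, hz l, h1])
  have hrank : Module.finrank ℤ L = d := by
    rw [ZLattice.rank ℝ L]; simp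
  have hsum : Summable fun x : L => ‖x‖ ^ (-(2 * s)) :=
    ZLattice.summable_norm_rpow L _ (by rw [hrank]; linarith)
  have hfin : {k | f k = 0}.Finite := (Set.finite_singleton (0 : L)).preimage hf.injOn
  refine Summable.of_norm_bounded_eventually (hsum.comp_injective hf) ?_
  filter_upwards [hfin.compl_mem_cofinite] with k hk
  have hpos : 0 < ‖f k‖ := norm_pos_iff.2 hk
  have hle : ‖f k‖ ≤ order (d + d) k := by
    refine (pi_norm_le_iff_of_nonneg (Nat.cast_nonneg _)).2 fun j => ?_
    show ‖((z k j : ℤ) : ℝ)‖ ≤ _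
    rw [Real.norm_eq_abs]
    exact_mod_cast hz' k j
  rw [Real.norm_of_nonneg (inv_nonneg.2 (weight_pos _ _ _).le), Function.comp_apply,
    Real.rpow_neg (norm_nonneg _)]
  refine inv_anti₀ (by positivity) ?_
  rw [weight, Real.rpow_mul (norm_nonneg _), Real.rpow_two]
  refine Real.rpow_le_rpow (by positivity) ?_ hs0.le
  nlinarith

theorem weight_add_le (hs : 0 ≤ s) (p q : quasilattice Q) :
    weight Q s ((p : ℂ) + q) ≤ 4 ^ s * (weight Q s p + weight Q s q) := by
  have key : ∀ a b c : ℝ, 0 ≤ a → a ≤ b → 0 ≤ c → c ≤ a + b →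
      (1 + c ^ 2) ^ s ≤ 4 ^ s * (1 + b ^ 2) ^ s := by
    intro a b c ha hab hc hcab
    rw [← Real.mul_rpow (by norm_num) (by positivity)]
    refine Real.rpow_le_rpow (by positivity) ?_ hs
    nlinarith
  have hN : (order Q ((p : ℂ) + q) : ℝ) ≤ order Q p + order Q q := by
    exact_mod_cast order_add_le p q
  have h4 : (0 : ℝ) < 4 ^ s := by positivity
  have hp := mul_pos h4 (weight_pos Q s p)
  have hq := mul_pos h4 (weight_pos Q s q)
  rw [mul_add]
  rcases le_total (order Q p : ℝ) (order Q q) with hle | hle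
  · have := key _ _ _ (Nat.cast_nonneg _) hle (Nat.cast_nonneg _) hN
    unfold weight at *; linarith
  · have := key _ _ _ (Nat.cast_nonneg _) hle (Nat.cast_nonneg _) (hN.trans_eq (add_comm _ _))
    unfold weight at *; linarith

/-- The Fourier coefficient `∑_{p + q = k} U_p V_q` of the product `UV`. -/
noncomputable def mulCoeff (u v : QPSpace Q s) (k : quasilattice Q) : ℂ :=
  ∑' p : {p : quasilattice Q × quasilattice Q // p.1 + p.2 = k}, u.coeff p.1.1 * v.coeff p.1.2

theorem mulCoeff_mem (h : Admissible Q s) (u v : QPSpace Q s) :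
    (∀ k : quasilattice Q,
      Summable fun p : {p : quasilattice Q × quasilattice Q // p.1 + p.2 = k} =>
        ‖u.coeff p.1.1 * v.coeff p.1.2‖) ∧
    Summable fun k : quasilattice Q => weight Q s k * ‖mulCoeff u v k‖ ^ 2 := by
  have hs : 0 ≤ s := by
    have := h.2.2
    have : (0 : ℝ) ≤ Q := Nat.cast_nonneg Q
    linarith
  let A : quasilattice Q × quasilattice Q → ℝ := fun p =>
    (weight Q s p.1 * ‖u.coeff p.1‖ ^ 2) * (weight Q s p.2 * ‖v.coeff p.2‖ ^ 2)
  have hW : ∀ k, 0 < weight Q s k := weight_pos Q s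
  have hA0 : ∀ p, 0 ≤ A p := fun p => by
    have := hW p.1; have := hW p.2; positivity
  have hA : Summable A := u.summable.mul_of_nonneg v.summable
    (fun k => by have := hW k; positivity) (fun k => by have := hW k; positivity)
  have hI := summable_inv_weight h
  set M := ∑' k : quasilattice Q, (weight Q s k)⁻¹ with hM
  let F := fun k : quasilattice Q => {p : quasilattice Q × quasilattice Q // p.1 + p.2 = k}
  have hAf : ∀ k, Summable fun p : F k => A p.1 := fun k =>
    hA.comp_injective Subtype.val_injective
  have inj1 : ∀ k, Function.Injective fun p : F k => p.1.1 := by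
    rintro k ⟨⟨a, b⟩, hab⟩ ⟨⟨c, e⟩, hce⟩ (rfl : a = c)
    have hab' : (a : ℂ) + b = k := congrArg Subtype.val hab
    have hce' : (a : ℂ) + e = k := congrArg Subtype.val hce
    have : b = e := Subtype.ext (add_left_cancel (hab'.trans hce'.symm))
    subst this; rfl
  have inj2 : ∀ k, Function.Injective fun p : F k => p.1.2 := by
    rintro k ⟨⟨a, b⟩, hab⟩ ⟨⟨c, e⟩, hce⟩ (rfl : b = e)
    have hab' : (a : ℂ) + b = k := congrArg Subtype.val hab
    have hce' : (c : ℂ) + b = k := congrArg Subtype.val hce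
    have : a = c := Subtype.ext (add_right_cancel (hab'.trans hce'.symm))
    subst this; rfl
  let B : quasilattice Q × quasilattice Q → ℝ := fun p => (weight Q s p.1 * weight Q s p.2)⁻¹
  have hB0 : ∀ p, 0 ≤ B p := fun p => by
    have := hW p.1; have := hW p.2; positivity
  have hBle : ∀ k (p : F k), B p.1 ≤
      4 ^ s * (weight Q s k)⁻¹ * ((weight Q s p.1.1)⁻¹ + (weight Q s p.1.2)⁻¹) := by
    rintro k ⟨⟨a, b⟩, hab⟩
    have ha := hW a
    have hb := hW b
    have hk := hW k
    have hab' : (a : ℂ) + b = k := congrArg Subtype.val hab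
    have h1 := weight_add_le hs a b
    rw [hab'] at h1
    simp only [B]
    have h3 : (4 : ℝ) ^ s * (weight Q s k)⁻¹ * ((weight Q s a)⁻¹ + (weight Q s b)⁻¹) =
        4 ^ s * (weight Q s a + weight Q s b) / weight Q s k * (weight Q s a * weight Q s b)⁻¹ := by
      field_simp; ring
    rw [h3]
    exact le_mul_of_one_le_left (by positivity) ((one_le_div₀ hk).2 h1)
  have hI1 : ∀ k, Summable fun p : F k => (weight Q s p.1.1)⁻¹ := fun k =>
    hI.comp_injective (inj1 k)
  have hI2 : ∀ k, Summable fun p : F k => (weight Q s p.1.2)⁻¹ := fun k =>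
    hI.comp_injective (inj2 k)
  have hBf : ∀ k, Summable fun p : F k => B p.1 := fun k =>
    Summable.of_nonneg_of_le (fun p => hB0 p.1) (hBle k) (((hI1 k).add (hI2 k)).mul_left _)
  have hBsum : ∀ k : quasilattice Q, weight Q s k * ∑' p : F k, B p.1 ≤ 4 ^ s * (2 * M) := by
    intro k
    have e1 : ∑' p : F k, (weight Q s p.1.1)⁻¹ ≤ M :=
      Summable.tsum_le_tsum_of_inj (fun p : F k => p.1.1) (inj1 k)
        (fun c _ => inv_nonneg.2 (hW c).le) (fun _ => le_rfl) (hI1 k) hI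
    have e2 : ∑' p : F k, (weight Q s p.1.2)⁻¹ ≤ M :=
      Summable.tsum_le_tsum_of_inj (fun p : F k => p.1.2) (inj2 k)
        (fun c _ => inv_nonneg.2 (hW c).le) (fun _ => le_rfl) (hI2 k) hI
    have e3 := (hBf k).tsum_le_tsum (hBle k) (((hI1 k).add (hI2 k)).mul_left _)
    rw [tsum_mul_left, (hI1 k).tsum_add (hI2 k)] at e3
    have hk := hW k
    calc weight Q s k * ∑' p : F k, B p.1
        ≤ weight Q s k * (4 ^ s * (weight Q s k)⁻¹ * (M + M)) := by gcongr; exact e3.trans (by gcongr)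
      _ = 4 ^ s * (2 * M) := by field_simp; ring
  have hprod : ∀ k (p : F k), √(A p.1) * √(B p.1) = ‖u.coeff p.1.1 * v.coeff p.1.2‖ := by
    intro k p
    have h1 := hW p.1.1
    have h2 := hW p.1.2
    rw [← Real.sqrt_mul (hA0 _), ← Real.sqrt_sq (norm_nonneg (u.coeff p.1.1 * v.coeff p.1.2))]
    congr 1
    simp only [A, B, norm_mul]
    field_simp
  have hsq : ∀ x : ℝ, 0 ≤ x → √x ^ (2 : ℝ) = x := fun x hx => by
    rw [Real.rpow_two, Real.sq_sqrt hx]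
  have hCS := fun k => Real.summable_and_inner_le_Lp_mul_Lq_tsum_of_nonneg
    (f := fun p : F k => √(A p.1)) (g := fun p : F k => √(B p.1)) Real.HolderConjugate.two_two
    (fun _ => Real.sqrt_nonneg _) (fun _ => Real.sqrt_nonneg _)
    (by simpa only [hsq _ (hA0 _)] using hAf k) (by simpa only [hsq _ (hB0 _)] using hBf k)
  simp only [hprod, hsq _ (hA0 _), hsq _ (hB0 _), ← Real.sqrt_eq_rpow] at hCS
  refine ⟨fun k => (hCS k).1, ?_⟩
  have hAk : Summable fun k => ∑' p : F k, A p.1 := by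
    have := (Equiv.sigmaFiberEquiv
      (fun p : quasilattice Q × quasilattice Q => p.1 + p.2)).summable_iff.2 hA
    exact this.sigma
  refine Summable.of_nonneg_of_le (fun k => ?_) (fun k => ?_) (hAk.mul_left (4 ^ s * (2 * M)))
  · have := hW k; positivity
  · have h1 : ‖mulCoeff u v k‖ ≤ √(∑' p : F k, A p.1) * √(∑' p : F k, B p.1) :=
      (norm_tsum_le_tsum_norm (hCS k).1).trans (hCS k).2
    have h2 := pow_le_pow_left₀ (norm_nonneg _) h1 2
    rw [mul_pow, Real.sq_sqrt (tsum_nonneg fun p => hA0 _),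
      Real.sq_sqrt (tsum_nonneg fun p => hB0 _)] at h2
    calc weight Q s k * ‖mulCoeff u v k‖ ^ 2
        ≤ weight Q s k * ((∑' p : F k, A p.1) * ∑' p : F k, B p.1) := by
          have := hW k; gcongr
      _ = (weight Q s k * ∑' p : F k, B p.1) * ∑' p : F k, A p.1 := by ring
      _ ≤ _ := mul_le_mul_of_nonneg_right (hBsum k) (tsum_nonneg fun p => hA0 _)

/-- The (pointwise) product of two elements of `𝓗_s`. -/
noncomputable def mul (h : Admissible Q s) (u v : QPSpace Q s) : QPSpace Q s :=
  ⟨mulCoeff u v, (mulCoeff_mem h u v).2⟩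

/-- Invariance of `U` under the rotation of the plane by the angle `2π/Q`: the coefficient at
the rotated wave vector equals the coefficient at the wave vector. -/
def RotInvariant (u : QPSpace Q s) : Prop :=
  ∀ k k' : quasilattice Q,
    (k' : ℂ) = ⟨Real.cos (2 * Real.pi / Q), Real.sin (2 * Real.pi / Q)⟩ * (k : ℂ) →
      u.coeff k' = u.coeff k

/-! ### The formal solution of `(1 + Δ)² U - μ U + U³ = 0` -/

/-- The constant `β = 3 (Q - 1)`. -/
noncomputable def beta (Q : ℕ) : ℝ := 3 * ((Q : ℝ) - 1)

/-- `U = (μ/β)^{1/2} ∑ μⁿ U⁽ⁿ⁾`, with `U⁽ⁿ⁾` in `𝓗_s` invariant under rotations by `2π/Q` and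
`U⁽⁰⁾ = ∑_j exp(i k_j·x)`, solves `(1 + Δ)² U - μ U + U³ = 0` as a formal power series in
`μ^{1/2}`, that is, order by order. -/
structure IsFormalSolution (h : Admissible Q s) (U : ℕ → QPSpace Q s) : Prop where
  leading : U 0 = ∑ j : Fin Q, mode s ⟨waveVec Q j, waveVec_mem Q j⟩
  rotInvariant : ∀ n, RotInvariant (U n)
  order_zero : linOp (U 0) = 0
  order_succ : ∀ n, linOp (U (n + 1)) =
    emb (U n - ((beta Q)⁻¹ : ℂ) • ∑ p ∈ Finset.HasAntidiagonal.antidiagonal n, ∑ q ∈ Finset.HasAntidiagonal.antidiagonal p.2,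
      mul h (mul h (U p.1) (U q.1)) (U q.2))

/-- The Gevrey estimate `‖U⁽ⁿ⁾‖_s ≤ γ Kⁿ (n!)⁴` for all `n`, with some constant `γ`. -/
def GevreyBound (U : ℕ → QPSpace Q s) (K : ℝ) : Prop :=
  ∃ γ > 0, ∀ n, ‖U n‖ ≤ γ * K ^ n * (n ! : ℝ) ^ 4

/-- The term `ζ^{4n+2} / (4n+2)! · β^{-1/2} U⁽ⁿ⁾` of the Borel transform. -/
noncomputable def borelTerm (U : ℕ → QPSpace Q s) (ζ : ℂ) (n : ℕ) : QPSpace Q s :=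
  (ζ ^ (4 * n + 2) / ((4 * n + 2)! : ℂ)) • (((√(beta Q))⁻¹ : ℝ) : ℂ) • U n

/-- The Borel transform, in the variable `ζ = μ^{1/4}`, of the formal series
`(μ/β)^{1/2} ∑ μⁿ U⁽ⁿ⁾ = ∑ ζ^{4n+2} β^{-1/2} U⁽ⁿ⁾`. -/
noncomputable def borelTransform (U : ℕ → QPSpace Q s) (ζ : ℂ) : QPSpace Q s :=
  ∑' n, borelTerm U ζ n

/-! ### The transformed equation -/

/-- The coefficient `f_n` of `f(ζ) = ∑ f_n ζⁿ`. -/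
noncomputable def taylorCoeff (f : ℂ → QPSpace Q s) (n : ℕ) : QPSpace Q s :=
  ((n ! : ℂ)⁻¹) • iteratedDeriv n f 0

/-- The term `n!/(n+4)! ζ^{n+4} f_n` of `𝒦 f`. -/
noncomputable def opKTerm (f : ℂ → QPSpace Q s) (ζ : ℂ) (n : ℕ) : QPSpace Q s :=
  ((n ! : ℂ) / ((n + 4)! : ℂ) * ζ ^ (n + 4)) • taylorCoeff f n

/-- `(𝒦 f)(ζ) = ∑_{n ≥ 1} n!/(n+4)! ζ^{n+4} f_n`. -/
noncomputable def opK (f : ℂ → QPSpace Q s) (ζ : ℂ) : QPSpace Q s :=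
  ∑' n, opKTerm f ζ (n + 1)

/-- The term `∑_{1 ≤ k ≤ n-1} f_k g_{n-k} k! (n-k)! / n! ζⁿ` of `f ∗ g`. -/
noncomputable def convTerm (h : Admissible Q s) (f g : ℂ → QPSpace Q s) (ζ : ℂ) (n : ℕ) :
    QPSpace Q s :=
  ζ ^ n • ∑ k ∈ Finset.Ico 1 n, ((k ! : ℂ) * ((n - k)! : ℂ) / (n ! : ℂ)) •
    mul h (taylorCoeff f k) (taylorCoeff g (n - k))

/-- The convolution `f ∗ g`. -/
noncomputable def conv (h : Admissible Q s) (f g : ℂ → QPSpace Q s) (ζ : ℂ) : QPSpace Q s :=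
  ∑' n, convTerm h f g ζ n

/-- `f` is analytic in the disc `|ζ| < r` with values in `𝓗_s` and vanishes at `ζ = 0`. -/
def IsAnalyticNull (r : ℝ) (f : ℂ → QPSpace Q s) : Prop :=
  AnalyticOnNhd ℂ f (Metric.ball 0 r) ∧ f 0 = 0

/-- `V` is analytic in the disc `|ζ| < r` with values in `𝓗_s` invariant under rotations by
`2π/Q`, vanishes at `ζ = 0`, and satisfies `(1 + Δ)² V - 𝒦 V + V ∗ V ∗ V = 0` in this disc
(an equation in `𝓗_{s-4}`). -/
structure IsBorelSolution (h : Admissible Q s) (r : ℝ) (V : ℂ → QPSpace Q s) : Prop where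
  analytic : IsAnalyticNull r V
  rotInvariant : ∀ ζ ∈ Metric.ball (0 : ℂ) r, RotInvariant (V ζ)
  equation : ∀ ζ ∈ Metric.ball (0 : ℂ) r,
    linOp (V ζ) - emb (opK V ζ) + emb (conv h (conv h V V) V ζ) = 0

end QuasiPattern

open QuasiPattern

namespace QuasiPattern

variable {Q : ℕ} {s : ℝ}

/-! ### The weighted sequence space: coefficients, completeness. -/

namespace QPSpace

/-! Everything rests on one scalar nondegeneracy. The rotation invariant kernel of (1 + Δ)² is
spanned by the basic pattern e = ∑_j exp(i k_j·x), and the coefficient of e³ at a wave vector is β: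
three wave vectors sum to a given one only if one of them is that vector and the other two cancel,
which leaves 3(Q - 1) triples (`baseCoeff_mul₃_basicPattern`). In the recursion (1 + Δ)² u_{m+d} =
u_m - b (u³)_m with u_0 = a e, the earlier terms determine u_n up to a multiple δ e, and solvability
of the equation for u_{n+d} sees δ through the factor 1 - 3a²bβ. If this factor is nonzero, a
determines u (`IsStepSolution.unique`); for the formal solution it is -2.

Existence and the Gevrey bound need control of 1 - |k|². For Q = 8, 10, 12 the points of Γ are
integer cubic polynomials in ω = exp(2πi/Q), and |k|² is an integer of a real quadratic field. The
norm of 1 - |k|² is an ordinary integer which vanishes only at wave vectors, while the conjugate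
factor is at most 1 + 16 N_k². Hence |1 - |k|²| ≥ 1/(1 + 16 N_k²) elsewhere
(`waveVec_or_small_divisor`). Since U⁽ⁿ⁾ has only modes of order at most 2n + 1, each inversion of
(1 + Δ)² costs a factor O(n⁴), and factorials absorb the number of cubic terms; this yields (n!)⁴
(`gevrey_of_recursive_bound`).

On the Borel side put w_n = n! V_n. The factorial weights in 𝒦 and ∗ are such that the transformed
equation becomes the formal equation (1 + Δ)² W - t⁴ W + W³ = 0 for W = ∑ w_n tⁿ
(`isBorelSolution_iff`). The t³ coefficient forces w_1 = 0, so W = t² ∑ u_n tⁿ, where u solves the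
recursion with d = 4, b = 1 and a (1 - a²β) = 0 (`IsBorelSeq.eq_shift`). For a = 0 and a = ±β^{-1/2}
the factor 1 - 3a²β is 1 and -2, so each a admits exactly one u: zero, or plus or minus the sequence
β^{-1/2} U⁽ⁿ⁾ spread over the multiples of 4. The Borel series converges because (n!)⁴ ≤ (4n + 2)!
and K |ζ|⁴ < 1. -/

@[simp] theorem coeff_zero (k : quasilattice Q) : (0 : QPSpace Q s).coeff k = 0 := rfl

@[simp] theorem coeff_add (u v : QPSpace Q s) (k : quasilattice Q) :
    (u + v).coeff k = u.coeff k + v.coeff k := rfl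

@[simp] theorem coeff_sub (u v : QPSpace Q s) (k : quasilattice Q) :
    (u - v).coeff k = u.coeff k - v.coeff k := rfl

@[simp] theorem coeff_smul (c : ℂ) (u : QPSpace Q s) (k : quasilattice Q) :
    (c • u).coeff k = c * u.coeff k := rfl

theorem norm_sq_eq (u : QPSpace Q s) :
    ‖u‖ ^ 2 = ∑' k : quasilattice Q, weight Q s k * ‖u.coeff k‖ ^ 2 := by
  rw [norm_def, Real.sq_sqrt]
  exact tsum_nonneg fun k => mul_nonneg (weight_pos Q s k).le (sq_nonneg _)

/-- Coefficientwise domination implies domination of norms. -/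
theorem norm_le_of_coeff_le {u v : QPSpace Q s} {M : ℝ} (hM : 0 ≤ M)
    (huv : ∀ k, ‖u.coeff k‖ ≤ M * ‖v.coeff k‖) : ‖u‖ ≤ M * ‖v‖ := by
  refine le_of_sq_le_sq ?_ (by positivity)
  rw [mul_pow, norm_sq_eq, norm_sq_eq, ← tsum_mul_left]
  refine u.summable.tsum_le_tsum (fun k => ?_) (v.summable.mul_left _)
  rw [mul_left_comm, ← mul_pow]
  exact mul_le_mul_of_nonneg_left (pow_le_pow_left₀ (norm_nonneg _) (huv k) 2)
    (weight_pos Q s k).le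

theorem sqrt_weight_mul_norm_coeff_le (u : QPSpace Q s) (k : quasilattice Q) :
    √(weight Q s k) * ‖u.coeff k‖ ≤ ‖u‖ := by
  refine le_of_sq_le_sq ?_ (norm_nonneg _)
  rw [mul_pow, Real.sq_sqrt (weight_pos Q s k).le, norm_sq_eq]
  exact u.summable.le_tsum k fun l _ => mul_nonneg (weight_pos Q s l).le (sq_nonneg _)

/-- The coefficient functional as a continuous linear map. -/
noncomputable def coeffCLM (s : ℝ) (k : quasilattice Q) : QPSpace Q s →L[ℂ] ℂ :=
  LinearMap.mkContinuous
    { toFun := fun u => u.coeff k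
      map_add' := fun _ _ => rfl
      map_smul' := fun _ _ => rfl } (√(weight Q s k))⁻¹ fun u => by
    have hw : 0 < √(weight Q s k) := Real.sqrt_pos.2 (weight_pos Q s k)
    rw [inv_mul_eq_div, le_div_iff₀ hw, mul_comm]
    exact u.sqrt_weight_mul_norm_coeff_le k

@[simp] theorem coeffCLM_apply (k : quasilattice Q) (u : QPSpace Q s) :
    coeffCLM s k u = u.coeff k := rfl

theorem coeff_sum {ι : Type*} (t : Finset ι) (f : ι → QPSpace Q s) (k : quasilattice Q) :
    (∑ i ∈ t, f i).coeff k = ∑ i ∈ t, (f i).coeff k :=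
  map_sum (coeffCLM s k) f t

/-- The weighted coefficients as an element of `ℓ²`. -/
noncomputable def toLp (u : QPSpace Q s) : lp (fun _ : quasilattice Q => ℂ) 2 :=
  ⟨fun k => (√(weight Q s k) : ℂ) * u.coeff k, by
    refine (memℓp_gen_iff (by norm_num)).2 (u.summable.congr fun k => ?_)
    simp [mul_pow, Real.sq_sqrt (weight_pos Q s k).le, abs_of_nonneg (Real.sqrt_nonneg _)]⟩

theorem norm_toLp_sub (u v : QPSpace Q s) : ‖toLp u - toLp v‖ = ‖u - v‖ := by
  rw [lp.norm_eq_tsum_rpow (by norm_num), norm_def, Real.sqrt_eq_rpow]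
  congr 1
  refine tsum_congr fun k => ?_
  have : (toLp u - toLp v) k = (√(weight Q s k) : ℂ) * (u - v).coeff k := by
    show (√(weight Q s k) : ℂ) * u.coeff k - (√(weight Q s k) : ℂ) * v.coeff k = _
    rw [coeff_sub, mul_sub]
  rw [this]
  simp [mul_pow, Real.sq_sqrt (weight_pos Q s k).le, abs_of_nonneg (Real.sqrt_nonneg _)]

theorem toLp_surjective : Function.Surjective (toLp : QPSpace Q s → _) := by
  intro x
  have hw : ∀ k : quasilattice Q, (√(weight Q s k) : ℂ) ≠ 0 := fun k => by
    exact_mod_cast (Real.sqrt_pos.2 (weight_pos Q s k)).ne'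
  refine ⟨⟨fun k => (√(weight Q s k) : ℂ)⁻¹ * x k, ?_⟩, ?_⟩
  · refine ((memℓp_gen_iff (by norm_num)).1 (lp.memℓp x)).congr fun k => ?_
    have := (weight_pos Q s k).ne'
    simp [mul_pow, Real.sq_sqrt (weight_pos Q s k).le, abs_of_nonneg (Real.sqrt_nonneg _), this]
  · refine Subtype.ext (funext fun k => ?_)
    exact mul_inv_cancel_left₀ (hw k) _

/-- Multiplying coefficients by the square root of the weight is an isometric bijection onto ℓ².
Completeness is what makes the bounded power series below converge and define analytic functions. -/
instance : CompleteSpace (QPSpace Q s) := by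
  have hi : Isometry (toLp : QPSpace Q s → _) :=
    Isometry.of_dist_eq fun u v => by rw [dist_eq_norm, dist_eq_norm, norm_toLp_sub]
  exact (hi.isUniformInducing.completeSpace_congr toLp_surjective).2 inferInstance

end QPSpace

/-! ### The product as a bounded multilinear map. -/

open QPSpace

/-- Cauchy–Schwarz on each fibre p + q = k, after factoring out the weights. The weight at p + q is
at most 4^s times the sum of the weights at p and q, so the weight at k times the fibre sum of
inverse weight products is bounded uniformly in k. -/
theorem exists_norm_mul_le (h : Admissible Q s) : ∃ C : ℝ, 0 ≤ C ∧ ∀ u v : QPSpace Q s,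
    ‖mul h u v‖ ≤ C * ‖u‖ * ‖v‖ := by
  have hs : 0 ≤ s := by
    have := h.2.2
    have : (0 : ℝ) ≤ Q := Nat.cast_nonneg Q
    linarith
  have hW : ∀ k, 0 < weight Q s k := weight_pos Q s
  have hI := summable_inv_weight h
  set M := ∑' k : quasilattice Q, (weight Q s k)⁻¹ with hM
  have hM0 : 0 ≤ M := tsum_nonneg fun k => inv_nonneg.2 (hW k).le
  refine ⟨√(4 ^ s * (2 * M)), Real.sqrt_nonneg _, fun u v => ?_⟩
  let A : quasilattice Q × quasilattice Q → ℝ := fun p =>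
    (weight Q s p.1 * ‖u.coeff p.1‖ ^ 2) * (weight Q s p.2 * ‖v.coeff p.2‖ ^ 2)
  have hA0 : ∀ p, 0 ≤ A p := fun p => by
    have := hW p.1; have := hW p.2; positivity
  have hA : Summable A := u.summable.mul_of_nonneg v.summable
    (fun k => by have := hW k; positivity) (fun k => by have := hW k; positivity)
  let F := fun k : quasilattice Q => {p : quasilattice Q × quasilattice Q // p.1 + p.2 = k}
  have hAf : ∀ k, Summable fun p : F k => A p.1 := fun k =>
    hA.comp_injective Subtype.val_injective
  have inj1 : ∀ k, Function.Injective fun p : F k => p.1.1 := by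
    rintro k ⟨⟨a, b⟩, hab⟩ ⟨⟨c, e⟩, hce⟩ (rfl : a = c)
    have : b = e := Subtype.ext (add_left_cancel
      ((congrArg Subtype.val hab).trans (congrArg Subtype.val hce).symm : (a : ℂ) + b = a + e))
    subst this; rfl
  have inj2 : ∀ k, Function.Injective fun p : F k => p.1.2 := by
    rintro k ⟨⟨a, b⟩, hab⟩ ⟨⟨c, e⟩, hce⟩ (rfl : b = e)
    have : a = c := Subtype.ext (add_right_cancel
      ((congrArg Subtype.val hab).trans (congrArg Subtype.val hce).symm : (a : ℂ) + b = c + b))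
    subst this; rfl
  -- The complementary Cauchy–Schwarz factor: √A √B = |U_p V_q|.
  let B : quasilattice Q × quasilattice Q → ℝ := fun p => (weight Q s p.1 * weight Q s p.2)⁻¹
  have hB0 : ∀ p, 0 ≤ B p := fun p => by
    have := hW p.1; have := hW p.2; positivity
  have hBle : ∀ k (p : F k), B p.1 ≤
      4 ^ s * (weight Q s k)⁻¹ * ((weight Q s p.1.1)⁻¹ + (weight Q s p.1.2)⁻¹) := by
    rintro k ⟨⟨a, b⟩, hab⟩
    have ha := hW a
    have hb := hW b
    have hk := hW k
    have hab' : (a : ℂ) + b = k := congrArg Subtype.val hab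
    have h1 := weight_add_le hs a b
    rw [hab'] at h1
    simp only [B]
    have h3 : (4 : ℝ) ^ s * (weight Q s k)⁻¹ * ((weight Q s a)⁻¹ + (weight Q s b)⁻¹) =
        4 ^ s * (weight Q s a + weight Q s b) / weight Q s k * (weight Q s a * weight Q s b)⁻¹ := by
      field_simp; ring
    rw [h3]
    exact le_mul_of_one_le_left (by positivity) ((one_le_div₀ hk).2 h1)
  have hI1 : ∀ k, Summable fun p : F k => (weight Q s p.1.1)⁻¹ := fun k =>
    hI.comp_injective (inj1 k)
  have hI2 : ∀ k, Summable fun p : F k => (weight Q s p.1.2)⁻¹ := fun k =>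
    hI.comp_injective (inj2 k)
  have hBf : ∀ k, Summable fun p : F k => B p.1 := fun k =>
    Summable.of_nonneg_of_le (fun p => hB0 p.1) (hBle k) (((hI1 k).add (hI2 k)).mul_left _)
  have hBsum : ∀ k : quasilattice Q, weight Q s k * ∑' p : F k, B p.1 ≤ 4 ^ s * (2 * M) := by
    intro k
    have e1 : ∑' p : F k, (weight Q s p.1.1)⁻¹ ≤ M :=
      Summable.tsum_le_tsum_of_inj (fun p : F k => p.1.1) (inj1 k)
        (fun c _ => inv_nonneg.2 (hW c).le) (fun _ => le_rfl) (hI1 k) hI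
    have e2 : ∑' p : F k, (weight Q s p.1.2)⁻¹ ≤ M :=
      Summable.tsum_le_tsum_of_inj (fun p : F k => p.1.2) (inj2 k)
        (fun c _ => inv_nonneg.2 (hW c).le) (fun _ => le_rfl) (hI2 k) hI
    have e3 := (hBf k).tsum_le_tsum (hBle k) (((hI1 k).add (hI2 k)).mul_left _)
    rw [tsum_mul_left, (hI1 k).tsum_add (hI2 k)] at e3
    have hk := hW k
    calc weight Q s k * ∑' p : F k, B p.1
        ≤ weight Q s k * (4 ^ s * (weight Q s k)⁻¹ * (M + M)) := by
          gcongr; exact e3.trans (by gcongr)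
      _ = 4 ^ s * (2 * M) := by field_simp; ring
  have hprod : ∀ k (p : F k), √(A p.1) * √(B p.1) = ‖u.coeff p.1.1 * v.coeff p.1.2‖ := by
    intro k p
    have h1 := hW p.1.1
    have h2 := hW p.1.2
    rw [← Real.sqrt_mul (hA0 _), ← Real.sqrt_sq (norm_nonneg (u.coeff p.1.1 * v.coeff p.1.2))]
    congr 1
    simp only [A, B, norm_mul]
    field_simp
  have hsq : ∀ x : ℝ, 0 ≤ x → √x ^ (2 : ℝ) = x := fun x hx => by
    rw [Real.rpow_two, Real.sq_sqrt hx]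
  have hCS := fun k => Real.summable_and_inner_le_Lp_mul_Lq_tsum_of_nonneg
    (f := fun p : F k => √(A p.1)) (g := fun p : F k => √(B p.1)) Real.HolderConjugate.two_two
    (fun _ => Real.sqrt_nonneg _) (fun _ => Real.sqrt_nonneg _)
    (by simpa only [hsq _ (hA0 _)] using hAf k) (by simpa only [hsq _ (hB0 _)] using hBf k)
  simp only [hprod, hsq _ (hA0 _), hsq _ (hB0 _), ← Real.sqrt_eq_rpow] at hCS
  have hAsig := (Equiv.sigmaFiberEquiv
    (fun p : quasilattice Q × quasilattice Q => p.1 + p.2)).summable_iff.2 hA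
  -- The fibres partition all pairs, so summing over them recovers the full double series.
  have hAtot : ∑' k, ∑' p : F k, A p.1 = ‖u‖ ^ 2 * ‖v‖ ^ 2 := by
    rw [norm_sq_eq, norm_sq_eq, u.summable.tsum_mul_tsum v.summable hA,
      ← (Equiv.sigmaFiberEquiv
        (fun p : quasilattice Q × quasilattice Q => p.1 + p.2)).tsum_eq]
    exact (hAsig.tsum_sigma).symm
  refine le_of_sq_le_sq ?_ (by positivity)
  rw [mul_assoc, mul_pow, mul_pow, Real.sq_sqrt (by positivity), ← hAtot, norm_sq_eq,
    ← tsum_mul_left]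
  refine (mul h u v).summable.tsum_le_tsum (fun k => ?_) (hAsig.sigma.mul_left _)
  have h1 : ‖mulCoeff u v k‖ ≤ √(∑' p : F k, A p.1) * √(∑' p : F k, B p.1) :=
    (norm_tsum_le_tsum_norm (hCS k).1).trans (hCS k).2
  have h2 := pow_le_pow_left₀ (norm_nonneg _) h1 2
  rw [mul_pow, Real.sq_sqrt (tsum_nonneg fun p => hA0 _),
    Real.sq_sqrt (tsum_nonneg fun p => hB0 _)] at h2
  calc weight Q s k * ‖mulCoeff u v k‖ ^ 2
      ≤ weight Q s k * ((∑' p : F k, A p.1) * ∑' p : F k, B p.1) := by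
        have := hW k; gcongr
    _ = (weight Q s k * ∑' p : F k, B p.1) * ∑' p : F k, A p.1 := by ring
    _ ≤ _ := mul_le_mul_of_nonneg_right (hBsum k) (tsum_nonneg fun p => hA0 _)

theorem coeff_mul (h : Admissible Q s) (u v : QPSpace Q s) (k : quasilattice Q) :
    (mul h u v).coeff k =
      ∑' p : {p : quasilattice Q × quasilattice Q // p.1 + p.2 = k},
        u.coeff p.1.1 * v.coeff p.1.2 := rfl

/-- The product of `𝓗_s` as a continuous bilinear map. -/
noncomputable def mulCLM (h : Admissible Q s) : QPSpace Q s →L[ℂ] QPSpace Q s →L[ℂ] QPSpace Q s :=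
  LinearMap.mkContinuous₂
    (LinearMap.mk₂ ℂ (mul h)
      (fun u u' v => QPSpace.ext fun k => by
        simp only [coeff_mul, coeff_add, add_mul]
        exact ((mulCoeff_mem h u v).1 k).of_norm.tsum_add ((mulCoeff_mem h u' v).1 k).of_norm)
      (fun c u v => QPSpace.ext fun k => by
        simp only [coeff_mul, coeff_smul, mul_assoc, tsum_mul_left])
      (fun u v v' => QPSpace.ext fun k => by
        simp only [coeff_mul, coeff_add, mul_add]
        exact ((mulCoeff_mem h u v).1 k).of_norm.tsum_add ((mulCoeff_mem h u v').1 k).of_norm)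
      (fun c u v => QPSpace.ext fun k => by
        simp only [coeff_mul, coeff_smul, mul_left_comm _ c, tsum_mul_left]))
    (exists_norm_mul_le h).choose (exists_norm_mul_le h).choose_spec.2

theorem mulCLM_apply (h : Admissible Q s) (u v : QPSpace Q s) : mulCLM h u v = mul h u v := rfl

theorem coeff_mode_self (k : quasilattice Q) : (mode s k).coeff k = 1 := by
  classical
  exact Pi.single_eq_same k 1

theorem coeff_mode_of_ne {k l : quasilattice Q} (hkl : l ≠ k) : (mode s k).coeff l = 0 := by
  classical
  exact Pi.single_eq_of_ne hkl 1

theorem mul_mode_mode (h : Admissible Q s) (k l : quasilattice Q) :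
    mul h (mode s k) (mode s l) = mode s (k + l) := by
  refine QPSpace.ext fun m => ?_
  rw [coeff_mul]
  by_cases hm : k + l = m
  · subst hm
    rw [tsum_eq_single ⟨(k, l), rfl⟩]
    · simp [coeff_mode_self]
    · rintro ⟨⟨p, q⟩, hpq⟩ hne
      by_cases hp : p = k
      · have hq : q ≠ l := by rintro rfl; exact hne (by simp [hp])
        simp [coeff_mode_of_ne hq]
      · simp [coeff_mode_of_ne hp]
  · rw [coeff_mode_of_ne (Ne.symm hm)]
    refine (tsum_congr ?_).trans tsum_zero
    rintro ⟨⟨p, q⟩, hpq⟩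
    by_cases hp : p = k
    · have hq : q ≠ l := by rintro rfl; exact hm (by rw [← hp]; exact hpq)
      simp [coeff_mode_of_ne hq]
    · simp [coeff_mode_of_ne hp]

/-- The product `u v w`, as a trilinear expression. -/
noncomputable def mul₃ (h : Admissible Q s) (u v w : QPSpace Q s) : QPSpace Q s :=
  mul h (mul h u v) w

theorem mul₃_eq (h : Admissible Q s) (u v w : QPSpace Q s) :
    mul₃ h u v w = mulCLM h (mulCLM h u v) w := rfl

theorem exists_norm_mul₃_le (h : Admissible Q s) : ∃ C : ℝ, 0 ≤ C ∧ ∀ u v w : QPSpace Q s,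
    ‖mul₃ h u v w‖ ≤ C * (‖u‖ * ‖v‖ * ‖w‖) := by
  obtain ⟨C, hC, hmul⟩ := exists_norm_mul_le h
  refine ⟨C * C, by positivity, fun u v w => (hmul _ _).trans ?_⟩
  calc C * ‖mul h u v‖ * ‖w‖ ≤ C * (C * ‖u‖ * ‖v‖) * ‖w‖ := by gcongr; exact hmul u v
    _ = _ := by ring

/-! ### Wave vectors as powers of a root of unity. -/

/-- The unit vector at angle `2π/Q`. -/
noncomputable def rotor (Q : ℕ) : ℂ := ⟨Real.cos (2 * Real.pi / Q), Real.sin (2 * Real.pi / Q)⟩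

theorem rotor_eq_exp (Q : ℕ) : rotor Q = Complex.exp ((2 * Real.pi / Q : ℝ) * Complex.I) := by
  apply Complex.ext
  · rw [Complex.exp_ofReal_mul_I_re]; rfl
  · rw [Complex.exp_ofReal_mul_I_im]; rfl

theorem rotor_pow_eq_exp (Q n : ℕ) :
    rotor Q ^ n = Complex.exp ((2 * Real.pi * n / Q : ℝ) * Complex.I) := by
  rw [rotor_eq_exp, ← Complex.exp_nat_mul]
  congr 1
  push_cast
  ring

theorem waveVec_eq_rotor_pow (j : Fin Q) : waveVec Q j = rotor Q ^ (j : ℕ) := by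
  rw [rotor_pow_eq_exp]
  apply Complex.ext
  · rw [Complex.exp_ofReal_mul_I_re]; rfl
  · rw [Complex.exp_ofReal_mul_I_im]; rfl

theorem isPrimitiveRoot_rotor (hQ : Q ≠ 0) : IsPrimitiveRoot (rotor Q) Q := by
  convert Complex.isPrimitiveRoot_exp Q hQ using 1
  rw [rotor_eq_exp]
  congr 1
  push_cast
  ring

theorem norm_rotor (Q : ℕ) : ‖rotor Q‖ = 1 := by
  rw [rotor_eq_exp, Complex.norm_exp_ofReal_mul_I]

theorem rotor_ne_zero (Q : ℕ) : rotor Q ≠ 0 := by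
  rw [← norm_pos_iff, norm_rotor]; exact one_pos

theorem rotor_pow_half {d : ℕ} (hd : d ≠ 0) : rotor (d + d) ^ d = -1 := by
  have hd' : (d : ℝ) ≠ 0 := Nat.cast_ne_zero.2 hd
  rw [rotor_pow_eq_exp, show (2 * Real.pi * d / (d + d : ℕ) : ℝ) = Real.pi by
    push_cast; field_simp; ring]
  exact Complex.exp_pi_mul_I

/-! ### Arithmetic of the quasilattice -/

/-- The cubic polynomial with coefficients `z`, evaluated at `w`. -/
noncomputable def cubicEval (w : ℂ) (z : ℤ × ℤ × ℤ × ℤ) : ℂ :=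
  z.1 + z.2.1 * w + z.2.2.1 * w ^ 2 + z.2.2.2 * w ^ 3

theorem cubicEval_zero (w : ℂ) : cubicEval w 0 = 0 := by simp [cubicEval]

theorem cubicEval_add (w : ℂ) (z z' : ℤ × ℤ × ℤ × ℤ) :
    cubicEval w (z + z') = cubicEval w z + cubicEval w z' := by
  simp only [cubicEval, Prod.fst_add, Prod.snd_add]
  push_cast
  ring

theorem cubicEval_nsmul (w : ℂ) (n : ℕ) (z : ℤ × ℤ × ℤ × ℤ) :
    cubicEval w (n • z) = n * cubicEval w z := by
  induction n with
  | zero => simp [cubicEval_zero]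
  | succ n ih => rw [succ_nsmul, cubicEval_add, ih]; push_cast; ring

/-- The size of a coefficient vector, as the sum of the absolute values. -/
def cubicSize (z : ℤ × ℤ × ℤ × ℤ) : ℤ := |z.1| + |z.2.1| + |z.2.2.1| + |z.2.2.2|

theorem cubicSize_add_le (z z' : ℤ × ℤ × ℤ × ℤ) :
    cubicSize (z + z') ≤ cubicSize z + cubicSize z' := by
  simp only [cubicSize, Prod.fst_add, Prod.snd_add]
  linarith [abs_add_le z.1 z'.1, abs_add_le z.2.1 z'.2.1, abs_add_le z.2.2.1 z'.2.2.1,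
    abs_add_le z.2.2.2 z'.2.2.2]

theorem cubicSize_nsmul_le (n : ℕ) (z : ℤ × ℤ × ℤ × ℤ) :
    cubicSize (n • z) ≤ n * cubicSize z := by
  induction n with
  | zero => simp [cubicSize]
  | succ n ih =>
    rw [succ_nsmul]
    refine (cubicSize_add_le _ _).trans ?_
    push_cast
    linarith

theorem norm_cubicEval_le {w : ℂ} (hw : ‖w‖ = 1) (z : ℤ × ℤ × ℤ × ℤ) :
    ‖cubicEval w z‖ ≤ cubicSize z := by
  have h4 : ∀ a b c d : ℂ, ‖a + b + c + d‖ ≤ ‖a‖ + ‖b‖ + ‖c‖ + ‖d‖ := fun a b c d => by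
    linarith [norm_add_le (a + b + c) d, norm_add_le (a + b) c, norm_add_le a b]
  refine (h4 _ _ _ _).trans (le_of_eq ?_)
  simp [hw, cubicSize]

/-- Passing from an optimal representation by wave vectors to integer coordinates loses only a
factor 4, which becomes the 16 in the small divisor bound. -/
theorem exists_cubicEval_eq {w : ℂ} {Z : Fin Q → ℤ × ℤ × ℤ × ℤ}
    (hZ : ∀ j, waveVec Q j = cubicEval w (Z j)) (hZ4 : ∀ j, cubicSize (Z j) ≤ 4)
    (k : quasilattice Q) :
    ∃ z, (k : ℂ) = cubicEval w z ∧ cubicSize z ≤ 4 * order Q k := by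
  obtain ⟨m, hm, hm'⟩ := exists_order_eq k
  have key : ∀ t : Finset (Fin Q),
      (∑ j ∈ t, (m j : ℂ) * waveVec Q j = cubicEval w (∑ j ∈ t, m j • Z j)) ∧
      cubicSize (∑ j ∈ t, m j • Z j) ≤ 4 * ((∑ j ∈ t, m j : ℕ) : ℤ) := by
    intro t
    induction t using Finset.induction_on with
    | empty => simp [cubicEval_zero, cubicSize]
    | insert j t hj ih =>
      rw [Finset.sum_insert hj, Finset.sum_insert hj, Finset.sum_insert hj]
      refine ⟨by rw [cubicEval_add, cubicEval_nsmul, ih.1, hZ], (cubicSize_add_le _ _).trans ?_⟩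
      have h1 := cubicSize_nsmul_le (m j) (Z j)
      have h2 : (m j : ℤ) * cubicSize (Z j) ≤ m j * 4 :=
        mul_le_mul_of_nonneg_left (hZ4 j) (Nat.cast_nonneg _)
      push_cast
      push_cast at ih
      linarith [ih.2]
  refine ⟨_, hm.symm.trans (key Finset.univ).1, ?_⟩
  rw [← hm']
  exact (key Finset.univ).2

/-- Otherwise √p = |u/v| would be rational. -/
theorem eq_zero_of_sq_eq_prime_mul_sq {p : ℕ} (hp : p.Prime) {u v : ℤ} (huv : u ^ 2 = p * v ^ 2) :
    v = 0 := by
  by_contra hv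
  refine hp.irrational_sqrt ⟨|(u / v : ℚ)|, ?_⟩
  have hv' : (v : ℝ) ≠ 0 := Int.cast_ne_zero.2 hv
  have huv' : (u : ℝ) ^ 2 = p * v ^ 2 := by exact_mod_cast huv
  push_cast
  rw [← Real.sqrt_sq_eq_abs, div_pow, huv', mul_div_assoc, div_self (by positivity), mul_one]

/-- The dichotomy for the distance to the unit circle of the points of a quasilattice of rank four:
`|k|²` is `A + B c` with a quadratic irrationality `c`, and its conjugate `A + B c'` is of the
same kind. -/
theorem unit_or_small_divisor {w w' : ℂ} (hw' : ‖w'‖ = 1) {c c' : ℝ}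
    {τ ν e : ℤ} {p : ℕ} (hp : p.Prime) (hsum : c + c' = τ) (hprod : c * c' = ν)
    (he : e ≠ 0) (hdisc : τ ^ 2 - 4 * ν = p * e ^ 2) {A B : ℤ × ℤ × ℤ × ℤ → ℤ}
    (hA : ∀ z, ‖cubicEval w z‖ ^ 2 = A z + B z * c)
    (hA' : ∀ z, ‖cubicEval w' z‖ ^ 2 = A z + B z * c')
    {Z : Fin Q → ℤ × ℤ × ℤ × ℤ}
    (hZ : ∀ j, waveVec Q j = cubicEval w (Z j)) (hZ4 : ∀ j, cubicSize (Z j) ≤ 4)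
    (hunit : ∀ z, A z = 1 → B z = 0 → ∃ j, z = Z j) (k : quasilattice Q) :
    (∃ j, (k : ℂ) = waveVec Q j) ∨
      1 ≤ (1 + 16 * (order Q k : ℝ) ^ 2) * |1 - ‖(k : ℂ)‖ ^ 2| := by
  obtain ⟨z, hz, hzN⟩ := exists_cubicEval_eq hZ hZ4 k
  -- The field norm of 1 - |k|², expanded through the trace τ and the norm ν of c.
  set n : ℤ := (A z - 1) ^ 2 + (A z - 1) * B z * τ + B z ^ 2 * ν with hn
  have hnorm : ((1 - ‖(k : ℂ)‖ ^ 2) * (1 - ‖cubicEval w' z‖ ^ 2) : ℝ) = n := by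
    rw [hz, hA, hA', hn]
    push_cast
    rw [← hsum, ← hprod]
    ring
  by_cases h0 : n = 0
  · left
    -- Completing the square in n = 0; the discriminant is p e², not a square, so both coordinates
    -- of 1 - |k|² vanish.
    have h1 : (2 * (A z - 1) + B z * τ) ^ 2 = p * (e * B z) ^ 2 := by
      linear_combination 4 * hn.symm.trans h0 + (B z) ^ 2 * hdisc
    have hB : B z = 0 := by
      have := eq_zero_of_sq_eq_prime_mul_sq hp h1
      exact (mul_eq_zero.1 this).resolve_left he
    have hA1 : A z = 1 := by
      rw [hn, hB] at h0
      have : (A z - 1) ^ 2 = 0 := by linear_combination h0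
      linarith [pow_eq_zero_iff (two_ne_zero) |>.1 this]
    obtain ⟨j, rfl⟩ := hunit z hA1 hB
    exact ⟨j, hz.trans (hZ j).symm⟩
  · right
    have h1 : (1 : ℝ) ≤ |(n : ℝ)| := by exact_mod_cast Int.one_le_abs h0
    rw [← hnorm, abs_mul, mul_comm] at h1
    refine h1.trans (mul_le_mul_of_nonneg_right ?_ (abs_nonneg _))
    -- The conjugate point obeys the same size bound because w' is also unimodular.
    have h2 : ‖cubicEval w' z‖ ≤ 4 * order Q k :=
      (norm_cubicEval_le hw' z).trans (by exact_mod_cast hzN)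
    have h3 := norm_nonneg (cubicEval w' z)
    rw [abs_le]
    constructor <;> nlinarith

/-- Conjugation inverts w, so only the sums w^j + w^{-j} occur; for j = 1, 2, 3 these are c, c² - 2
and c³ - 3c. -/
theorem norm_sq_cubicEval {w : ℂ} (hw : ‖w‖ = 1) {c : ℝ} (hc : (c : ℂ) = w + w⁻¹)
    (z : ℤ × ℤ × ℤ × ℤ) :
    ‖cubicEval w z‖ ^ 2 = z.1 ^ 2 + z.2.1 ^ 2 + z.2.2.1 ^ 2 + z.2.2.2 ^ 2 +
      (z.1 * z.2.1 + z.2.1 * z.2.2.1 + z.2.2.1 * z.2.2.2) * c +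
      (z.1 * z.2.2.1 + z.2.1 * z.2.2.2) * (c ^ 2 - 2) + z.1 * z.2.2.2 * (c ^ 3 - 3 * c) := by
  obtain ⟨p, q, r, t⟩ := z
  have hw0 : w ≠ 0 := by rw [← norm_pos_iff, hw]; exact one_pos
  have hconj : (starRingEnd ℂ) w = w⁻¹ := (Complex.inv_eq_conj hw).symm
  apply Complex.ofReal_injective
  push_cast
  rw [← Complex.mul_conj', hc]
  simp only [cubicEval, map_add, map_mul, map_pow, map_intCast, hconj]
  field_simp
  ring

theorem exists_real_eq_add_inv {w : ℂ} (hw : ‖w‖ = 1) : ∃ c : ℝ, (c : ℂ) = w + w⁻¹ :=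
  ⟨2 * w.re, by rw [Complex.inv_eq_conj hw, Complex.add_conj]⟩

/-- The coordinates of the wave vectors for `Q = 8`. -/
def table8 : Fin 8 → ℤ × ℤ × ℤ × ℤ :=
  ![(1, 0, 0, 0), (0, 1, 0, 0), (0, 0, 1, 0), (0, 0, 0, 1),
    (-1, 0, 0, 0), (0, -1, 0, 0), (0, 0, -1, 0), (0, 0, 0, -1)]

/-- The coordinates of the wave vectors for `Q = 10`. -/
def table10 : Fin 10 → ℤ × ℤ × ℤ × ℤ :=
  ![(1, 0, 0, 0), (0, 1, 0, 0), (0, 0, 1, 0), (0, 0, 0, 1), (-1, 1, -1, 1),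
    (-1, 0, 0, 0), (0, -1, 0, 0), (0, 0, -1, 0), (0, 0, 0, -1), (1, -1, 1, -1)]

/-- The coordinates of the wave vectors for `Q = 12`. -/
def table12 : Fin 12 → ℤ × ℤ × ℤ × ℤ :=
  ![(1, 0, 0, 0), (0, 1, 0, 0), (0, 0, 1, 0), (0, 0, 0, 1), (-1, 0, 1, 0), (0, -1, 0, 1),
    (-1, 0, 0, 0), (0, -1, 0, 0), (0, 0, -1, 0), (0, 0, 0, -1), (1, 0, -1, 0), (0, 1, 0, -1)]

theorem mem_Icc_of_sq_lt {a : ℤ} (ha : a ^ 2 < 4) : a ∈ Finset.Icc (-1 : ℤ) 1 := by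
  rw [Finset.mem_Icc]; constructor <;> nlinarith

theorem exists_table8 : ∀ p ∈ Finset.Icc (-1 : ℤ) 1, ∀ q ∈ Finset.Icc (-1 : ℤ) 1,
    ∀ r ∈ Finset.Icc (-1 : ℤ) 1, ∀ t ∈ Finset.Icc (-1 : ℤ) 1,
    p ^ 2 + q ^ 2 + r ^ 2 + t ^ 2 = 1 → ∃ j, (p, q, r, t) = table8 j := by
  decide +kernel

/-- The quadratic form is 2A + B, the trace of |k|². Being positive definite, it bounds the
coordinates and reduces the claim to a finite check. -/
theorem exists_table10 : ∀ p ∈ Finset.Icc (-1 : ℤ) 1, ∀ q ∈ Finset.Icc (-1 : ℤ) 1,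
    ∀ r ∈ Finset.Icc (-1 : ℤ) 1, ∀ t ∈ Finset.Icc (-1 : ℤ) 1,
    2 * (p ^ 2 + q ^ 2 + r ^ 2 + t ^ 2) + (p * q + q * r + r * t) - (p * r + q * t) + p * t = 2 →
      ∃ j, (p, q, r, t) = table10 j := by
  decide +kernel

theorem exists_table12 : ∀ p ∈ Finset.Icc (-1 : ℤ) 1, ∀ q ∈ Finset.Icc (-1 : ℤ) 1,
    ∀ r ∈ Finset.Icc (-1 : ℤ) 1, ∀ t ∈ Finset.Icc (-1 : ℤ) 1,
    p ^ 2 + q ^ 2 + r ^ 2 + t ^ 2 + (p * r + q * t) = 1 → ∃ j, (p, q, r, t) = table12 j := by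
  decide +kernel

/-- Here c² = 2, and ω ↦ -ω realizes the conjugation c ↦ -c. The rational part A is the sum of four
squares, so A = 1 leaves only signed coordinate vectors. -/
theorem unit_or_small_divisor_eight (k : quasilattice 8) :
    (∃ j, (k : ℂ) = waveVec 8 j) ∨
      1 ≤ (1 + 16 * (order 8 k : ℝ) ^ 2) * |1 - ‖(k : ℂ)‖ ^ 2| := by
  have hw := norm_rotor 8
  have hw0 := rotor_ne_zero 8
  have h4 : rotor 8 ^ 4 = -1 := rotor_pow_half (d := 4) (by norm_num)
  obtain ⟨c, hc⟩ := exists_real_eq_add_inv hw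
  have hc2 : c ^ 2 = 2 := by
    apply Complex.ofReal_injective
    push_cast
    rw [hc]
    field_simp
    linear_combination h4
  have hc' : ((-c : ℝ) : ℂ) = -rotor 8 + (-rotor 8)⁻¹ := by
    push_cast; rw [hc, inv_neg]; ring
  have hw' : ‖-rotor 8‖ = 1 := by rw [norm_neg, hw]
  refine unit_or_small_divisor (w := rotor 8) (w' := -rotor 8) hw' (c := c) (c' := -c) (τ := 0)
    (ν := -2) (e := 2) Nat.prime_two (by simp) (by push_cast; linear_combination -hc2) (by norm_num)
    (by norm_num)
    (A := fun z => z.1 ^ 2 + z.2.1 ^ 2 + z.2.2.1 ^ 2 + z.2.2.2 ^ 2)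
    (B := fun z => z.1 * z.2.1 + z.2.1 * z.2.2.1 + z.2.2.1 * z.2.2.2 - z.1 * z.2.2.2)
    (fun z => ?_) (fun z => ?_) (Z := table8) (fun j => ?_) (by decide) ?_ k
  · rw [norm_sq_cubicEval hw hc]
    push_cast
    linear_combination ((z.1 : ℝ) * z.2.2.1 + z.2.1 * z.2.2.2 + c * z.1 * z.2.2.2) * hc2
  · rw [norm_sq_cubicEval hw' hc']
    push_cast
    linear_combination ((z.1 : ℝ) * z.2.2.1 + z.2.1 * z.2.2.2 - c * z.1 * z.2.2.2) * hc2
  · rw [waveVec_eq_rotor_pow]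
    generalize rotor 8 = x at h4
    fin_cases j <;> simp [cubicEval, table8] <;> grind
  · rintro ⟨p, q, r, t⟩ h1 -
    simp only at h1
    exact exists_table8 p (mem_Icc_of_sq_lt (by nlinarith)) q (mem_Icc_of_sq_lt (by nlinarith))
      r (mem_Icc_of_sq_lt (by nlinarith)) t (mem_Icc_of_sq_lt (by nlinarith)) h1

/-- Here c² = 3, again with ω ↦ -ω. The rational part A is the sum of two hexagonal forms, in (p, r)
and (q, t), each of which takes the value 1 at six vectors. -/
theorem unit_or_small_divisor_twelve (k : quasilattice 12) :
    (∃ j, (k : ℂ) = waveVec 12 j) ∨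
      1 ≤ (1 + 16 * (order 12 k : ℝ) ^ 2) * |1 - ‖(k : ℂ)‖ ^ 2| := by
  have hw := norm_rotor 12
  have hw0 := rotor_ne_zero 12
  have h6 : rotor 12 ^ 6 = -1 := rotor_pow_half (d := 6) (by norm_num)
  -- The twelfth cyclotomic relation: ω⁶ + 1 divided by ω² + 1, which is nonzero since ω⁴ ≠ 1.
  have h4 : rotor 12 ^ 4 = rotor 12 ^ 2 - 1 := by
    have h2 : rotor 12 ^ 2 + 1 ≠ 0 := fun h => by
      have := (isPrimitiveRoot_rotor (Q := 12) (by norm_num)).pow_ne_one_of_pos_of_lt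
        (l := 4) (by norm_num) (by norm_num)
      exact this (by linear_combination (rotor 12 ^ 2 - 1) * h)
    refine sub_eq_zero.1 ((mul_eq_zero.1 ?_).resolve_left h2)
    linear_combination h6
  obtain ⟨c, hc⟩ := exists_real_eq_add_inv hw
  have hc2 : c ^ 2 = 3 := by
    apply Complex.ofReal_injective
    push_cast
    rw [hc]
    field_simp
    linear_combination h4
  have hc' : ((-c : ℝ) : ℂ) = -rotor 12 + (-rotor 12)⁻¹ := by
    push_cast; rw [hc, inv_neg]; ring
  have hw' : ‖-rotor 12‖ = 1 := by rw [norm_neg, hw]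
  refine unit_or_small_divisor (w := rotor 12) (w' := -rotor 12) hw' (c := c) (c' := -c) (τ := 0)
    (ν := -3) (e := 2) Nat.prime_three (by simp) (by push_cast; linear_combination -hc2)
    (by norm_num) (by norm_num)
    (A := fun z => z.1 ^ 2 + z.2.1 ^ 2 + z.2.2.1 ^ 2 + z.2.2.2 ^ 2 +
      (z.1 * z.2.2.1 + z.2.1 * z.2.2.2))
    (B := fun z => z.1 * z.2.1 + z.2.1 * z.2.2.1 + z.2.2.1 * z.2.2.2)
    (fun z => ?_) (fun z => ?_) (Z := table12) (fun j => ?_) (by decide) ?_ k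
  · rw [norm_sq_cubicEval hw hc]
    push_cast
    linear_combination ((z.1 : ℝ) * z.2.2.1 + z.2.1 * z.2.2.2 + c * z.1 * z.2.2.2) * hc2
  · rw [norm_sq_cubicEval hw' hc']
    push_cast
    linear_combination ((z.1 : ℝ) * z.2.2.1 + z.2.1 * z.2.2.2 - c * z.1 * z.2.2.2) * hc2
  · rw [waveVec_eq_rotor_pow]
    generalize rotor 12 = x at h4
    fin_cases j <;> simp [cubicEval, table12] <;> grind
  · rintro ⟨p, q, r, t⟩ h1 -
    simp only at h1
    exact exists_table12 p
      (mem_Icc_of_sq_lt (by nlinarith [sq_nonneg (p + 2 * r), sq_nonneg (q + 2 * t), sq_nonneg t]))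
      q (mem_Icc_of_sq_lt (by nlinarith [sq_nonneg (p + 2 * r), sq_nonneg (q + 2 * t), sq_nonneg p]))
      r (mem_Icc_of_sq_lt (by nlinarith [sq_nonneg (r + 2 * p), sq_nonneg (t + 2 * q), sq_nonneg t]))
      t (mem_Icc_of_sq_lt (by nlinarith [sq_nonneg (r + 2 * p), sq_nonneg (t + 2 * q), sq_nonneg r]))
      h1

/-- Here c² = c + 1, and the conjugation c ↦ 1 - c comes from ω ↦ ω³. -/
theorem unit_or_small_divisor_ten (k : quasilattice 10) :
    (∃ j, (k : ℂ) = waveVec 10 j) ∨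
      1 ≤ (1 + 16 * (order 10 k : ℝ) ^ 2) * |1 - ‖(k : ℂ)‖ ^ 2| := by
  have hw := norm_rotor 10
  have hw0 := rotor_ne_zero 10
  have h5 : rotor 10 ^ 5 = -1 := rotor_pow_half (d := 5) (by norm_num)
  have h4 : rotor 10 ^ 4 = rotor 10 ^ 3 - rotor 10 ^ 2 + rotor 10 - 1 := by
    have h2 : rotor 10 + 1 ≠ 0 := fun h => by
      have := (isPrimitiveRoot_rotor (Q := 10) (by norm_num)).pow_ne_one_of_pos_of_lt
        (l := 2) (by norm_num) (by norm_num)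
      exact this (by linear_combination (rotor 10 - 1) * h)
    refine sub_eq_zero.1 ((mul_eq_zero.1 ?_).resolve_left h2)
    linear_combination h5
  obtain ⟨c, hc⟩ := exists_real_eq_add_inv hw
  have hc2 : c ^ 2 = c + 1 := by
    apply Complex.ofReal_injective
    push_cast
    rw [hc]
    field_simp
    linear_combination h4
  have hc' : ((1 - c : ℝ) : ℂ) = rotor 10 ^ 3 + (rotor 10 ^ 3)⁻¹ := by
    push_cast
    rw [hc]
    field_simp
    linear_combination -(rotor 10) ^ 2 * h4 - h5
  have hw' : ‖rotor 10 ^ 3‖ = 1 := by rw [norm_pow, hw, one_pow]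
  have hd2 : (1 - c) ^ 2 = (1 - c) + 1 := by linear_combination hc2
  refine unit_or_small_divisor (w := rotor 10) (w' := rotor 10 ^ 3) hw' (c := c) (c' := 1 - c)
    (τ := 1) (ν := -1) (e := 1) Nat.prime_five (by simp) (by push_cast; linear_combination -hc2)
    (by norm_num) (by norm_num)
    (A := fun z => z.1 ^ 2 + z.2.1 ^ 2 + z.2.2.1 ^ 2 + z.2.2.2 ^ 2 -
      (z.1 * z.2.2.1 + z.2.1 * z.2.2.2) + z.1 * z.2.2.2)
    (B := fun z => z.1 * z.2.1 + z.2.1 * z.2.2.1 + z.2.2.1 * z.2.2.2 +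
      (z.1 * z.2.2.1 + z.2.1 * z.2.2.2) - z.1 * z.2.2.2)
    (fun z => ?_) (fun z => ?_) (Z := table10) (fun j => ?_) (by decide) ?_ k
  · rw [norm_sq_cubicEval hw hc]
    push_cast
    linear_combination ((z.1 : ℝ) * z.2.2.1 + z.2.1 * z.2.2.2 + (c + 1) * z.1 * z.2.2.2) * hc2
  · rw [norm_sq_cubicEval hw' hc']
    push_cast
    linear_combination
      ((z.1 : ℝ) * z.2.2.1 + z.2.1 * z.2.2.2 + ((1 - c) + 1) * z.1 * z.2.2.2) * hd2
  · rw [waveVec_eq_rotor_pow]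
    generalize rotor 10 = x at h4
    fin_cases j <;> simp [cubicEval, table10] <;> grind
  · rintro ⟨p, q, r, t⟩ h1 h2
    simp only at h1 h2
    have h3 : 2 * (p ^ 2 + q ^ 2 + r ^ 2 + t ^ 2) + (p * q + q * r + r * t) - (p * r + q * t) +
        p * t = 2 := by linear_combination 2 * h1 + h2
    -- Twice the trace form is the sum of squared differences of the five numbers 0, p, -q, r, -t.
    have h6 : p ^ 2 + q ^ 2 + r ^ 2 + t ^ 2 + (p + q) ^ 2 + (p - r) ^ 2 + (p + t) ^ 2 +
        (q + r) ^ 2 + (q - t) ^ 2 + (r + t) ^ 2 = 4 := by linear_combination 2 * h3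
    have hp : p ^ 2 < 4 := by
      nlinarith [sq_nonneg (p + 2 * q), sq_nonneg (p - 2 * r), sq_nonneg (p + 2 * t),
        sq_nonneg (q + r), sq_nonneg (q - t), sq_nonneg (r + t)]
    have hq : q ^ 2 < 4 := by
      nlinarith [sq_nonneg (q + 2 * p), sq_nonneg (q + 2 * r), sq_nonneg (q - 2 * t),
        sq_nonneg (p - r), sq_nonneg (p + t), sq_nonneg (r + t)]
    have hr : r ^ 2 < 4 := by
      nlinarith [sq_nonneg (r - 2 * p), sq_nonneg (r + 2 * q), sq_nonneg (r + 2 * t),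
        sq_nonneg (p + q), sq_nonneg (p + t), sq_nonneg (q - t)]
    have ht : t ^ 2 < 4 := by
      nlinarith [sq_nonneg (t + 2 * p), sq_nonneg (t - 2 * q), sq_nonneg (t + 2 * r),
        sq_nonneg (p + q), sq_nonneg (p - r), sq_nonneg (q + r)]
    exact exists_table10 p (mem_Icc_of_sq_lt hp) q (mem_Icc_of_sq_lt hq)
      r (mem_Icc_of_sq_lt hr) t (mem_Icc_of_sq_lt ht) h3

theorem waveVec_or_small_divisor (hQ : Q = 8 ∨ Q = 10 ∨ Q = 12) (k : quasilattice Q) :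
    (∃ j, (k : ℂ) = waveVec Q j) ∨
      1 ≤ (1 + 16 * (order Q k : ℝ) ^ 2) * |1 - ‖(k : ℂ)‖ ^ 2| := by
  rcases hQ with rfl | rfl | rfl
  · exact unit_or_small_divisor_eight k
  · exact unit_or_small_divisor_ten k
  · exact unit_or_small_divisor_twelve k

/-! ### Rotations -/

theorem rotor_pow_self (hQ : Q ≠ 0) : rotor Q ^ Q = 1 := (isPrimitiveRoot_rotor hQ).pow_eq_one

theorem rotor_pow_mem (hQ : Q ≠ 0) (n : ℕ) : rotor Q ^ n ∈ quasilattice Q := by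
  have : rotor Q ^ n = waveVec Q ⟨n % Q, Nat.mod_lt n (Nat.pos_of_ne_zero hQ)⟩ := by
    rw [waveVec_eq_rotor_pow, ← pow_mod_orderOf, ← (isPrimitiveRoot_rotor hQ).eq_orderOf]
  rw [this]
  exact waveVec_mem Q _

theorem rotor_pow_mul_mem (n : ℕ) (k : quasilattice Q) : rotor Q ^ n * (k : ℂ) ∈ quasilattice Q := by
  obtain ⟨m, hm⟩ := k.2
  rw [← hm, waveSum, Finset.mul_sum]
  refine sum_mem fun j _ => ?_
  have hQ : Q ≠ 0 := j.pos.ne'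
  rw [waveVec_eq_rotor_pow, mul_left_comm, ← pow_add, ← nsmul_eq_mul]
  exact nsmul_mem (rotor_pow_mem hQ _) _

/-- The rotation of the quasilattice by the angle `2π/Q`. -/
noncomputable def rotEquiv (hQ : Q ≠ 0) : quasilattice Q ≃ quasilattice Q where
  toFun k := ⟨rotor Q * k, by simpa using rotor_pow_mul_mem 1 k⟩
  invFun k := ⟨rotor Q ^ (Q - 1) * k, rotor_pow_mul_mem _ k⟩
  left_inv k := Subtype.ext <| by
    show rotor Q ^ (Q - 1) * (rotor Q * (k : ℂ)) = k
    rw [← mul_assoc, pow_sub_one_mul hQ, rotor_pow_self hQ, one_mul]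
  right_inv k := Subtype.ext <| by
    show rotor Q * (rotor Q ^ (Q - 1) * (k : ℂ)) = k
    rw [← mul_assoc, mul_pow_sub_one hQ, rotor_pow_self hQ, one_mul]

theorem coe_rotEquiv (hQ : Q ≠ 0) (k : quasilattice Q) : (rotEquiv hQ k : ℂ) = rotor Q * k := rfl

theorem rotEquiv_add (hQ : Q ≠ 0) (k l : quasilattice Q) :
    rotEquiv hQ (k + l) = rotEquiv hQ k + rotEquiv hQ l :=
  Subtype.ext (mul_add _ _ _)

theorem rotInvariant_iff (hQ : Q ≠ 0) {u : QPSpace Q s} :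
    RotInvariant u ↔ ∀ k, u.coeff (rotEquiv hQ k) = u.coeff k :=
  ⟨fun hu k => hu k _ rfl, fun hu k k' hk => by
    rw [← hu k]; exact congrArg _ (Subtype.ext hk)⟩

/-- The subspace of the rotation invariant functions. -/
def rotSubmodule (Q : ℕ) (s : ℝ) : Submodule ℂ (QPSpace Q s) where
  carrier := {u | RotInvariant u}
  zero_mem' := fun _ _ _ => rfl
  add_mem' := fun {u v} hu hv k k' hk => by rw [coeff_add, coeff_add, hu k k' hk, hv k k' hk]
  smul_mem' := fun c u hu k k' hk => by rw [coeff_smul, coeff_smul, hu k k' hk]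

theorem mem_rotSubmodule {u : QPSpace Q s} : u ∈ rotSubmodule Q s ↔ RotInvariant u := Iff.rfl

theorem Admissible.ne_zero (h : Admissible Q s) : Q ≠ 0 := by have := h.2.1; omega

/-- The rotation is an additive automorphism of Γ, so it maps the pairs with sum k bijectively onto
the pairs whose sum is the rotated k. -/
theorem mul_mem_rotSubmodule (h : Admissible Q s) {u v : QPSpace Q s} (hu : u ∈ rotSubmodule Q s)
    (hv : v ∈ rotSubmodule Q s) : mul h u v ∈ rotSubmodule Q s := by
  rw [mem_rotSubmodule, rotInvariant_iff h.ne_zero] at hu hv ⊢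
  intro k
  rw [coeff_mul, coeff_mul]
  let E : {p : quasilattice Q × quasilattice Q // p.1 + p.2 = k} ≃
      {p : quasilattice Q × quasilattice Q // p.1 + p.2 = rotEquiv h.ne_zero k} :=
    ((rotEquiv (Q := Q) h.ne_zero).prodCongr (rotEquiv h.ne_zero)).subtypeEquiv fun p => by
      show _ ↔ rotEquiv h.ne_zero p.1 + rotEquiv h.ne_zero p.2 = _
      rw [← rotEquiv_add, (rotEquiv h.ne_zero).apply_eq_iff_eq]
  rw [← E.tsum_eq]
  refine tsum_congr fun p => ?_
  show u.coeff (rotEquiv h.ne_zero p.1.1) * v.coeff (rotEquiv h.ne_zero p.1.2) = _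
  rw [hu, hv]

theorem mul₃_mem_rotSubmodule (h : Admissible Q s) {u v w : QPSpace Q s}
    (hu : u ∈ rotSubmodule Q s) (hv : v ∈ rotSubmodule Q s) (hw : w ∈ rotSubmodule Q s) :
    mul₃ h u v w ∈ rotSubmodule Q s :=
  mul_mem_rotSubmodule h (mul_mem_rotSubmodule h hu hv) hw

/-! ### The kernel of the linear operator -/

/-- The wave vector with index `j` as a point of the quasilattice. -/
noncomputable def wavePoint (Q : ℕ) (j : Fin Q) : quasilattice Q := ⟨waveVec Q j, waveVec_mem Q j⟩

theorem waveVec_injective : Function.Injective (waveVec Q) := by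
  intro i j hij
  rw [waveVec_eq_rotor_pow, waveVec_eq_rotor_pow] at hij
  exact Fin.ext ((isPrimitiveRoot_rotor i.pos.ne').pow_inj i.2 j.2 hij)

theorem wavePoint_injective : Function.Injective (wavePoint Q) := fun _ _ hij =>
  waveVec_injective (congrArg Subtype.val hij)

theorem order_wavePoint_le (j : Fin Q) : order Q (wavePoint Q j) ≤ 1 :=
  Nat.sInf_le ⟨Pi.single j 1, by simp [waveSum, Pi.single_apply, wavePoint], by simp⟩

/-- The pattern `∑_j exp(i k_j·x)`. -/
noncomputable def basicPattern (Q : ℕ) (s : ℝ) : QPSpace Q s := ∑ j, mode s (wavePoint Q j)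

theorem coeff_basicPattern_wavePoint (j : Fin Q) :
    (basicPattern Q s).coeff (wavePoint Q j) = 1 := by
  rw [basicPattern, coeff_sum, Finset.sum_eq_single j, coeff_mode_self]
  · exact fun i _ hi => coeff_mode_of_ne fun hij => hi (wavePoint_injective hij.symm)
  · simp

theorem coeff_basicPattern_of_ne {k : quasilattice Q} (hk : ∀ j, k ≠ wavePoint Q j) :
    (basicPattern Q s).coeff k = 0 := by
  rw [basicPattern, coeff_sum]
  exact Finset.sum_eq_zero fun j _ => coeff_mode_of_ne (hk j)

/-- The symbol `(1 - |k|²)²` of the linear operator. -/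
noncomputable def symb (k : quasilattice Q) : ℝ := (1 - ‖(k : ℂ)‖ ^ 2) ^ 2

theorem coeff_linOp (u : QPSpace Q s) (k : quasilattice Q) :
    (linOp u).coeff k = symb k * u.coeff k := by
  rw [symb]; rfl

theorem coeff_emb (u : QPSpace Q s) (k : quasilattice Q) : (emb u).coeff k = u.coeff k := by
  simp only [emb, coeff]

theorem symb_nonneg (k : quasilattice Q) : 0 ≤ symb k := sq_nonneg _

theorem symb_wavePoint (j : Fin Q) : symb (wavePoint Q j) = 0 := by
  simp [symb, wavePoint, norm_waveVec]

theorem wavePoint_or_small_divisor (hQ : Q = 8 ∨ Q = 10 ∨ Q = 12) (k : quasilattice Q) :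
    (∃ j, k = wavePoint Q j) ∨ 1 ≤ (1 + 16 * (order Q k : ℝ) ^ 2) ^ 2 * symb k := by
  refine (waveVec_or_small_divisor hQ k).imp (fun ⟨j, hj⟩ => ⟨j, Subtype.ext hj⟩) fun hk => ?_
  have := pow_le_pow_left₀ zero_le_one hk 2
  rwa [one_pow, mul_pow, sq_abs] at this

theorem symb_ne_zero (hQ : Q = 8 ∨ Q = 10 ∨ Q = 12) {k : quasilattice Q}
    (hk : ∀ j, k ≠ wavePoint Q j) : symb k ≠ 0 := fun h0 => by
  rcases wavePoint_or_small_divisor hQ k with ⟨j, hj⟩ | h1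
  · exact hk j hj
  · rw [h0] at h1; norm_num at h1

theorem symb_mul_coeff_basicPattern (k : quasilattice Q) :
    (symb k : ℂ) * (basicPattern Q s).coeff k = 0 := by
  by_cases hk : ∃ j, k = wavePoint Q j
  · obtain ⟨j, rfl⟩ := hk
    simp [symb_wavePoint]
  · push Not at hk
    rw [coeff_basicPattern_of_ne hk, mul_zero]

theorem rotEquiv_wavePoint (hQ : Q ≠ 0) (j : Fin Q) : rotEquiv hQ (wavePoint Q j) =
    wavePoint Q ⟨(j + 1) % Q, Nat.mod_lt _ (Nat.pos_of_ne_zero hQ)⟩ := by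
  refine Subtype.ext ?_
  show rotor Q * waveVec Q j = waveVec Q _
  rw [waveVec_eq_rotor_pow, waveVec_eq_rotor_pow, ← pow_succ', ← pow_mod_orderOf,
    ← (isPrimitiveRoot_rotor hQ).eq_orderOf]

/-- The first wave vector. -/
noncomputable def basePoint (h : Admissible Q s) : quasilattice Q :=
  wavePoint Q ⟨0, Nat.pos_of_ne_zero h.ne_zero⟩

/-- The coefficient at the first wave vector, as a functional. -/
noncomputable def baseCoeff (h : Admissible Q s) : QPSpace Q s →L[ℂ] ℂ := coeffCLM s (basePoint h)

theorem baseCoeff_basicPattern (h : Admissible Q s) : baseCoeff h (basicPattern Q s) = 1 :=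
  coeff_basicPattern_wavePoint _

theorem symb_basePoint (h : Admissible Q s) : symb (basePoint h) = 0 := symb_wavePoint _

/-- The rotation permutes the wave vectors cyclically. This makes the invariant kernel
one-dimensional and leaves a single solvability condition. -/
theorem coeff_wavePoint_eq_baseCoeff (h : Admissible Q s) {u : QPSpace Q s}
    (hu : u ∈ rotSubmodule Q s) (j : Fin Q) : u.coeff (wavePoint Q j) = baseCoeff h u := by
  rw [mem_rotSubmodule, rotInvariant_iff h.ne_zero] at hu
  obtain ⟨n, hn⟩ := j
  induction n with
  | zero => rfl
  | succ n ih =>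
    rw [← ih (n.lt_succ_self.trans hn), ← hu (wavePoint Q ⟨n, _⟩), rotEquiv_wavePoint]
    simp only [Nat.mod_eq_of_lt hn]

theorem basicPattern_mem_rotSubmodule : basicPattern Q s ∈ rotSubmodule Q s := by
  by_cases hQ : Q = 0
  · subst hQ
    simp [basicPattern]
  rw [mem_rotSubmodule, rotInvariant_iff hQ]
  have key : ∀ k, (∃ j, k = wavePoint Q j) → ∃ j, rotEquiv hQ k = wavePoint Q j := by
    rintro _ ⟨j, rfl⟩
    exact ⟨_, rotEquiv_wavePoint hQ j⟩
  have key' : ∀ k, (∃ j, rotEquiv hQ k = wavePoint Q j) → ∃ j, k = wavePoint Q j := by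
    rintro k ⟨j, hj⟩
    refine ⟨⟨(j + (Q - 1)) % Q, Nat.mod_lt _ (Nat.pos_of_ne_zero hQ)⟩,
      (rotEquiv hQ).injective (hj.trans ?_)⟩
    rw [rotEquiv_wavePoint]
    refine congrArg _ (Fin.ext ?_)
    show (j : ℕ) = ((j + (Q - 1)) % Q + 1) % Q
    rw [Nat.mod_add_mod, show (j : ℕ) + (Q - 1) + 1 = j + Q by omega, Nat.add_mod_right,
      Nat.mod_eq_of_lt j.2]
  intro k
  by_cases hk : ∃ j, k = wavePoint Q j
  · obtain ⟨i, hi⟩ := key k hk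
    obtain ⟨j, rfl⟩ := hk
    rw [hi, coeff_basicPattern_wavePoint, coeff_basicPattern_wavePoint]
  · have hk' := mt (key' k) hk
    push Not at hk hk'
    rw [coeff_basicPattern_of_ne hk, coeff_basicPattern_of_ne hk']

/-- The invariant functions in the kernel of the linear operator are the multiples of the basic
pattern. -/
theorem eq_smul_basicPattern (hQ : Q = 8 ∨ Q = 10 ∨ Q = 12) (h : Admissible Q s) {u : QPSpace Q s}
    (hu : u ∈ rotSubmodule Q s) (hker : ∀ k, (symb k : ℂ) * u.coeff k = 0) :
    u = baseCoeff h u • basicPattern Q s := by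
  refine QPSpace.ext fun k => ?_
  rw [coeff_smul]
  by_cases hk : ∃ j, k = wavePoint Q j
  · obtain ⟨j, rfl⟩ := hk
    rw [coeff_basicPattern_wavePoint, mul_one, coeff_wavePoint_eq_baseCoeff h hu]
  · push Not at hk
    rw [coeff_basicPattern_of_ne hk, mul_zero]
    exact (mul_eq_zero.1 (hker k)).resolve_left (Complex.ofReal_ne_zero.2 (symb_ne_zero hQ hk))

/-! ### The cubic coefficient -/

/-- Four unit vectors with `a + b + c = 1` form a rhombus. -/
theorem add_eq_one_iff {a b c : ℂ} (ha : ‖a‖ = 1) (hb : ‖b‖ = 1) (hc : ‖c‖ = 1) :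
    a + b + c = 1 ↔ (a = 1 ∧ c = -b) ∨ (b = 1 ∧ c = -a) ∨ (c = 1 ∧ b = -a) := by
  constructor
  · intro habc
    have h0 : a ≠ 0 ∧ b ≠ 0 ∧ c ≠ 0 := by
      refine ⟨?_, ?_, ?_⟩ <;> rw [← norm_pos_iff] <;> simp [*]
    -- The conjugate of the given relation; cleared of denominators it reads ab + bc + ca = abc.
    have hinv : a⁻¹ + b⁻¹ + c⁻¹ = 1 := by
      rw [Complex.inv_eq_conj ha, Complex.inv_eq_conj hb, Complex.inv_eq_conj hc, ← map_add,
        ← map_add, habc, map_one]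
    obtain ⟨ha0, hb0, hc0⟩ := h0
    field_simp at hinv
    -- The product equals (a + b + c)(ab + bc + ca) - abc.
    have hprod : (a + b) * (b + c) * (c + a) = 0 := by
      linear_combination (a * b + b * c + c * a) * habc + hinv
    rcases mul_eq_zero.1 hprod with hprod | hprod
    · rcases mul_eq_zero.1 hprod with hprod | hprod
      · exact Or.inr (Or.inr ⟨by linear_combination habc - hprod, by linear_combination hprod⟩)
      · exact Or.inl ⟨by linear_combination habc - hprod, by linear_combination hprod⟩
    · exact Or.inr (Or.inl ⟨by linear_combination habc - hprod, by linear_combination hprod⟩)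
  · rintro (⟨rfl, rfl⟩ | ⟨rfl, rfl⟩ | ⟨rfl, rfl⟩) <;> ring

theorem waveVec_eq_one_iff (j : Fin Q) : waveVec Q j = 1 ↔ (j : ℕ) = 0 := by
  rw [waveVec_eq_rotor_pow, (isPrimitiveRoot_rotor j.pos.ne').pow_eq_one_iff_dvd]
  exact ⟨fun hj => Nat.eq_zero_of_dvd_of_lt hj j.2, fun hj => hj ▸ dvd_zero _⟩

theorem waveVec_eq_neg_iff {d : ℕ} (i j : Fin (d + d)) :
    waveVec (d + d) i = -waveVec (d + d) j ↔ (i : ℕ) = (j + d) % (d + d) := by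
  have hd : d ≠ 0 := by have := i.pos; omega
  have hr := isPrimitiveRoot_rotor (Q := d + d) i.pos.ne'
  rw [waveVec_eq_rotor_pow, waveVec_eq_rotor_pow, ← mul_neg_one, ← rotor_pow_half hd, ← pow_add,
    ← pow_mod_orderOf (rotor (d + d)) (j + d), ← hr.eq_orderOf]
  exact ⟨fun hij => hr.pow_inj i.2 (Nat.mod_lt _ i.pos) hij, fun hij => hij ▸ rfl⟩

theorem exists_waveVec_eq_neg (hQ : Even Q) (h0 : Q ≠ 0) (j : Fin Q) :
    ∃ i, waveVec Q i = -waveVec Q j := by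
  obtain ⟨d, rfl⟩ := hQ
  exact ⟨⟨(j + d) % (d + d), Nat.mod_lt _ (Nat.pos_of_ne_zero h0)⟩,
    (waveVec_eq_neg_iff _ _).2 rfl⟩

/-- Inclusion–exclusion: each of the three families has as many triples as ι has elements, any two
share one triple, and no triple lies in all three because σ moves o. -/
theorem sum_rhombus {ι : Type*} [Fintype ι] [DecidableEq ι] (o : ι) {σ : ι → ι}
    (hσ : Function.Involutive σ) (ho : σ o ≠ o) :
    (∑ a, ∑ b, ∑ c, if (a = o ∧ c = σ b) ∨ (b = o ∧ c = σ a) ∨ (c = o ∧ b = σ a) then (1 : ℂ)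
      else 0) = 3 * (Fintype.card ι - 1) := by
  let δ : ι → ι → ℂ := fun i j => if i = j then 1 else 0
  have hδ : ∀ a b c : ι, (if (a = o ∧ c = σ b) ∨ (b = o ∧ c = σ a) ∨ (c = o ∧ b = σ a) then (1 : ℂ)
      else 0) = δ a o * δ c (σ b) + δ b o * δ c (σ a) + δ c o * δ b (σ a) - δ a o * δ b o * δ c (σ o)
        - δ a o * δ c o * δ b (σ o) - δ b o * δ c o * δ a (σ o) := by
    intro a b c
    simp only [δ]
    have h1 : ∀ i, o = σ i ↔ i = σ o :=
      fun i => ⟨fun hi => by rw [hi, hσ], fun hi => by rw [hi, hσ]⟩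
    by_cases ha : a = o <;> by_cases hb : b = o <;> by_cases hc : c = o <;>
      simp [ha, hb, hc, ho.symm, h1]
  have hs : ∀ i, ∑ j, δ j i = 1 := fun i => by simp [δ]
  simp only [hδ, Finset.sum_sub_distrib, Finset.sum_add_distrib, ← Finset.mul_sum, hs, mul_one,
    ← Finset.sum_mul, one_mul, Finset.sum_const, Finset.card_univ, nsmul_eq_mul]
  ring

theorem mul₃_basicPattern (h : Admissible Q s) :
    mul₃ h (basicPattern Q s) (basicPattern Q s) (basicPattern Q s) =
      ∑ a, ∑ b, ∑ c, mode s (wavePoint Q a + wavePoint Q b + wavePoint Q c) := by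
  simp only [mul₃_eq, basicPattern, map_sum, sum_apply, mulCLM_apply,
    mul_mode_mode]
  refine Finset.sum_congr rfl fun a _ => Finset.sum_congr rfl fun b _ =>
    Finset.sum_congr rfl fun c _ => congrArg _ ?_
  abel

/-- The origin of β: the first wave vector is the complex number 1, so the coefficient counts
triples of wave vectors with sum 1. -/
theorem baseCoeff_mul₃_basicPattern (h : Admissible Q s) :
    baseCoeff h (mul₃ h (basicPattern Q s) (basicPattern Q s) (basicPattern Q s)) = beta Q := by
  classical
  have h1 : baseCoeff h (mul₃ h (basicPattern Q s) (basicPattern Q s) (basicPattern Q s)) =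
      ∑ a : Fin Q, ∑ b : Fin Q, ∑ c : Fin Q,
        if waveVec Q a + waveVec Q b + waveVec Q c = 1 then (1 : ℂ) else 0 := by
    rw [mul₃_basicPattern]
    simp only [map_sum]
    refine Finset.sum_congr rfl fun a _ => Finset.sum_congr rfl fun b _ =>
      Finset.sum_congr rfl fun c _ => ?_
    have hb : ((basePoint h : quasilattice Q) : ℂ) = 1 := (waveVec_eq_one_iff _).2 rfl
    split_ifs with habc
    · have : basePoint h = wavePoint Q a + wavePoint Q b + wavePoint Q c :=
        Subtype.ext (hb.trans habc.symm)
      rw [baseCoeff, coeffCLM_apply, this, coeff_mode_self]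
    · refine coeff_mode_of_ne (s := s) fun heq => habc ?_
      rw [← hb, heq]; rfl
  choose σ hσ using exists_waveVec_eq_neg h.1 h.ne_zero
  have hσσ : Function.Involutive σ := fun j => waveVec_injective (by rw [hσ, hσ, neg_neg])
  let o : Fin Q := ⟨0, Nat.pos_of_ne_zero h.ne_zero⟩
  have ho : ∀ j, waveVec Q j = 1 ↔ j = o := fun j => by rw [waveVec_eq_one_iff, Fin.ext_iff]
  have hneg : ∀ i j, waveVec Q i = -waveVec Q j ↔ i = σ j := fun i j => by
    rw [← hσ, waveVec_injective.eq_iff]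
  have hne : σ o ≠ o := by
    rw [Ne, ← ho, hσ, (ho o).2 rfl]
    norm_num
  rw [h1]
  simp only [add_eq_one_iff (norm_waveVec Q _) (norm_waveVec Q _) (norm_waveVec Q _), ho, hneg]
  rw [sum_rhombus o hσσ hne, Fintype.card_fin, beta]
  push_cast
  rfl

theorem beta_ne_zero (h : Admissible Q s) : (beta Q : ℂ) ≠ 0 := by
  have : (8 : ℝ) ≤ Q := by exact_mod_cast h.2.1
  rw [Complex.ofReal_ne_zero, beta]
  nlinarith

theorem beta_pos (h : Admissible Q s) : 0 < beta Q := by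
  have : (8 : ℝ) ≤ Q := by exact_mod_cast h.2.1
  rw [beta]
  linarith

/-! ### Cubic convolutions of sequences -/

/-- The triples of natural numbers with sum `n`. -/
def triples (n : ℕ) : Finset (ℕ × ℕ × ℕ) :=
  (Finset.range (n + 1) ×ˢ Finset.range (n + 1) ×ˢ Finset.range (n + 1)).filter
    fun x => x.1 + x.2.1 + x.2.2 = n

theorem mem_triples {n : ℕ} {x : ℕ × ℕ × ℕ} : x ∈ triples n ↔ x.1 + x.2.1 + x.2.2 = n := by
  simp only [triples, Finset.mem_filter, Finset.mem_product, Finset.mem_range]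
  omega

theorem sum_antidiagonal_antidiagonal {A : Type*} [AddCommMonoid A] (F : ℕ → ℕ → ℕ → A) (n : ℕ) :
    ∑ p ∈ Finset.HasAntidiagonal.antidiagonal n,
      ∑ q ∈ Finset.HasAntidiagonal.antidiagonal p.2, F p.1 q.1 q.2 =
    ∑ x ∈ triples n, F x.1 x.2.1 x.2.2 := by
  rw [Finset.sum_sigma']
  refine Finset.sum_bij (fun y _ => (y.1.1, y.2.1, y.2.2)) ?_ ?_ ?_ ?_
  · rintro ⟨⟨a, b⟩, c, e⟩ hy
    simp only [Finset.mem_sigma, Finset.HasAntidiagonal.mem_antidiagonal] at hy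
    simp only [mem_triples]
    omega
  · rintro ⟨⟨a, b⟩, c, e⟩ hy ⟨⟨a', b'⟩, c', e'⟩ hy' heq
    simp only [Finset.mem_sigma, Finset.HasAntidiagonal.mem_antidiagonal, Prod.mk.injEq] at hy hy' heq
    obtain ⟨rfl, rfl, rfl⟩ := heq
    obtain rfl : b = b' := by omega
    rfl
  · rintro ⟨a, b, c⟩ hx
    simp only [mem_triples] at hx
    exact ⟨⟨(a, b + c), (b, c)⟩, Finset.mem_sigma.2
      ⟨Finset.HasAntidiagonal.mem_antidiagonal.2 ((add_assoc a b c).symm.trans hx),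
        Finset.HasAntidiagonal.mem_antidiagonal.2 rfl⟩, rfl⟩
  · rintro ⟨⟨a, b⟩, c, e⟩ -
    rfl

/-- For n > 0, a triple with an entry n has zeros elsewhere. The split separates the terms linear in
the unknown u_n from those known by induction. -/
theorem sum_triples_eq_of_pos {A : Type*} [AddCommMonoid A] (F : ℕ → ℕ → ℕ → A) {n : ℕ}
    (hn : 0 < n) :
    ∑ x ∈ triples n, F x.1 x.2.1 x.2.2 =
      (∑ x ∈ (triples n).filter fun x => x.1 < n ∧ x.2.1 < n ∧ x.2.2 < n, F x.1 x.2.1 x.2.2) +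
        (F n 0 0 + (F 0 n 0 + F 0 0 n)) := by
  have h1 : ((triples n).filter fun x => ¬(x.1 < n ∧ x.2.1 < n ∧ x.2.2 < n)) =
      {(n, 0, 0), (0, n, 0), (0, 0, n)} := by
    ext ⟨a, b, c⟩
    simp only [Finset.mem_filter, mem_triples, Finset.mem_insert, Finset.mem_singleton,
      Prod.mk.injEq]
    omega
  rw [← Finset.sum_filter_add_sum_filter_not (triples n)
    fun x => x.1 < n ∧ x.2.1 < n ∧ x.2.2 < n, h1, Finset.sum_insert, Finset.sum_insert,
    Finset.sum_singleton]
  · simp only [Finset.mem_singleton, Prod.mk.injEq]; omega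
  · simp only [Finset.mem_insert, Finset.mem_singleton, Prod.mk.injEq]; omega

/-- The coefficient `∑_{i + j + l = n} u_i u_j u_l` of the cube of a formal power series. -/
noncomputable def cubicConv (h : Admissible Q s) (u : ℕ → QPSpace Q s) (n : ℕ) : QPSpace Q s :=
  ∑ x ∈ triples n, mul₃ h (u x.1) (u x.2.1) (u x.2.2)

section mul₃

variable (h : Admissible Q s)

theorem mul₃_zero_left (v w : QPSpace Q s) : mul₃ h 0 v w = 0 := by simp [mul₃_eq]

theorem mul₃_zero_mid (u w : QPSpace Q s) : mul₃ h u 0 w = 0 := by simp [mul₃_eq]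

theorem mul₃_zero_right (u v : QPSpace Q s) : mul₃ h u v 0 = 0 := by simp [mul₃_eq]

theorem mul₃_smul (a b c : ℂ) (u v w : QPSpace Q s) :
    mul₃ h (a • u) (b • v) (c • w) = (a * b * c) • mul₃ h u v w := by
  simp only [mul₃_eq, map_smul, smul_apply, smul_smul]
  congr 1
  ring

theorem cubicConv_congr {u v : ℕ → QPSpace Q s} {n : ℕ} (huv : ∀ m ≤ n, u m = v m) :
    cubicConv h u n = cubicConv h v n := by
  refine Finset.sum_congr rfl fun x hx => ?_
  rw [mem_triples] at hx
  rw [huv _ (by omega), huv _ (by omega), huv _ (by omega)]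

theorem cubicConv_smul (c : ℂ) (u : ℕ → QPSpace Q s) (n : ℕ) :
    cubicConv h (c • u) n = c ^ 3 • cubicConv h u n := by
  rw [cubicConv, cubicConv, Finset.smul_sum]
  refine Finset.sum_congr rfl fun x _ => ?_
  rw [Pi.smul_apply, Pi.smul_apply, Pi.smul_apply, mul₃_smul]
  congr 1
  ring

theorem cubicConv_zero_index (u : ℕ → QPSpace Q s) :
    cubicConv h u 0 = mul₃ h (u 0) (u 0) (u 0) := by
  rw [cubicConv, show triples 0 = {(0, 0, 0)} by decide, Finset.sum_singleton]

/-- The part of the cubic convolution which is linear in the last entry. -/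
theorem cubicConv_update (u : ℕ → QPSpace Q s) {n : ℕ} (hn : 0 < n) (v : QPSpace Q s) :
    cubicConv h (Function.update u n v) n = cubicConv h (Function.update u n 0) n +
      (mul₃ h v (u 0) (u 0) + (mul₃ h (u 0) v (u 0) + mul₃ h (u 0) (u 0) v)) := by
  rw [cubicConv, sum_triples_eq_of_pos (fun i j l => mul₃ h (Function.update u n v i)
    (Function.update u n v j) (Function.update u n v l)) hn, cubicConv,
    sum_triples_eq_of_pos (fun i j l => mul₃ h (Function.update u n 0 i)
    (Function.update u n 0 j) (Function.update u n 0 l)) hn]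
  simp only [Function.update_self, Function.update_of_ne hn.ne, mul₃_zero_left, mul₃_zero_mid,
    mul₃_zero_right, add_zero]
  congr 1
  refine Finset.sum_congr rfl fun x hx => ?_
  obtain ⟨-, h1, h2, h3⟩ := Finset.mem_filter.1 hx
  simp only [Function.update_of_ne h1.ne, Function.update_of_ne h2.ne, Function.update_of_ne h3.ne]

theorem cubicConv_eq_add (u : ℕ → QPSpace Q s) {n : ℕ} (hn : 0 < n) :
    cubicConv h u n = cubicConv h (Function.update u n 0) n +
      (mul₃ h (u n) (u 0) (u 0) + (mul₃ h (u 0) (u n) (u 0) + mul₃ h (u 0) (u 0) (u n))) := by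
  conv_lhs => rw [← Function.update_eq_self n u]
  exact cubicConv_update h u hn (u n)

theorem cubicConv_mem_rotSubmodule {u : ℕ → QPSpace Q s} {n : ℕ}
    (hu : ∀ m ≤ n, u m ∈ rotSubmodule Q s) : cubicConv h u n ∈ rotSubmodule Q s := by
  refine sum_mem fun x hx => ?_
  rw [mem_triples] at hx
  exact mul₃_mem_rotSubmodule h (hu _ (by omega)) (hu _ (by omega)) (hu _ (by omega))

/-- The linearization of the cube at a multiple of the basic pattern, in the direction `v`. -/
noncomputable def linCube (a : ℂ) (v : QPSpace Q s) : QPSpace Q s :=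
  mul₃ h v (a • basicPattern Q s) (a • basicPattern Q s) +
    (mul₃ h (a • basicPattern Q s) v (a • basicPattern Q s) +
      mul₃ h (a • basicPattern Q s) (a • basicPattern Q s) v)

theorem linCube_add (a : ℂ) (v w : QPSpace Q s) :
    linCube h a (v + w) = linCube h a v + linCube h a w := by
  simp only [linCube, mul₃_eq, map_add, add_apply]
  abel

theorem baseCoeff_linCube_smul (a c : ℂ) :
    baseCoeff h (linCube h a (c • basicPattern Q s)) = 3 * a ^ 2 * c * beta Q := by
  simp only [linCube, mul₃_smul, map_add, map_smul, baseCoeff_mul₃_basicPattern, smul_eq_mul]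
  ring

end mul₃

/-! ### Formal solutions -/

/-- The sequence `u` of invariant functions solves the recursion `(1 + Δ)² u_m = 0` for `m < d` and
`(1 + Δ)² u_{m + d} = u_m - b ∑_{i + j + l = m} u_i u_j u_l`. -/
structure IsStepSolution (h : Admissible Q s) (d : ℕ) (b : ℂ) (u : ℕ → QPSpace Q s) : Prop where
  rot : ∀ n, u n ∈ rotSubmodule Q s
  low : ∀ m < d, ∀ k, (symb k : ℂ) * (u m).coeff k = 0
  step : ∀ m k, (symb k : ℂ) * (u (m + d)).coeff k = (u m - b • cubicConv h u m).coeff k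

/-- The solvability condition: the symbol vanishes at the wave vectors, hence so does the right-hand
side. -/
theorem IsStepSolution.baseCoeff_eq {h : Admissible Q s} {d : ℕ} {b : ℂ} {u : ℕ → QPSpace Q s}
    (hu : IsStepSolution h d b u) (m : ℕ) : baseCoeff h (u m - b • cubicConv h u m) = 0 := by
  rw [baseCoeff, coeffCLM_apply, ← hu.step, symb_basePoint]
  simp

/-- Two solutions that agree below n differ at n by an invariant kernel element δ e. Subtracting
their solvability conditions at n leaves δ (1 - 3a²bβ) = 0; the factor is the derivative of x - bβx³
at a. -/
theorem IsStepSolution.unique (hQ : Q = 8 ∨ Q = 10 ∨ Q = 12) {h : Admissible Q s} {d : ℕ}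
    (hd : 0 < d) {a b : ℂ} (hab : 3 * a ^ 2 * b * beta Q ≠ 1) {u v : ℕ → QPSpace Q s}
    (hu : IsStepSolution h d b u) (hv : IsStepSolution h d b v)
    (hu0 : u 0 = a • basicPattern Q s) (hv0 : v 0 = a • basicPattern Q s) : u = v := by
  funext n
  induction n using Nat.strong_induction_on with
  | _ n ih =>
    rcases Nat.eq_zero_or_pos n with rfl | hn
    · rw [hu0, hv0]
    have hker : ∀ k, (symb k : ℂ) * (u n - v n).coeff k = 0 := by
      intro k
      rw [coeff_sub, mul_sub]
      rcases lt_or_ge n d with hnd | hnd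
      · rw [hu.low n hnd, hv.low n hnd, sub_zero]
      · obtain ⟨m, rfl⟩ := Nat.exists_eq_add_of_le' hnd
        rw [hu.step, hv.step]
        rw [ih m (by omega), cubicConv_congr h fun i hi => ih i (by omega), sub_self]
    obtain ⟨δ, hδ⟩ : ∃ δ, u n - v n = δ • basicPattern Q s :=
      ⟨_, eq_smul_basicPattern hQ h (sub_mem (hu.rot n) (hv.rot n)) hker⟩
    have hup : cubicConv h (Function.update u n 0) n = cubicConv h (Function.update v n 0) n :=
      cubicConv_congr h fun i hi => by
        rcases hi.eq_or_lt with rfl | hi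
        · simp
        · rw [Function.update_of_ne hi.ne, Function.update_of_ne hi.ne, ih i hi]
    have hcu := cubicConv_eq_add h u hn
    have hcv := cubicConv_eq_add h v hn
    rw [hu0] at hcu
    rw [hv0, ← hup] at hcv
    have hun : u n = v n + δ • basicPattern Q s := by rw [← hδ]; abel
    have hcuv : cubicConv h u n = cubicConv h v n + linCube h a (δ • basicPattern Q s) := by
      rw [hcu, hcv]
      change _ + linCube h a (u n) = _ + linCube h a (v n) + _
      rw [hun, linCube_add, add_assoc]
    have e1 := hu.baseCoeff_eq n
    have e2 := hv.baseCoeff_eq n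
    rw [hcuv, hun] at e1
    simp only [map_sub, map_add, map_smul, baseCoeff_linCube_smul, baseCoeff_basicPattern,
      smul_eq_mul] at e1 e2
    have hδ0 : δ = 0 := by
      have : δ * (1 - 3 * a ^ 2 * b * beta Q) = 0 := by linear_combination e1 - e2
      exact (mul_eq_zero.1 this).resolve_right (sub_ne_zero.2 hab.symm)
    rw [hun, hδ0, zero_smul, add_zero]

theorem isFormalSolution_iff {h : Admissible Q s} {U : ℕ → QPSpace Q s} :
    IsFormalSolution h U ↔
      IsStepSolution h 1 (beta Q : ℂ)⁻¹ U ∧ U 0 = basicPattern Q s := by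
  have hcube : ∀ n, ∑ p ∈ Finset.HasAntidiagonal.antidiagonal n,
      ∑ q ∈ Finset.HasAntidiagonal.antidiagonal p.2, mul h (mul h (U p.1) (U q.1)) (U q.2) =
      cubicConv h U n := fun n =>
    sum_antidiagonal_antidiagonal (fun i j l => mul h (mul h (U i) (U j)) (U l)) n
  constructor
  · intro hU
    refine ⟨⟨hU.rotInvariant, fun m hm k => ?_, fun m k => ?_⟩, hU.leading⟩
    · obtain rfl : m = 0 := by omega
      rw [← coeff_linOp, hU.order_zero, coeff_zero]
    · rw [← coeff_linOp, hU.order_succ, coeff_emb, hcube]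
  · rintro ⟨hU, h0⟩
    refine ⟨h0, hU.rot, QPSpace.ext fun k => ?_, fun n => QPSpace.ext fun k => ?_⟩
    · rw [coeff_linOp, hU.low 0 one_pos, coeff_zero]
    · rw [coeff_linOp, hU.step, coeff_emb, hcube]

/-! ### Existence of the formal solution -/

/-- The function `u` has no Fourier modes of order above `N`. -/
def OrderLE (N : ℕ) (u : QPSpace Q s) : Prop := ∀ k : quasilattice Q, N < order Q k → u.coeff k = 0

namespace OrderLE

variable {N N' : ℕ} {u v : QPSpace Q s}

theorem mono (hu : OrderLE N u) (hN : N ≤ N') : OrderLE N' u := fun k hk => hu k (hN.trans_lt hk)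

theorem smul (c : ℂ) (hu : OrderLE N u) : OrderLE N (c • u) := fun k hk => by
  rw [coeff_smul, hu k hk, mul_zero]

theorem sub (hu : OrderLE N u) (hv : OrderLE N v) : OrderLE N (u - v) := fun k hk => by
  rw [coeff_sub, hu k hk, hv k hk, sub_zero]

theorem sum {ι : Type*} {t : Finset ι} {f : ι → QPSpace Q s} (hf : ∀ i ∈ t, OrderLE N (f i)) :
    OrderLE N (∑ i ∈ t, f i) := fun k hk => by
  rw [coeff_sum]
  exact Finset.sum_eq_zero fun i hi => hf i hi k hk

/-- The order is subadditive on Γ, so every pair contributing to a mode of order above N + N' has a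
vanishing factor. -/
theorem mul (h : Admissible Q s) (hu : OrderLE N u) (hv : OrderLE N' v) :
    OrderLE (N + N') (mul h u v) := fun k hk => by
  rw [coeff_mul]
  refine (tsum_congr ?_).trans tsum_zero
  rintro ⟨⟨p, q⟩, rfl⟩
  have hpq : N + N' < order Q p + order Q q := hk.trans_le (order_add_le p q)
  rcases lt_or_ge N (order Q p) with hp | hp
  · simp [hu p hp]
  · simp [hv q (by omega)]

theorem cubicConv (h : Admissible Q s) {u : ℕ → QPSpace Q s} {n : ℕ}
    (hu : ∀ m ≤ n, OrderLE (2 * m + 1) (u m)) : OrderLE (2 * n + 3) (cubicConv h u n) := by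
  refine sum fun x hx => ?_
  rw [mem_triples] at hx
  exact (((hu _ (by omega)).mul h (hu _ (by omega))).mul h (hu _ (by omega))).mono (by omega)

end OrderLE

theorem orderLE_basicPattern : OrderLE 1 (basicPattern Q s) := fun _ hk =>
  coeff_basicPattern_of_ne fun j hj => (hj ▸ hk).not_ge (order_wavePoint_le j)

/-- The truncated inverse of the linear operator. -/
noncomputable def truncInv (M : ℝ) (u : QPSpace Q s) : QPSpace Q s :=
  ⟨fun k => if 1 ≤ M * symb k then ((symb k)⁻¹ : ℝ) * u.coeff k else 0, by
    refine Summable.of_nonneg_of_le (fun k => ?_) (fun k => ?_) (u.summable.mul_left (M ^ 2))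
    · have := weight_pos Q s k; positivity
    · have hw := weight_pos Q s k
      dsimp only
      split_ifs with hk
      · have h0 : 0 < symb k := (symb_nonneg k).lt_of_ne fun h0 => by
          rw [← h0] at hk; norm_num at hk
        have h1 : (symb k)⁻¹ ≤ M := by rwa [inv_le_iff_one_le_mul₀ h0]
        rw [norm_mul, Complex.norm_real, Real.norm_of_nonneg (inv_nonneg.2 h0.le), mul_pow,
          mul_left_comm]
        gcongr
      · rw [norm_zero]
        have : 0 ≤ M ^ 2 * (weight Q s k * ‖u.coeff k‖ ^ 2) := by positivity
        simpa using this⟩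

theorem coeff_truncInv (M : ℝ) (u : QPSpace Q s) (k : quasilattice Q) :
    (truncInv M u).coeff k = if 1 ≤ M * symb k then ((symb k)⁻¹ : ℝ) * u.coeff k else 0 := rfl

theorem symb_rotEquiv (hQ : Q ≠ 0) (k : quasilattice Q) : symb (rotEquiv hQ k) = symb k := by
  rw [symb, symb, coe_rotEquiv, norm_mul, norm_rotor, one_mul]

theorem truncInv_mem_rotSubmodule (hQ : Q ≠ 0) (M : ℝ) {u : QPSpace Q s}
    (hu : u ∈ rotSubmodule Q s) : truncInv M u ∈ rotSubmodule Q s := by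
  rw [mem_rotSubmodule, rotInvariant_iff hQ] at hu ⊢
  intro k
  rw [coeff_truncInv, coeff_truncInv, symb_rotEquiv, hu]

theorem baseCoeff_truncInv (h : Admissible Q s) (M : ℝ) (u : QPSpace Q s) :
    baseCoeff h (truncInv M u) = 0 := by
  rw [baseCoeff, coeffCLM_apply, coeff_truncInv, symb_basePoint]
  norm_num

theorem OrderLE.truncInv {N : ℕ} (M : ℝ) {u : QPSpace Q s} (hu : OrderLE N u) :
    OrderLE N (truncInv M u) := fun k hk => by
  rw [coeff_truncInv, hu k hk, mul_zero, ite_self]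

/-- The reciprocal of the smallest nonzero value of the symbol on modes of order at most `N`. -/
noncomputable def divisorBound (N : ℕ) : ℝ := (1 + 16 * (N : ℝ) ^ 2) ^ 2

theorem one_le_divisorBound_mul_symb (hQ : Q = 8 ∨ Q = 10 ∨ Q = 12) {N : ℕ} {k : quasilattice Q}
    (hN : order Q k ≤ N) (hk : ∀ j, k ≠ wavePoint Q j) : 1 ≤ divisorBound N * symb k := by
  refine ((wavePoint_or_small_divisor hQ k).resolve_left fun ⟨j, hj⟩ => hk j hj).trans ?_
  have h1 : (order Q k : ℝ) ≤ N := by exact_mod_cast hN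
  have := symb_nonneg k
  rw [divisorBound]
  gcongr

/-- The truncation is harmless: wave vectors are covered by the solvability condition, modes of
order above N do not occur in u, and all others pass the threshold by the small divisor bound. -/
theorem symb_mul_coeff_truncInv (hQ : Q = 8 ∨ Q = 10 ∨ Q = 12) (h : Admissible Q s) {N : ℕ}
    {u : QPSpace Q s} (hu : OrderLE N u) (hrot : u ∈ rotSubmodule Q s) (h0 : baseCoeff h u = 0)
    (k : quasilattice Q) : (symb k : ℂ) * (truncInv (divisorBound N) u).coeff k = u.coeff k := by
  by_cases hk : ∃ j, k = wavePoint Q j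
  · obtain ⟨j, rfl⟩ := hk
    rw [symb_wavePoint, coeff_wavePoint_eq_baseCoeff h hrot, h0, Complex.ofReal_zero, zero_mul]
  · push Not at hk
    rcases lt_or_ge N (order Q k) with hN | hN
    · rw [hu.truncInv _ k hN, hu k hN, mul_zero]
    · rw [coeff_truncInv, if_pos (one_le_divisorBound_mul_symb hQ hN hk), Complex.ofReal_inv,
        mul_inv_cancel_left₀ (Complex.ofReal_ne_zero.2 (symb_ne_zero hQ hk))]

/-- The residual `u_n - β⁻¹ ∑_{i + j + l = n} u_i u_j u_l` of a sequence. -/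
noncomputable def residual (h : Admissible Q s) (u : ℕ → QPSpace Q s) (n : ℕ) : QPSpace Q s :=
  u n - (beta Q : ℂ)⁻¹ • cubicConv h u n

/-- The term of index `n + 1` of the formal solution, from the terms of index at most `n`. -/
noncomputable def nextTerm (h : Admissible Q s) (n : ℕ) (u : ℕ → QPSpace Q s) : QPSpace Q s :=
  truncInv (divisorBound (2 * n + 3)) (residual h u n) -
    ((beta Q : ℂ)⁻¹ * baseCoeff h (cubicConv h (Function.update u (n + 1)
      (truncInv (divisorBound (2 * n + 3)) (residual h u n))) (n + 1)) / 2) • basicPattern Q s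

/-- The formal solution. -/
noncomputable def formalSolution (h : Admissible Q s) : ℕ → QPSpace Q s
  | 0 => basicPattern Q s
  -- The guard makes the recursion well founded; `nextTerm` with index n never uses the values it
  -- replaces by 0.
  | n + 1 => nextTerm h n fun m => if _ : m < n + 1 then formalSolution h m else 0

theorem residual_congr (h : Admissible Q s) {u v : ℕ → QPSpace Q s} {n : ℕ}
    (huv : ∀ m ≤ n, u m = v m) : residual h u n = residual h v n := by
  rw [residual, residual, huv n le_rfl, cubicConv_congr h huv]

theorem formalSolution_succ (h : Admissible Q s) (n : ℕ) :
    formalSolution h (n + 1) = nextTerm h n (formalSolution h) := by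
  have hlt : ∀ m ≤ n, (if _ : m < n + 1 then formalSolution h m else 0) = formalSolution h m :=
    fun m hm => dif_pos (by omega)
  rw [formalSolution, nextTerm, nextTerm, residual_congr h hlt]
  congr 5
  refine cubicConv_congr h fun m hm => ?_
  rcases hm.eq_or_lt with rfl | hm
  · simp
  · rw [Function.update_of_ne hm.ne, Function.update_of_ne hm.ne, hlt m (by omega)]

/-- Subtracting c e from V changes the base coefficient of the residual by -c + 3c = 2c, so
solvability at index n forces c; hence the division by 2. -/
theorem baseCoeff_residual_of_eq (h : Admissible Q s) {u : ℕ → QPSpace Q s} {n : ℕ} (hn : 0 < n)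
    (h0 : u 0 = basicPattern Q s) {V : QPSpace Q s} (hV : baseCoeff h V = 0)
    (hu : u n = V - ((beta Q : ℂ)⁻¹ * baseCoeff h (cubicConv h (Function.update u n V) n) / 2) •
      basicPattern Q s) : baseCoeff h (residual h u n) = 0 := by
  set c := (beta Q : ℂ)⁻¹ * baseCoeff h (cubicConv h (Function.update u n V) n) / 2 with hc
  have h1 := cubicConv_eq_add h u hn
  have h2 := cubicConv_update h u hn V
  rw [h0, ← one_smul ℂ (basicPattern Q s)] at h1 h2
  change _ = _ + linCube h 1 (u n) at h1
  change _ = _ + linCube h 1 V at h2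
  have h3 : u n = V + (-c) • basicPattern Q s := by rw [hu, neg_smul, sub_eq_add_neg]
  rw [h3, linCube_add, ← add_assoc, ← h2] at h1
  rw [residual, h1, h3]
  simp only [map_sub, map_add, map_smul, hV, baseCoeff_basicPattern, baseCoeff_linCube_smul,
    smul_eq_mul]
  have hβ := beta_ne_zero h
  rw [hc]
  field_simp
  ring

/-- The properties must be proved together: the next term inverts the residual, so the residual has
to be invariant, solvable and of bounded order first. Cubing raises the order bound from 2n + 1 to
2n + 3 = 2(n + 1) + 1, which closes the induction. -/
theorem formalSolution_invariant (h : Admissible Q s) (n : ℕ) :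
    formalSolution h n ∈ rotSubmodule Q s ∧ OrderLE (2 * n + 1) (formalSolution h n) ∧
      baseCoeff h (residual h (formalSolution h) n) = 0 ∧
      OrderLE (2 * n + 3) (residual h (formalSolution h) n) ∧
      residual h (formalSolution h) n ∈ rotSubmodule Q s := by
  induction n using Nat.strong_induction_on with
  | _ n ih =>
    have h1 : formalSolution h n ∈ rotSubmodule Q s ∧ OrderLE (2 * n + 1) (formalSolution h n) ∧
        baseCoeff h (residual h (formalSolution h) n) = 0 := by
      cases n with
      | zero =>
        have h0 : formalSolution h 0 = basicPattern Q s := by rw [formalSolution]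
        refine ⟨by rw [h0]; exact basicPattern_mem_rotSubmodule,
          by rw [h0]; exact orderLE_basicPattern, ?_⟩
        rw [residual, cubicConv_zero_index, h0]
        simp [baseCoeff_basicPattern, baseCoeff_mul₃_basicPattern, beta_ne_zero h]
      | succ n =>
        obtain ⟨-, -, -, hO, hR⟩ := ih n n.lt_succ_self
        have heq := formalSolution_succ h n
        rw [nextTerm] at heq
        refine ⟨?_, ?_, baseCoeff_residual_of_eq h n.succ_pos (by rw [formalSolution])
          (baseCoeff_truncInv h _ _) heq⟩
        · rw [heq]
          exact sub_mem (truncInv_mem_rotSubmodule h.ne_zero _ hR)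
            (Submodule.smul_mem _ _ basicPattern_mem_rotSubmodule)
        · rw [heq]
          exact (hO.truncInv _).sub ((orderLE_basicPattern.mono (by omega)).smul _)
    refine ⟨h1.1, h1.2.1, h1.2.2, ?_, ?_⟩
    · refine (h1.2.1.mono (by omega)).sub (OrderLE.smul _ (OrderLE.cubicConv h fun m hm => ?_))
      rcases hm.eq_or_lt with rfl | hm
      · exact h1.2.1
      · exact (ih m hm).2.1
    · refine sub_mem h1.1 (Submodule.smul_mem _ _ (cubicConv_mem_rotSubmodule h fun m hm => ?_))
      rcases hm.eq_or_lt with rfl | hm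
      · exact h1.1
      · exact (ih m hm).1

theorem isStepSolution_formalSolution (hQ : Q = 8 ∨ Q = 10 ∨ Q = 12) (h : Admissible Q s) :
    IsStepSolution h 1 (beta Q : ℂ)⁻¹ (formalSolution h) := by
  refine ⟨fun n => (formalSolution_invariant h n).1, fun m hm k => ?_, fun m k => ?_⟩
  · obtain rfl : m = 0 := by omega
    rw [formalSolution, symb_mul_coeff_basicPattern]
  · obtain ⟨-, -, h0, hO, hR⟩ := formalSolution_invariant h m
    rw [formalSolution_succ, nextTerm, coeff_sub, mul_sub, symb_mul_coeff_truncInv hQ h hO hR h0,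
      coeff_smul, mul_left_comm, symb_mul_coeff_basicPattern, mul_zero, sub_zero, residual]

theorem existsUnique_isFormalSolution (hQ : Q = 8 ∨ Q = 10 ∨ Q = 12) (h : Admissible Q s) :
    ∃! U : ℕ → QPSpace Q s, IsFormalSolution h U := by
  refine ⟨formalSolution h, isFormalSolution_iff.2
    ⟨isStepSolution_formalSolution hQ h, by rw [formalSolution]⟩, fun U hU => ?_⟩
  obtain ⟨hU, h0⟩ := isFormalSolution_iff.1 hU
  refine hU.unique hQ one_pos (a := 1) ?_ (isStepSolution_formalSolution hQ h) (by rw [h0, one_smul])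
    (by rw [formalSolution, one_smul])
  rw [one_pow, mul_one, inv_mul_cancel_right₀ (beta_ne_zero h)]
  norm_num

/-! ### Gevrey estimates -/

theorem factorial_succ_mul_factorial_succ_le (a b : ℕ) :
    (a + 1)! * (b + 1)! ≤ (a + b + 1)! := by
  induction a with
  | zero => simp
  | succ a ih =>
    calc (a + 1 + 1)! * (b + 1)! = (a + 2) * ((a + 1)! * (b + 1)!) := by
          rw [Nat.factorial_succ (a + 1), mul_assoc]
      _ ≤ (a + b + 2) * (a + b + 1)! := Nat.mul_le_mul (by omega) ih
      _ = (a + 1 + b + 1)! := by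
          rw [show a + 1 + b + 1 = (a + b + 1) + 1 by ring, Nat.factorial_succ (a + b + 1)]

/-- At least two of the indices are positive, which gains a factor n over the trivial bound. Its
fourth power will pay for the number of triples. -/
theorem mul_factorial_triple_le {i j l n : ℕ} (hn : i + j + l = n) (hi : i < n) (hj : j < n)
    (hl : l < n) : n * (i ! * j ! * l !) ≤ n ! := by
  have key : ∀ p q : ℕ, p ≠ 0 → q ≠ 0 → (p + q) * (p ! * q !) ≤ (p + q)! := by
    intro p q hp hq
    obtain ⟨a, rfl⟩ := Nat.exists_eq_succ_of_ne_zero hp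
    obtain ⟨b, rfl⟩ := Nat.exists_eq_succ_of_ne_zero hq
    rw [show a.succ + b.succ = (a + b + 1) + 1 by omega, Nat.factorial_succ (a + b + 1)]
    exact Nat.mul_le_mul_left _ (factorial_succ_mul_factorial_succ_le a b)
  subst hn
  by_cases hl0 : l = 0
  · subst hl0
    simpa using key i j (by omega) (by omega)
  · refine (Nat.mul_le_mul_left _ (Nat.mul_le_mul_right _ ?_)).trans (key (i + j) l (by omega) hl0)
    exact Nat.le_of_dvd (Nat.factorial_pos _) (Nat.factorial_mul_factorial_dvd_factorial_add i j)

theorem card_triples_le (n : ℕ) : (triples n).card ≤ (n + 1) ^ 2 := by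
  have : (triples n).card ≤ (Finset.range (n + 1) ×ˢ Finset.range (n + 1)).card := by
    refine Finset.card_le_card_of_injOn (fun x => (x.1, x.2.1)) (fun x hx => ?_) ?_
    · have := mem_triples.1 hx
      simp only [Finset.coe_product, Finset.coe_range, Set.mem_prod, Set.mem_Iio]
      omega
    · rintro ⟨a, b, c⟩ hx ⟨a', b', c'⟩ hy hxy
      have hx := mem_triples.1 hx
      have hy := mem_triples.1 hy
      simp only [Prod.mk.injEq] at hx hy hxy ⊢
      omega
  simpa [sq] using this

/-- The sum of `x_i x_j x_l` over `i + j + l = n`. -/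
def tripleSum (x : ℕ → ℝ) (n : ℕ) : ℝ := ∑ t ∈ triples n, x t.1 * x t.2.1 * x t.2.2

/-- The sum of `x_i x_j x_l` over `i + j + l = n` with indices less than `n`. -/
def innerTripleSum (x : ℕ → ℝ) (n : ℕ) : ℝ :=
  ∑ t ∈ (triples n).filter fun t => t.1 < n ∧ t.2.1 < n ∧ t.2.2 < n, x t.1 * x t.2.1 * x t.2.2

/-- At most one index is zero, so each term carries ε² and at most one factor G. There are at most
(n + 1)² ≤ 4n⁴ terms, and the factorials gain n⁻⁴ in each. -/
theorem innerTripleSum_le {x : ℕ → ℝ} (hx : ∀ n, 0 ≤ x n) {G ε K : ℝ} (hG : 1 ≤ G) (hε : 0 < ε)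
    (hε1 : ε ≤ 1) (hK : 0 < K) (hx0 : x 0 ≤ G) {n : ℕ} (hn : 0 < n)
    (hxn : ∀ m, 0 < m → m < n → x m ≤ ε * (K ^ m * (m ! : ℝ) ^ 4)) :
    innerTripleSum x n ≤ 4 * G * ε ^ 2 * (K ^ n * (n ! : ℝ) ^ 4) := by
  have hn0 : (0 : ℝ) < n := Nat.cast_pos.2 hn
  set η : ℕ → ℝ := fun m => if m = 0 then G else ε with hη
  have hη0 : ∀ m, 0 < η m := fun m => by simp only [hη]; split_ifs <;> linarith
  have hxη : ∀ m < n, x m ≤ η m * (K ^ m * (m ! : ℝ) ^ 4) := by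
    intro m hm
    rcases Nat.eq_zero_or_pos m with rfl | hm0
    · simpa [hη] using hx0
    · simpa [hη, hm0.ne'] using hxn m hm0 hm
  have hterm : ∀ t ∈ (triples n).filter fun t => t.1 < n ∧ t.2.1 < n ∧ t.2.2 < n,
      x t.1 * x t.2.1 * x t.2.2 ≤ G * ε ^ 2 * (K ^ n * ((n ! : ℝ) / n) ^ 4) := by
    rintro ⟨i, j, l⟩ ht
    obtain ⟨ht, hi, hj, hl⟩ := Finset.mem_filter.1 ht
    have hsum : i + j + l = n := mem_triples.1 ht
    simp only at hi hj hl ⊢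
    have h1 : η i * η j * η l ≤ G * ε ^ 2 := by
      have hεG : ε ≤ G := hε1.trans hG
      have h3 : ε * ε * ε ≤ G * ε ^ 2 := by nlinarith [sq_nonneg ε]
      by_cases hi0 : i = 0
      · have hj0 : j ≠ 0 := by omega
        have hl0 : l ≠ 0 := by omega
        simp only [hη, if_pos hi0, if_neg hj0, if_neg hl0]
        nlinarith
      · by_cases hj0 : j = 0
        · have hl0 : l ≠ 0 := by omega
          simp only [hη, if_neg hi0, if_pos hj0, if_neg hl0]
          nlinarith
        · by_cases hl0 : l = 0
          · simp only [hη, if_neg hi0, if_neg hj0, if_pos hl0]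
            nlinarith
          · simpa only [hη, if_neg hi0, if_neg hj0, if_neg hl0] using h3
    have h2 : ((i ! : ℝ) * j ! * l !) ≤ (n ! : ℝ) / n := by
      rw [le_div_iff₀ hn0, mul_comm]
      exact_mod_cast mul_factorial_triple_le hsum hi hj hl
    calc x i * x j * x l
        ≤ (η i * (K ^ i * (i ! : ℝ) ^ 4)) * (η j * (K ^ j * (j ! : ℝ) ^ 4)) *
          (η l * (K ^ l * (l ! : ℝ) ^ 4)) := by
          have := hη0 i; have := hη0 j; have := hη0 l
          exact mul_le_mul (mul_le_mul (hxη i hi) (hxη j hj) (hx j) (by positivity)) (hxη l hl)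
            (hx l) (by positivity)
      _ = (η i * η j * η l) * (K ^ n * ((i ! : ℝ) * j ! * l !) ^ 4) := by
          rw [← hsum, pow_add, pow_add]; ring
      _ ≤ G * ε ^ 2 * (K ^ n * ((n ! : ℝ) / n) ^ 4) := by gcongr
  have hcard : (((triples n).filter fun t => t.1 < n ∧ t.2.1 < n ∧ t.2.2 < n).card : ℝ) ≤
      4 * (n : ℝ) ^ 4 := by
    have h1 : ((triples n).filter fun t => t.1 < n ∧ t.2.1 < n ∧ t.2.2 < n).card ≤ (n + 1) ^ 2 :=
      (Finset.card_filter_le _ _).trans (card_triples_le n)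
    have h2 : (((triples n).filter fun t => t.1 < n ∧ t.2.1 < n ∧ t.2.2 < n).card : ℝ) ≤
        ((n : ℝ) + 1) ^ 2 := by exact_mod_cast h1
    have h3 : (1 : ℝ) ≤ n := by exact_mod_cast hn
    have h4 : (1 : ℝ) ≤ (n : ℝ) ^ 2 := one_le_pow₀ h3
    nlinarith
  calc innerTripleSum x n
      ≤ ((triples n).filter fun t => t.1 < n ∧ t.2.1 < n ∧ t.2.2 < n).card •
        (G * ε ^ 2 * (K ^ n * ((n ! : ℝ) / n) ^ 4)) := Finset.sum_le_card_nsmul _ _ _ hterm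
    _ ≤ (4 * (n : ℝ) ^ 4) * (G * ε ^ 2 * (K ^ n * ((n ! : ℝ) / n) ^ 4)) := by
        rw [nsmul_eq_mul]; gcongr
    _ = 4 * G * ε ^ 2 * (K ^ n * (n ! : ℝ) ^ 4) := by field_simp

/-- The inner sum at n + 1 has no gain from K, so smallness must come from its being quadratic in ε;
the remaining terms gain 1/K. Only x 0 is allowed to be large, and G bounds it. -/
theorem gevrey_of_recursive_bound {x : ℕ → ℝ} (hx : ∀ n, 0 ≤ x n) {C : ℝ} (hC : 0 ≤ C)
    (hrec : ∀ n, x (n + 1) ≤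
      C * (((n + 1 : ℕ) : ℝ) ^ 4 * (x n + tripleSum x n) + innerTripleSum x (n + 1))) :
    ∃ K > 0, ∃ γ > 0, ∀ n, x n ≤ γ * K ^ n * (n ! : ℝ) ^ 4 := by
  set G := max 1 (x 0) with hGdef
  have hG : 1 ≤ G := le_max_left _ _
  have hx0 : x 0 ≤ G := le_max_right _ _
  have hG0 : 0 < G := one_pos.trans_le hG
  -- Chosen so that C · 4Gε² is half of εC/(C + 1).
  set ε := 1 / (8 * (C + 1) * G) with hεdef
  have hε : 0 < ε := by positivity
  have hε1 : ε ≤ 1 := by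
    rw [hεdef, div_le_one (by positivity)]
    nlinarith
  -- Chosen so that C · 8G³/K is the other half.
  set K := 16 * (C + 1) * G ^ 3 / ε with hKdef
  have hK : 0 < K := by positivity
  have main : ∀ n, 0 < n → x n ≤ ε * (K ^ n * (n ! : ℝ) ^ 4) := by
    intro n
    induction n using Nat.strong_induction_on with
    | _ n ih =>
      intro hn
      obtain ⟨n, rfl⟩ := Nat.exists_eq_succ_of_ne_zero hn.ne'
      set D : ℝ := K ^ (n + 1) * ((n + 1)! : ℝ) ^ 4 with hD
      set E : ℝ := K ^ n * (n ! : ℝ) ^ 4 with hE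
      have hE0 : 0 < E := by positivity
      have hDE : D = K * (((n + 1 : ℕ) : ℝ) ^ 4 * E) := by
        rw [hD, hE, Nat.factorial_succ, pow_succ]; push_cast; ring
      have hS : innerTripleSum x (n + 1) ≤ 4 * G * ε ^ 2 * D :=
        innerTripleSum_le hx hG hε hε1 hK hx0 n.succ_pos fun m hm hmn => ih m hmn hm
      have hxn : x n ≤ G * E := by
        rcases Nat.eq_zero_or_pos n with rfl | hn0
        · simpa [hE] using hx0
        · exact (ih n n.lt_succ_self hn0).trans (by gcongr; linarith)
      have hT : tripleSum x n ≤ 7 * G ^ 3 * E := by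
        rcases Nat.eq_zero_or_pos n with rfl | hn0
        · have : x 0 * x 0 * x 0 ≤ G * G * G :=
            mul_le_mul (mul_le_mul hx0 hx0 (hx 0) hG0.le) hx0 (hx 0) (by positivity)
          rw [tripleSum, show triples 0 = {(0, 0, 0)} by decide, Finset.sum_singleton, hE]
          simp only [pow_zero, Nat.factorial_zero, Nat.cast_one, one_pow, mul_one]
          nlinarith [pow_pos hG0 3]
        · have h1 := innerTripleSum_le hx hG hε hε1 hK hx0 hn0 fun m hm hmn =>
            ih m (hmn.trans n.lt_succ_self) hm
          have h2 : x n * x 0 * x 0 ≤ G * E * G * G :=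
            mul_le_mul (mul_le_mul hxn hx0 (hx 0) (by positivity)) hx0 (hx 0) (by positivity)
          have h3 : 4 * G * ε ^ 2 * E ≤ 4 * G ^ 3 * E := by
            have : ε ^ 2 ≤ G ^ 2 := pow_le_pow_left₀ hε.le (hε1.trans hG) 2
            have : G * ε ^ 2 ≤ G * G ^ 2 := by gcongr
            nlinarith
          rw [tripleSum, sum_triples_eq_of_pos (fun i j l => x i * x j * x l) hn0]
          change innerTripleSum x n + _ ≤ _
          linarith
      have h1 : C * (((n + 1 : ℕ) : ℝ) ^ 4 * (x n + tripleSum x n) + innerTripleSum x (n + 1)) ≤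
          C * (((n + 1 : ℕ) : ℝ) ^ 4 * (8 * G ^ 3 * E) + 4 * G * ε ^ 2 * D) := by
        have : x n + tripleSum x n ≤ 8 * G ^ 3 * E := by
          have : G * E ≤ G ^ 3 * E := by
            have : G ≤ G ^ 3 := le_self_pow₀ hG (by norm_num)
            gcongr
          linarith
        gcongr
      have h2 : C * (((n + 1 : ℕ) : ℝ) ^ 4 * (8 * G ^ 3 * E) + 4 * G * ε ^ 2 * D) =
          (C / (C + 1)) * ε * D := by
        have : ((n + 1 : ℕ) : ℝ) ^ 4 * E = D / K := by rw [hDE]; field_simp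
        rw [show ((n + 1 : ℕ) : ℝ) ^ 4 * (8 * G ^ 3 * E) =
          8 * G ^ 3 * (((n + 1 : ℕ) : ℝ) ^ 4 * E) by ring, this, hKdef]
        have h8 : ε * (8 * (C + 1) * G) = 1 := by rw [hεdef]; field_simp
        field_simp
        linear_combination (8 * C * D) * h8
      have h3 : C / (C + 1) ≤ 1 := by rw [div_le_one (by positivity)]; linarith
      have hD0 : 0 < D := by positivity
      refine (hrec n).trans (h1.trans (h2.trans_le ?_))
      rw [mul_assoc]
      exact mul_le_of_le_one_left (by positivity) h3
  refine ⟨K, hK, G, hG0, fun n => ?_⟩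
  rcases Nat.eq_zero_or_pos n with rfl | hn
  · simpa using hx0
  · refine (main n hn).trans ?_
    rw [mul_assoc]
    gcongr
    linarith

theorem norm_truncInv_le {M : ℝ} (hM : 0 ≤ M) (u : QPSpace Q s) :
    ‖truncInv M u‖ ≤ M * ‖u‖ := by
  refine norm_le_of_coeff_le hM fun k => ?_
  rw [coeff_truncInv]
  split_ifs with hk
  · have h0 : 0 < symb k := (symb_nonneg k).lt_of_ne fun h0 => by
      rw [← h0] at hk; norm_num at hk
    rw [norm_mul, Complex.norm_real, Real.norm_of_nonneg (inv_nonneg.2 h0.le)]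
    gcongr
    rwa [inv_le_iff_one_le_mul₀ h0]
  · rw [norm_zero]; positivity

theorem divisorBound_le (n : ℕ) :
    divisorBound (2 * n + 3) ≤ 145 ^ 2 * ((n + 1 : ℕ) : ℝ) ^ 4 := by
  have h1 : (1 : ℝ) ≤ ((n + 1 : ℕ) : ℝ) := by exact_mod_cast n.succ_pos
  have h2 : ((2 * n + 3 : ℕ) : ℝ) ≤ 3 * ((n + 1 : ℕ) : ℝ) := by
    push_cast
    have : (0 : ℝ) ≤ n := Nat.cast_nonneg n
    linarith
  -- 145 = 1 + 16 · 3².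
  have h3 : 1 + 16 * ((2 * n + 3 : ℕ) : ℝ) ^ 2 ≤ 145 * ((n + 1 : ℕ) : ℝ) ^ 2 := by
    have := pow_le_pow_left₀ (Nat.cast_nonneg _) h2 2
    nlinarith
  rw [divisorBound]
  calc _ ≤ (145 * ((n + 1 : ℕ) : ℝ) ^ 2) ^ 2 := pow_le_pow_left₀ (by positivity) h3 2
    _ = _ := by ring

/-- The divisor enters only through the inverted residual of index n, with cost (n + 1)⁴. The
correction along e at index n + 1 is a bounded functional of the inner sum and of that inverse, with
no further divisor. -/
theorem exists_recursive_bound (h : Admissible Q s) : ∃ C : ℝ, 0 ≤ C ∧ ∀ n,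
    ‖formalSolution h (n + 1)‖ ≤
      C * (((n + 1 : ℕ) : ℝ) ^ 4 * (‖formalSolution h n‖ +
        tripleSum (fun m => ‖formalSolution h m‖) n) +
        innerTripleSum (fun m => ‖formalSolution h m‖) (n + 1)) := by
  obtain ⟨A, hA, hmul⟩ := exists_norm_mul₃_le h
  set x : ℕ → ℝ := fun m => ‖formalSolution h m‖ with hx
  have hx0 : ∀ m, 0 ≤ x m := fun m => norm_nonneg _
  set g := ‖basicPattern Q s‖ with hg
  set b := ‖(beta Q : ℂ)⁻¹‖ with hb
  set p := ‖baseCoeff h‖ with hp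
  have hbase : formalSolution h 0 = basicPattern Q s := by rw [formalSolution]
  set C₁ := 145 ^ 2 * (1 + b * A) with hC₁
  have hb0 : 0 ≤ b := norm_nonneg _
  have hg0 : 0 ≤ g := norm_nonneg _
  have hp0 : 0 ≤ p := norm_nonneg _
  refine ⟨(1 + b * p * A * 3 * g ^ 2 * g) * C₁ + b * p * A * g, by positivity, fun n => ?_⟩
  have hT : ∀ m, 0 ≤ tripleSum x m := fun m => Finset.sum_nonneg fun t _ =>
    mul_nonneg (mul_nonneg (hx0 _) (hx0 _)) (hx0 _)
  have hS : ∀ m, 0 ≤ innerTripleSum x m := fun m => Finset.sum_nonneg fun t _ =>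
    mul_nonneg (mul_nonneg (hx0 _) (hx0 _)) (hx0 _)
  set V := truncInv (divisorBound (2 * n + 3)) (residual h (formalSolution h) n) with hV
  set Y := ((n + 1 : ℕ) : ℝ) ^ 4 * (x n + tripleSum x n) with hY
  have hY0 : 0 ≤ Y := by have := hT n; have := hx0 n; positivity
  have hcub : ‖cubicConv h (formalSolution h) n‖ ≤ A * tripleSum x n := by
    rw [tripleSum, Finset.mul_sum]
    exact (norm_sum_le _ _).trans (Finset.sum_le_sum fun t _ => hmul _ _ _)
  have hres : ‖residual h (formalSolution h) n‖ ≤ (1 + b * A) * (x n + tripleSum x n) := by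
    have h1 : ‖residual h (formalSolution h) n‖ ≤ x n + b * (A * tripleSum x n) := by
      refine (norm_sub_le _ _).trans (add_le_add le_rfl ?_)
      rw [norm_smul]
      gcongr
    have h2 : 0 ≤ b * A * x n := by have := hx0 n; positivity
    nlinarith [hT n]
  have hVY : ‖V‖ ≤ C₁ * Y := by
    have hM : 0 ≤ divisorBound (2 * n + 3) := sq_nonneg _
    calc ‖V‖ ≤ divisorBound (2 * n + 3) * ‖residual h (formalSolution h) n‖ :=
          norm_truncInv_le hM _
      _ ≤ (145 ^ 2 * ((n + 1 : ℕ) : ℝ) ^ 4) * ((1 + b * A) * (x n + tripleSum x n)) :=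
          mul_le_mul (divisorBound_le n) hres (norm_nonneg _) (by positivity)
      _ = C₁ * Y := by rw [hC₁, hY]; ring
  have hupd : ‖cubicConv h (Function.update (formalSolution h) (n + 1) V) (n + 1)‖ ≤
      A * (innerTripleSum x (n + 1) + 3 * g ^ 2 * ‖V‖) := by
    rw [cubicConv_update h _ n.succ_pos, hbase]
    have h0 : ‖cubicConv h (Function.update (formalSolution h) (n + 1) 0) (n + 1)‖ ≤
        A * innerTripleSum x (n + 1) := by
      rw [cubicConv, sum_triples_eq_of_pos (fun i j l => mul₃ h
        (Function.update (formalSolution h) (n + 1) 0 i)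
        (Function.update (formalSolution h) (n + 1) 0 j)
        (Function.update (formalSolution h) (n + 1) 0 l)) n.succ_pos]
      simp only [Function.update_self, mul₃_zero_left, mul₃_zero_mid, mul₃_zero_right, add_zero]
      rw [innerTripleSum, Finset.mul_sum]
      refine (norm_sum_le _ _).trans (Finset.sum_le_sum fun t ht => ?_)
      obtain ⟨-, h1, h2, h3⟩ := Finset.mem_filter.1 ht
      rw [Function.update_of_ne h1.ne, Function.update_of_ne h2.ne, Function.update_of_ne h3.ne]
      exact hmul _ _ _
    refine (norm_add_le _ _).trans ?_
    have h1 := hmul V (basicPattern Q s) (basicPattern Q s)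
    have h2 := hmul (basicPattern Q s) V (basicPattern Q s)
    have h3 := hmul (basicPattern Q s) (basicPattern Q s) V
    have h4 := norm_add_le (mul₃ h V (basicPattern Q s) (basicPattern Q s))
      (mul₃ h (basicPattern Q s) V (basicPattern Q s) +
        mul₃ h (basicPattern Q s) (basicPattern Q s) V)
    have h5 := norm_add_le (mul₃ h (basicPattern Q s) V (basicPattern Q s))
      (mul₃ h (basicPattern Q s) (basicPattern Q s) V)
    nlinarith
  set S := innerTripleSum x (n + 1) with hSdef
  have hc : ‖(beta Q : ℂ)⁻¹ * baseCoeff h (cubicConv h (Function.update (formalSolution h) (n + 1) V)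
      (n + 1)) / 2‖ ≤ b * (p * (A * (S + 3 * g ^ 2 * ‖V‖))) := by
    rw [norm_div, norm_mul]
    have h1 := ((baseCoeff h).le_opNorm _).trans (mul_le_mul_of_nonneg_left hupd hp0)
    have h2 : ‖(2 : ℂ)‖ = 2 := by simp
    rw [h2]
    have h3 := mul_le_mul_of_nonneg_left h1 hb0
    have h4 : 0 ≤ ‖(beta Q : ℂ)⁻¹‖ * ‖baseCoeff h (cubicConv h
      (Function.update (formalSolution h) (n + 1) V) (n + 1))‖ := by positivity
    linarith
  have hS0 := hS (n + 1)
  calc ‖formalSolution h (n + 1)‖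
      ≤ ‖V‖ + b * (p * (A * (S + 3 * g ^ 2 * ‖V‖))) * g := by
        rw [formalSolution_succ, nextTerm]
        refine (norm_sub_le _ _).trans (add_le_add le_rfl ?_)
        rw [norm_smul]
        gcongr
    _ = (1 + b * p * A * 3 * g ^ 2 * g) * ‖V‖ + b * p * A * g * S := by ring
    _ ≤ (1 + b * p * A * 3 * g ^ 2 * g) * (C₁ * Y) + b * p * A * g * S := by gcongr
    _ ≤ ((1 + b * p * A * 3 * g ^ 2 * g) * C₁ + b * p * A * g) * (Y + S) := by
        have h1 : 0 ≤ b * p * A * g * Y := by positivity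
        have h2 : 0 ≤ (1 + b * p * A * 3 * g ^ 2 * g) * C₁ * S := by positivity
        linarith

theorem exists_gevreyBound (h : Admissible Q s) :
    ∃ K : ℝ, 0 < K ∧ GevreyBound (formalSolution h) K := by
  obtain ⟨C, hC, hrec⟩ := exists_recursive_bound h
  obtain ⟨K, hK, γ, hγ, hx⟩ := gevrey_of_recursive_bound (x := fun m => ‖formalSolution h m‖)
    (fun _ => norm_nonneg _) hC hrec
  exact ⟨K, hK, γ, hγ, hx⟩

/-! ### Power series in a disc -/

section PowerSeries

variable {E F : Type*} [NormedAddCommGroup E] [NormedSpace ℂ E] [NormedAddCommGroup F]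
  [NormedSpace ℂ F]

/-- `f(ζ) = ∑ ζⁿ a_n` in the disc `|ζ| < r`. -/
def HasPowerSum (r : ℝ) (f : ℂ → E) (a : ℕ → E) : Prop :=
  ∀ ζ ∈ Metric.ball (0 : ℂ) r, HasSum (fun n => ζ ^ n • a n) (f ζ)

namespace HasPowerSum

variable {r : ℝ} {f g : ℂ → E} {a b : ℕ → E}

theorem congr (hf : HasPowerSum r f a) (hfg : Set.EqOn g f (Metric.ball 0 r)) :
    HasPowerSum r g a := fun ζ hζ => by
  rw [hfg hζ]
  exact hf ζ hζ

theorem add (hf : HasPowerSum r f a) (hg : HasPowerSum r g b) :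
    HasPowerSum r (fun ζ => f ζ + g ζ) (fun n => a n + b n) := fun ζ hζ => by
  simpa only [smul_add] using (hf ζ hζ).add (hg ζ hζ)

theorem sub (hf : HasPowerSum r f a) (hg : HasPowerSum r g b) :
    HasPowerSum r (fun ζ => f ζ - g ζ) (fun n => a n - b n) := fun ζ hζ => by
  simpa only [smul_sub] using (hf ζ hζ).sub (hg ζ hζ)

theorem map (hf : HasPowerSum r f a) (L : E →L[ℂ] F) :
    HasPowerSum r (fun ζ => L (f ζ)) (fun n => L (a n)) := fun ζ hζ => by
  simpa only [map_smul] using (hf ζ hζ).mapL L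

theorem eval_zero (hr : 0 < r) (hf : HasPowerSum r f a) : f 0 = a 0 := by
  refine (hf 0 (Metric.mem_ball_self hr)).unique ?_
  convert hasSum_single (f := fun n => (0 : ℂ) ^ n • a n) 0 fun n hn => by simp [hn] using 1
  simp

theorem exists_bound (hf : HasPowerSum r f a) {ρ : ℝ} (hρ : 0 ≤ ρ) (hρr : ρ < r) :
    ∃ C, 0 ≤ C ∧ ∀ n, ‖a n‖ * ρ ^ n ≤ C := by
  have hmem : (ρ : ℂ) ∈ Metric.ball (0 : ℂ) r := by
    simpa [abs_of_nonneg hρ] using hρr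
  obtain ⟨C, hC⟩ := (hf ρ hmem).summable.tendsto_atTop_zero.norm.bddAbove_range
  have hC' : ∀ n, ‖a n‖ * ρ ^ n ≤ C := fun n => by
    have := hC ⟨n, rfl⟩
    simpa [norm_smul, abs_of_nonneg hρ, mul_comm] using this
  exact ⟨C, (by positivity : (0 : ℝ) ≤ ‖a 0‖ * ρ ^ 0).trans (hC' 0), hC'⟩

/-- Convergence at each ρ < r bounds ‖a_n‖ρⁿ, which gives the radius. Analyticity and uniqueness of
coefficients then follow from the general theory. -/
theorem hasFPowerSeriesOnBall (hr : 0 < r) (hf : HasPowerSum r f a) :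
    HasFPowerSeriesOnBall f (fun n => ContinuousMultilinearMap.mkPiRing ℂ (Fin n) (a n)) 0
      (ENNReal.ofReal r) := by
  refine ⟨?_, ENNReal.ofReal_pos.2 hr, fun {y} hy => ?_⟩
  · refine ENNReal.le_of_forall_nnreal_lt fun ρ hρ => ?_
    have hρr : (ρ : ℝ) < r := by
      rwa [← ENNReal.ofReal_coe_nnreal, ENNReal.ofReal_lt_ofReal_iff hr] at hρ
    obtain ⟨C, -, hC⟩ := hf.exists_bound ρ.2 hρr
    refine FormalMultilinearSeries.le_radius_of_bound _ C fun n => ?_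
    rw [ContinuousMultilinearMap.norm_mkPiRing]
    exact hC n
  · rw [Metric.eball_ofReal] at hy
    simpa using hf y hy

theorem analyticOnNhd [CompleteSpace E] (hr : 0 < r) (hf : HasPowerSum r f a) :
    AnalyticOnNhd ℂ f (Metric.ball 0 r) := by
  rw [← Metric.eball_ofReal]
  exact (hf.hasFPowerSeriesOnBall hr).analyticOnNhd

theorem iteratedDeriv_zero [CompleteSpace E] (hr : 0 < r) (hf : HasPowerSum r f a) (n : ℕ) :
    iteratedDeriv n f 0 = (n ! : ℂ) • a n := by
  rw [iteratedDeriv_eq_iteratedFDeriv, ← (hf.hasFPowerSeriesOnBall hr).factorial_smul 1 n]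
  simp [Nat.cast_smul_eq_nsmul]

theorem of_analyticOnNhd [CompleteSpace E] (hf : AnalyticOnNhd ℂ f (Metric.ball 0 r)) :
    HasPowerSum r f fun n => (n ! : ℂ)⁻¹ • iteratedDeriv n f 0 := fun ζ hζ => by
  have := Complex.hasSum_taylorSeries_on_ball hf.differentiableOn hζ
  simpa only [sub_zero, smul_comm (ζ ^ _)] using this

theorem unique [CompleteSpace E] (hr : 0 < r) (hf : HasPowerSum r f a) (hf' : HasPowerSum r f b) : a = b := by
  funext n
  have h1 := (hf.iteratedDeriv_zero hr n).symm.trans (hf'.iteratedDeriv_zero hr n)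
  exact smul_right_injective E (Nat.cast_ne_zero.2 n.factorial_ne_zero : (n ! : ℂ) ≠ 0) h1

theorem eq_zero [CompleteSpace E] (hr : 0 < r) (hf : HasPowerSum r f a) (h0 : ∀ ζ ∈ Metric.ball (0 : ℂ) r, f ζ = 0)
    (n : ℕ) : a n = 0 := by
  have : HasPowerSum r f fun _ => 0 := fun ζ hζ => by simp [h0 ζ hζ, hasSum_zero]
  exact congrFun (hf.unique hr this) n

end HasPowerSum

theorem summable_pow_smul [CompleteSpace E] {r : ℝ} {a : ℕ → E}
    (ha : ∀ ρ, 0 < ρ → ρ < r → ∃ C, ∀ n, ‖a n‖ * ρ ^ n ≤ C) {ζ : ℂ}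
    (hζ : ζ ∈ Metric.ball (0 : ℂ) r) : Summable fun n => ζ ^ n • a n := by
  rw [mem_ball_zero_iff] at hζ
  obtain ⟨ρ, hζρ, hρr⟩ := exists_between hζ
  have hρ : 0 < ρ := (norm_nonneg _).trans_lt hζρ
  obtain ⟨C, hC⟩ := ha ρ hρ hρr
  have hq : ‖ζ‖ / ρ < 1 := (div_lt_one hρ).2 hζρ
  refine Summable.of_norm_bounded
    ((summable_geometric_of_lt_one (by positivity) hq).mul_left C) fun n => ?_
  rw [norm_smul, norm_pow, div_pow]
  calc ‖ζ‖ ^ n * ‖a n‖ = (‖a n‖ * ρ ^ n) * (‖ζ‖ ^ n / ρ ^ n) := by field_simp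
    _ ≤ C * (‖ζ‖ ^ n / ρ ^ n) := by gcongr; exact hC n

end PowerSeries

/-! ### The operators of the transformed equation -/

theorem hasPowerSum_taylorCoeff {r : ℝ} {f : ℂ → QPSpace Q s}
    (hf : AnalyticOnNhd ℂ f (Metric.ball 0 r)) : HasPowerSum r f (taylorCoeff f) :=
  HasPowerSum.of_analyticOnNhd hf

theorem HasPowerSum.taylorCoeff_eq {r : ℝ} {f : ℂ → QPSpace Q s} {a : ℕ → QPSpace Q s} (hr : 0 < r)
    (hf : HasPowerSum r f a) : taylorCoeff f = a := by
  funext n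
  rw [taylorCoeff, hf.iteratedDeriv_zero hr,
    inv_smul_smul₀ (Nat.cast_ne_zero.2 n.factorial_ne_zero)]

/-- The Taylor coefficients of `𝒦 f`. -/
noncomputable def opKCoeff (a : ℕ → QPSpace Q s) (m : ℕ) : QPSpace Q s :=
  -- The threshold is 5, not 4, because 𝒦 omits the constant term of f.
  if 5 ≤ m then (((m - 4)! : ℂ) / (m ! : ℂ)) • a (m - 4) else 0

/-- The Taylor coefficients of `f ∗ g`. -/
noncomputable def convCoeff (h : Admissible Q s) (a b : ℕ → QPSpace Q s) (n : ℕ) : QPSpace Q s :=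
  ∑ k ∈ Finset.Ico 1 n, ((k ! : ℂ) * ((n - k)! : ℂ) / (n ! : ℂ)) • mul h (a k) (b (n - k))

theorem norm_opKCoeff_le (a : ℕ → QPSpace Q s) (m : ℕ) : ‖opKCoeff a m‖ ≤ ‖a (m - 4)‖ := by
  rw [opKCoeff]
  split_ifs with hm
  · rw [norm_smul, norm_div, Complex.norm_natCast, Complex.norm_natCast]
    refine mul_le_of_le_one_left (norm_nonneg _) ?_
    rw [div_le_one (by positivity)]
    exact_mod_cast Nat.factorial_le (Nat.sub_le m 4)
  · rw [norm_zero]; exact norm_nonneg _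

theorem opKTerm_eq (f : ℂ → QPSpace Q s) (ζ : ℂ) (n : ℕ) :
    opKTerm f ζ (n + 1) = ζ ^ (n + 5) • opKCoeff (taylorCoeff f) (n + 5) := by
  rw [opKTerm, opKCoeff, if_pos (by omega), smul_smul, mul_comm]
  rfl

theorem hasSum_opKTerm {r : ℝ} {f : ℂ → QPSpace Q s} {a : ℕ → QPSpace Q s} (hr : 0 < r)
    (hf : HasPowerSum r f a) {ζ : ℂ} (hζ : ζ ∈ Metric.ball (0 : ℂ) r) :
    Summable (fun n => opKTerm f ζ (n + 1)) ∧ HasSum (fun m => ζ ^ m • opKCoeff a m) (opK f ζ) := by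
  have ha := hf.taylorCoeff_eq hr
  have hsum : Summable fun m => ζ ^ m • opKCoeff a m := by
    refine summable_pow_smul (fun ρ hρ hρr => ?_) hζ
    obtain ⟨C, hC0, hC⟩ := hf.exists_bound hρ.le hρr
    refine ⟨C * ρ ^ 4, fun m => ?_⟩
    rcases lt_or_ge m 5 with hm | hm
    · rw [opKCoeff, if_neg (by omega), norm_zero, zero_mul]
      positivity
    · calc ‖opKCoeff a m‖ * ρ ^ m ≤ ‖a (m - 4)‖ * ρ ^ m := by
            gcongr; exact norm_opKCoeff_le a m
        _ = ‖a (m - 4)‖ * ρ ^ (m - 4) * ρ ^ 4 := by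
            rw [mul_assoc, ← pow_add, Nat.sub_add_cancel (by omega)]
        _ ≤ C * ρ ^ 4 := by gcongr; exact hC _
  have hinj : Function.Injective fun n : ℕ => n + 5 := add_left_injective 5
  have hzero : ∀ m ∉ Set.range fun n : ℕ => n + 5, ζ ^ m • opKCoeff a m = 0 := fun m hm => by
    rw [opKCoeff, if_neg fun h5 => hm ⟨m - 5, Nat.sub_add_cancel h5⟩, smul_zero]
  have hterm : (fun n => opKTerm f ζ (n + 1)) =
      (fun m => ζ ^ m • opKCoeff a m) ∘ fun n => n + 5 := by
    funext n
    rw [opKTerm_eq, ha]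
    rfl
  have h1 : Summable fun n => opKTerm f ζ (n + 1) := by
    rw [hterm]
    exact hsum.comp_injective hinj
  refine ⟨h1, (hinj.hasSum_iff hzero).1 ?_⟩
  rw [← hterm]
  exact h1.hasSum

theorem hasSum_convTerm (h : Admissible Q s) {r : ℝ} {f g : ℂ → QPSpace Q s}
    {a b : ℕ → QPSpace Q s} (hr : 0 < r) (hf : HasPowerSum r f a) (hg : HasPowerSum r g b) {ζ : ℂ}
    (hζ : ζ ∈ Metric.ball (0 : ℂ) r) :
    Summable (convTerm h f g ζ) ∧ HasSum (fun m => ζ ^ m • convCoeff h a b m) (conv h f g ζ) := by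
  have ha := hf.taylorCoeff_eq hr
  have hb := hg.taylorCoeff_eq hr
  have hterm : convTerm h f g ζ = fun m => ζ ^ m • convCoeff h a b m := by
    funext m
    rw [convTerm, ha, hb]
    rfl
  have hsum : Summable fun m => ζ ^ m • convCoeff h a b m := by
    refine summable_pow_smul (fun ρ hρ hρr => ?_) hζ
    -- The inverse binomial weights are at most 1; the number of summands, at most n, is absorbed by
    -- enlarging the radius to σ.
    obtain ⟨σ, hρσ, hσr⟩ := exists_between hρr
    have hσ : 0 < σ := hρ.trans hρσ
    obtain ⟨A, hA0, hA⟩ := hf.exists_bound hσ.le hσr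
    obtain ⟨B, hB0, hB⟩ := hg.exists_bound hσ.le hσr
    obtain ⟨M, hM, hmul⟩ := exists_norm_mul_le h
    have hq : ρ / σ < 1 := (div_lt_one hσ).2 hρσ
    obtain ⟨D, hD⟩ := (tendsto_self_mul_const_pow_of_lt_one (r := ρ / σ) (by positivity)
      hq).bddAbove_range
    refine ⟨M * A * B * D, fun n => ?_⟩
    have hn : ∀ k ∈ Finset.Ico 1 n,
        ‖((k ! : ℂ) * ((n - k)! : ℂ) / (n ! : ℂ)) • mul h (a k) (b (n - k))‖ ≤
          M * A * B / σ ^ n := by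
      intro k hk
      obtain ⟨hk1, hkn⟩ := Finset.mem_Ico.1 hk
      have h1 : ‖((k ! : ℂ) * ((n - k)! : ℂ) / (n ! : ℂ))‖ ≤ 1 := by
        rw [norm_div, norm_mul, Complex.norm_natCast, Complex.norm_natCast, Complex.norm_natCast,
          div_le_one (by positivity)]
        exact_mod_cast Nat.le_of_dvd n.factorial_pos (Nat.factorial_mul_factorial_dvd_factorial hkn.le)
      rw [norm_smul, le_div_iff₀ (by positivity)]
      calc _ ≤ 1 * (M * ‖a k‖ * ‖b (n - k)‖) * σ ^ n := by
            gcongr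
            exact hmul _ _
        _ = M * (‖a k‖ * σ ^ k) * (‖b (n - k)‖ * σ ^ (n - k)) := by
            rw [← Nat.add_sub_cancel' hkn.le, pow_add, Nat.add_sub_cancel_left]
            ring
        _ ≤ M * A * B := by
            gcongr
            · exact hA k
            · exact hB _
    calc ‖convCoeff h a b n‖ * ρ ^ n ≤ ((Finset.Ico 1 n).card • (M * A * B / σ ^ n)) * ρ ^ n := by
          gcongr
          exact (norm_sum_le _ _).trans (Finset.sum_le_card_nsmul _ _ _ hn)
      _ ≤ ((n : ℝ) * (M * A * B / σ ^ n)) * ρ ^ n := by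
          rw [nsmul_eq_mul, Nat.card_Ico]
          gcongr
          exact Nat.sub_le n 1
      _ = M * A * B * (n * (ρ / σ) ^ n) := by rw [div_pow]; ring
      _ ≤ M * A * B * D := by
          gcongr
          exact hD ⟨n, rfl⟩
  refine ⟨hterm ▸ hsum, ?_⟩
  rw [conv, hterm]
  exact hsum.hasSum

theorem hasPowerSum_opK {r : ℝ} {f : ℂ → QPSpace Q s} {a : ℕ → QPSpace Q s} (hr : 0 < r)
    (hf : HasPowerSum r f a) : HasPowerSum r (opK f) (opKCoeff a) := fun _ hζ =>
  (hasSum_opKTerm hr hf hζ).2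

theorem hasPowerSum_conv (h : Admissible Q s) {r : ℝ} {f g : ℂ → QPSpace Q s}
    {a b : ℕ → QPSpace Q s} (hr : 0 < r) (hf : HasPowerSum r f a) (hg : HasPowerSum r g b) :
    HasPowerSum r (conv h f g) (convCoeff h a b) := fun _ hζ =>
  (hasSum_convTerm h hr hf hg hζ).2

theorem operators_analytic (h : Admissible Q s) {r : ℝ} (hr : 0 < r) {f g : ℂ → QPSpace Q s}
    (hf : IsAnalyticNull r f) (hg : IsAnalyticNull r g) :
    (∀ ζ ∈ Metric.ball (0 : ℂ) r,
      (Summable fun n => opKTerm f ζ (n + 1)) ∧ Summable (convTerm h f g ζ)) ∧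
    IsAnalyticNull r (opK f) ∧ IsAnalyticNull r (conv h f g) := by
  have hf' := hasPowerSum_taylorCoeff hf.1
  have hg' := hasPowerSum_taylorCoeff hg.1
  have hK := hasPowerSum_opK hr hf'
  have hC := hasPowerSum_conv h hr hf' hg'
  refine ⟨fun ζ hζ => ⟨(hasSum_opKTerm hr hf' hζ).1, (hasSum_convTerm h hr hf' hg' hζ).1⟩,
    ⟨hK.analyticOnNhd hr, ?_⟩, ⟨hC.analyticOnNhd hr, ?_⟩⟩
  · rw [hK.eval_zero hr, opKCoeff, if_neg (by norm_num)]
  · rw [hC.eval_zero hr, convCoeff, Finset.Ico_eq_empty (by norm_num), Finset.sum_empty]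

/-! ### Reindexing of formal solutions -/

/-- Triples with an index outside the range of e contribute nothing. Applied to i ↦ 4i and i ↦ i +
2. -/
theorem cubicConv_comp (h : Admissible Q s) {v : ℕ → QPSpace Q s} {e : ℕ → ℕ} {n N : ℕ}
    (hinj : Function.Injective e) (he : ∀ i j l, e i + e j + e l = N ↔ i + j + l = n)
    (hv : ∀ m ∉ Set.range e, v m = 0) : cubicConv h v N = cubicConv h (v ∘ e) n := by
  symm
  refine Finset.sum_of_injOn (fun x => (e x.1, e x.2.1, e x.2.2)) ?_ ?_ ?_ fun _ _ => rfl
  · rintro ⟨a, b, c⟩ - ⟨a', b', c'⟩ - heq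
    simp only [Prod.mk.injEq, hinj.eq_iff] at heq
    obtain ⟨rfl, rfl, rfl⟩ := heq
    rfl
  · intro x hx
    exact mem_triples.2 ((he _ _ _).2 (mem_triples.1 hx))
  · rintro ⟨a, b, c⟩ hx hne
    by_cases ha : a ∈ Set.range e
    · by_cases hb : b ∈ Set.range e
      · by_cases hc : c ∈ Set.range e
        · obtain ⟨i, rfl⟩ := ha
          obtain ⟨j, rfl⟩ := hb
          obtain ⟨l, rfl⟩ := hc
          exact absurd ⟨(i, j, l), mem_triples.2 ((he _ _ _).1 (mem_triples.1 hx)), rfl⟩ hne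
        · simp only [hv c hc, mul₃_zero_right]
      · simp only [hv b hb, mul₃_zero_mid]
    · simp only [hv a ha, mul₃_zero_left]

theorem cubicConv_eq_zero (h : Admissible Q s) {v : ℕ → QPSpace Q s} {N : ℕ}
    (hv : ∀ i j l, i + j + l = N → v i = 0 ∨ v j = 0 ∨ v l = 0) : cubicConv h v N = 0 := by
  refine Finset.sum_eq_zero fun x hx => ?_
  rcases hv _ _ _ (mem_triples.1 hx) with h0 | h0 | h0
  · rw [h0, mul₃_zero_left]
  · rw [h0, mul₃_zero_mid]
  · rw [h0, mul₃_zero_right]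

namespace IsStepSolution

variable {h : Admissible Q s} {d : ℕ} {b : ℂ} {u : ℕ → QPSpace Q s}

theorem smul (hu : IsStepSolution h d b u) {b' c : ℂ} (hc : b' * c ^ 2 = b) :
    IsStepSolution h d b' (c • u) where
  rot n := Submodule.smul_mem _ c (hu.rot n)
  low m hm k := by rw [Pi.smul_apply, coeff_smul, mul_left_comm, hu.low m hm, mul_zero]
  step m k := by
    rw [Pi.smul_apply, Pi.smul_apply, coeff_smul, mul_left_comm, hu.step, cubicConv_smul]
    simp only [coeff_sub, coeff_smul, ← hc]
    ring

theorem zero : IsStepSolution h d b 0 where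
  rot _ := zero_mem _
  low _ _ _ := by simp
  step m k := by
    have h0 : cubicConv h (0 : ℕ → QPSpace Q s) m = 0 :=
      cubicConv_eq_zero h fun _ _ _ _ => Or.inl rfl
    rw [h0]
    simp

end IsStepSolution

/-- The sequence `u_0, 0, 0, 0, u_1, 0, 0, 0, u_2, …`. -/
noncomputable def dilate (u : ℕ → QPSpace Q s) (m : ℕ) : QPSpace Q s :=
  if 4 ∣ m then u (m / 4) else 0

theorem dilate_mul (u : ℕ → QPSpace Q s) (n : ℕ) : dilate u (4 * n) = u n := by
  rw [dilate, if_pos (dvd_mul_right 4 n), Nat.mul_div_cancel_left n (by norm_num)]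

theorem dilate_of_not_dvd (u : ℕ → QPSpace Q s) {m : ℕ} (hm : ¬4 ∣ m) : dilate u m = 0 :=
  if_neg hm

/-- The substitution μ = t⁴. Three multiples of 4 sum to a multiple of 4, so both sides vanish at
all other indices. -/
theorem IsStepSolution.dilate {h : Admissible Q s} {b : ℂ} {u : ℕ → QPSpace Q s}
    (hu : IsStepSolution h 1 b u) : IsStepSolution h 4 b (dilate u) where
  rot n := by
    by_cases hn : 4 ∣ n
    · obtain ⟨m, rfl⟩ := hn
      rw [dilate_mul]
      exact hu.rot m
    · rw [dilate_of_not_dvd u hn]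
      exact zero_mem _
  low m hm k := by
    by_cases hn : 4 ∣ m
    · obtain rfl : m = 4 * 0 := by omega
      rw [dilate_mul]
      exact hu.low 0 one_pos k
    · rw [dilate_of_not_dvd u hn, coeff_zero, mul_zero]
  step m k := by
    by_cases hm : 4 ∣ m
    · obtain ⟨n, rfl⟩ := hm
      have hc : cubicConv h (QuasiPattern.dilate u) (4 * n) = cubicConv h u n := by
        rw [cubicConv_comp h (e := fun i => 4 * i) (n := n)
          (fun i j hij => Nat.eq_of_mul_eq_mul_left (by norm_num) hij) (fun i j l => by omega)
          fun m hm => dilate_of_not_dvd u fun ⟨c, hc⟩ => hm ⟨c, hc.symm⟩]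
        exact congrArg (cubicConv h · n) (funext fun i => dilate_mul u i)
      rw [hc, show 4 * n + 4 = 4 * (n + 1) by ring, dilate_mul, dilate_mul, hu.step]
    · rw [dilate_of_not_dvd u hm, dilate_of_not_dvd u (by omega), cubicConv_eq_zero]
      · simp
      · intro i j l hsum
        by_cases hi : 4 ∣ i
        · by_cases hj : 4 ∣ j
          · exact Or.inr (Or.inr (dilate_of_not_dvd u (by omega)))
          · exact Or.inr (Or.inl (dilate_of_not_dvd u hj))
        · exact Or.inl (dilate_of_not_dvd u hi)

/-- The sequence `0, 0, u_0, u_1, …`. -/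
noncomputable def shift (u : ℕ → QPSpace Q s) : ℕ → QPSpace Q s
  | 0 => 0
  | 1 => 0
  | n + 2 => u n

theorem shift_of_lt (u : ℕ → QPSpace Q s) {n : ℕ} (hn : n < 2) : shift u n = 0 := by
  interval_cases n <;> rfl

theorem cubicConv_shift_of_lt (h : Admissible Q s) (u : ℕ → QPSpace Q s) {n : ℕ} (hn : n < 6) :
    cubicConv h (shift u) n = 0 := by
  refine cubicConv_eq_zero h fun i j l hsum => ?_
  by_cases hi : i < 2
  · exact Or.inl (shift_of_lt u hi)
  · by_cases hj : j < 2
    · exact Or.inr (Or.inl (shift_of_lt u hj))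
    · exact Or.inr (Or.inr (shift_of_lt u (by omega)))

theorem cubicConv_shift (h : Admissible Q s) (u : ℕ → QPSpace Q s) (n : ℕ) :
    cubicConv h (shift u) (n + 6) = cubicConv h u n := by
  rw [cubicConv_comp h (e := fun i => i + 2) (n := n) (add_left_injective 2)
    (fun i j l => by omega) fun m hm => shift_of_lt u ?_]
  · rfl
  · by_contra h2
    exact hm ⟨m - 2, Nat.sub_add_cancel (not_lt.1 h2)⟩

/-! ### Taylor coefficients of the solutions of the transformed equation -/

/-- The sequence `w_n = n! V_n` belongs to a solution `V = ∑ V_n ζⁿ` of the transformed equation: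
`∑ w_n tⁿ` is a formal solution of `(1 + Δ)² W - t⁴ W + W³ = 0`. -/
structure IsBorelSeq (h : Admissible Q s) (w : ℕ → QPSpace Q s) : Prop where
  zero : w 0 = 0
  rot : ∀ n, w n ∈ rotSubmodule Q s
  eq : ∀ n k, (symb k : ℂ) * (w n).coeff k =
    (if 4 ≤ n then w (n - 4) else 0).coeff k - (cubicConv h w n).coeff k

/-- For W = t² ∑ u_n tⁿ both t⁴W and W³ carry t⁶, while (1 + Δ)² W carries t². Dividing by t² leaves
delay four, and the coefficients below t⁶ are the kernel conditions. -/
theorem IsStepSolution.isBorelSeq_shift {h : Admissible Q s} {u : ℕ → QPSpace Q s}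
    (hu : IsStepSolution h 4 1 u) : IsBorelSeq h (shift u) := by
  refine ⟨rfl, fun n => ?_, fun n k => ?_⟩
  · match n with
    | 0 => exact zero_mem _
    | 1 => exact zero_mem _
    | n + 2 => exact hu.rot n
  · rcases lt_or_ge n 6 with hn | hn
    · have h1 : (if 4 ≤ n then shift u (n - 4) else 0) = 0 := by
        split_ifs
        · exact shift_of_lt u (by omega)
        · rfl
      rw [cubicConv_shift_of_lt h u hn, h1, coeff_zero, sub_zero]
      match n with
      | 0 => exact mul_zero _
      | 1 => exact mul_zero _
      | n + 2 => exact hu.low n (by omega) k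
    · obtain ⟨m, rfl⟩ := Nat.exists_eq_add_of_le' hn
      rw [if_pos (by omega), cubicConv_shift]
      have := hu.step m k
      rw [one_smul, coeff_sub] at this
      exact this

theorem baseCoeff_apply (h : Admissible Q s) (u : QPSpace Q s) :
    baseCoeff h u = u.coeff (basePoint h) := rfl

/-- The first order puts w_1 = α e. At order t³ the term t⁴W is absent and the cube is w_1³, so
solvability reads α³β = 0. -/
theorem IsBorelSeq.apply_one (hQ : Q = 8 ∨ Q = 10 ∨ Q = 12) {h : Admissible Q s}
    {w : ℕ → QPSpace Q s} (hw : IsBorelSeq h w) : w 1 = 0 := by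
  have hker : ∀ k, (symb k : ℂ) * (w 1).coeff k = 0 := fun k => by
    have hcub : cubicConv h w 1 = 0 := by
      refine cubicConv_eq_zero h fun i j l hsum => ?_
      by_cases hi : i = 0
      · exact Or.inl (hi ▸ hw.zero)
      · obtain rfl : j = 0 := by omega
        exact Or.inr (Or.inl hw.zero)
    rw [hw.eq, if_neg (by norm_num), hcub, sub_self]
  obtain ⟨α, hα⟩ : ∃ α, w 1 = α • basicPattern Q s :=
    ⟨_, eq_smul_basicPattern hQ h (hw.rot 1) hker⟩
  have hcub : cubicConv h w 3 = mul₃ h (w 1) (w 1) (w 1) := by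
    refine Finset.sum_eq_single (1, 1, 1) ?_ fun hne =>
      (hne (mem_triples.2 (by norm_num))).elim
    rintro ⟨i, j, l⟩ hx hne
    have hsum : i + j + l = 3 := mem_triples.1 hx
    show mul₃ h (w i) (w j) (w l) = 0
    by_cases hi : i = 0
    · rw [hi, hw.zero, mul₃_zero_left]
    · by_cases hj : j = 0
      · rw [hj, hw.zero, mul₃_zero_mid]
      · by_cases hl : l = 0
        · rw [hl, hw.zero, mul₃_zero_right]
        · refine absurd ?_ hne
          obtain ⟨rfl, rfl, rfl⟩ : i = 1 ∧ j = 1 ∧ l = 1 := by omega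
          rfl
  have h3 := hw.eq 3 (basePoint h)
  have hβ : (cubicConv h w 3).coeff (basePoint h) = α ^ 3 * beta Q := by
    rw [hcub, hα, ← baseCoeff_apply, mul₃_smul, map_smul, baseCoeff_mul₃_basicPattern,
      smul_eq_mul]
    ring
  rw [symb_basePoint, if_neg (by norm_num), hβ, coeff_zero, Complex.ofReal_zero, zero_mul,
    zero_sub, eq_comm, neg_eq_zero] at h3
  rw [hα, pow_eq_zero_iff (three_ne_zero) |>.1 ((mul_eq_zero.1 h3).resolve_right (beta_ne_zero h)),
    zero_smul]

theorem IsBorelSeq.eq_shift (hQ : Q = 8 ∨ Q = 10 ∨ Q = 12) {h : Admissible Q s}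
    {w : ℕ → QPSpace Q s} (hw : IsBorelSeq h w) : ∃ (u : ℕ → QPSpace Q s) (a : ℂ), w = shift u ∧
      IsStepSolution h 4 1 u ∧ u 0 = a • basicPattern Q s ∧ a * (1 - a ^ 2 * beta Q) = 0 := by
  obtain ⟨u, rfl⟩ : ∃ u, w = shift u := by
    refine ⟨fun n => w (n + 2), funext fun n => ?_⟩
    match n with
    | 0 => exact hw.zero
    | 1 => exact hw.apply_one hQ
    | n + 2 => rfl
  have hu : IsStepSolution h 4 1 u := by
    refine ⟨fun n => hw.rot (n + 2), fun m hm k => ?_, fun m k => ?_⟩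
    · have h1 : (if 4 ≤ m + 2 then shift u (m + 2 - 4) else 0) = 0 := by
        split_ifs
        · exact shift_of_lt _ (by omega)
        · rfl
      have h2 := hw.eq (m + 2) k
      rw [h1, cubicConv_shift_of_lt h _ (by omega), sub_self] at h2
      exact h2
    · have h2 := hw.eq (m + 6) k
      rw [if_pos (by omega), cubicConv_shift] at h2
      rw [one_smul, coeff_sub]
      exact h2
  obtain ⟨a, ha⟩ : ∃ a, u 0 = a • basicPattern Q s :=
    ⟨_, eq_smul_basicPattern hQ h (hu.rot 0) (hu.low 0 (by norm_num))⟩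
  refine ⟨u, a, rfl, hu, ha, ?_⟩
  have h1 := hu.baseCoeff_eq 0
  rw [cubicConv_zero_index, ha, mul₃_smul, one_smul, map_sub, map_smul, map_smul,
    baseCoeff_basicPattern, baseCoeff_mul₃_basicPattern, smul_eq_mul, smul_eq_mul] at h1
  linear_combination h1

theorem factorial_smul_convCoeff (h : Admissible Q s) (a b : ℕ → QPSpace Q s) (n : ℕ) :
    (n ! : ℂ) • convCoeff h a b n =
      ∑ k ∈ Finset.Ico 1 n, mul h ((k ! : ℂ) • a k) (((n - k)! : ℂ) • b (n - k)) := by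
  rw [convCoeff, Finset.smul_sum]
  refine Finset.sum_congr rfl fun k _ => ?_
  have hn : (n ! : ℂ) ≠ 0 := Nat.cast_ne_zero.2 n.factorial_ne_zero
  simp only [← mulCLM_apply, map_smul, smul_apply, smul_smul]
  congr 1
  field_simp

/-- Multiplication by n! turns the weighted convolution into the Cauchy product. The end indices
omitted in ∗ do not matter because w_0 = 0. -/
theorem factorial_smul_convCoeff_convCoeff (h : Admissible Q s) {a w : ℕ → QPSpace Q s}
    (haw : ∀ n, (n ! : ℂ) • a n = w n) (h0 : w 0 = 0) (n : ℕ) :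
    (n ! : ℂ) • convCoeff h (convCoeff h a a) a n = cubicConv h w n := by
  rw [factorial_smul_convCoeff]
  simp only [factorial_smul_convCoeff, haw, ← mulCLM_apply, map_sum, sum_apply]
  rw [Finset.sum_sigma']
  refine Finset.sum_of_injOn (fun y => (y.2, y.1 - y.2, n - y.1)) ?_ ?_ ?_ fun _ _ => rfl
  · rintro ⟨k, j⟩ hy ⟨k', j'⟩ hy' heq
    simp only [Finset.coe_sigma, Set.mem_sigma_iff, Finset.mem_coe, Finset.mem_Ico] at hy hy'
    simp only [Prod.mk.injEq] at heq
    obtain ⟨rfl, h2, h3⟩ := heq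
    obtain rfl : k = k' := by omega
    rfl
  · rintro ⟨k, j⟩ hy
    simp only [Finset.coe_sigma, Set.mem_sigma_iff, Finset.mem_coe, Finset.mem_Ico] at hy
    refine mem_triples.2 ?_
    simp only
    omega
  · rintro ⟨i, j, l⟩ hx hne
    have hsum := mem_triples.1 hx
    simp only at hsum ⊢
    by_cases hi : i = 0
    · rw [hi, h0, mul₃_zero_left]
    · by_cases hj : j = 0
      · rw [hj, h0, mul₃_zero_mid]
      · by_cases hl : l = 0
        · rw [hl, h0, mul₃_zero_right]
        · refine absurd ⟨⟨i + j, i⟩, ?_, ?_⟩ hne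
          · simp only [Finset.coe_sigma, Set.mem_sigma_iff, Finset.mem_coe, Finset.mem_Ico]
            show (1 ≤ i + j ∧ i + j < n) ∧ 1 ≤ i ∧ i < i + j
            omega
          · show (i, i + j - i, n - (i + j)) = (i, j, l)
            rw [Nat.add_sub_cancel_left, show n - (i + j) = l by omega]

theorem factorial_smul_opKCoeff {a w : ℕ → QPSpace Q s} (haw : ∀ n, (n ! : ℂ) • a n = w n)
    (h0 : w 0 = 0) (n : ℕ) :
    (n ! : ℂ) • opKCoeff a n = if 4 ≤ n then w (n - 4) else 0 := by
  rw [opKCoeff]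
  by_cases h5 : 5 ≤ n
  · have hn : (n ! : ℂ) ≠ 0 := Nat.cast_ne_zero.2 n.factorial_ne_zero
    rw [if_pos h5, if_pos (by omega), smul_smul, mul_div_cancel₀ _ hn, haw]
  · rw [if_neg h5, smul_zero]
    split_ifs with h4
    · rw [show n - 4 = 0 by omega, h0]
    · rfl

/-- The left-hand side of the transformed equation, in terms of Taylor coefficients. -/
theorem equation_iff (h : Admissible Q s) {a w : ℕ → QPSpace Q s}
    (haw : ∀ n, (n ! : ℂ) • a n = w n) (h0 : w 0 = 0) (n : ℕ) (k : quasilattice Q) :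
    ((symb k : ℂ) • a n - opKCoeff a n + convCoeff h (convCoeff h a a) a n).coeff k = 0 ↔
      (symb k : ℂ) * (w n).coeff k =
        (if 4 ≤ n then w (n - 4) else 0).coeff k - (cubicConv h w n).coeff k := by
  have hn : (n ! : ℂ) ≠ 0 := Nat.cast_ne_zero.2 n.factorial_ne_zero
  rw [← factorial_smul_opKCoeff haw h0, ← factorial_smul_convCoeff_convCoeff h haw h0, ← haw n]
  simp only [coeff_add, coeff_sub, coeff_smul]
  constructor
  · intro h1
    linear_combination (n ! : ℂ) * h1
  · intro h1
    refine (mul_eq_zero.1 ?_).resolve_left hn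
    linear_combination h1

theorem coeff_equation (h : Admissible Q s) (V : ℂ → QPSpace Q s) (ζ : ℂ) (k : quasilattice Q) :
    (linOp (V ζ) - emb (opK V ζ) + emb (conv h (conv h V V) V ζ)).coeff k =
      ((symb k : ℂ) • V ζ - opK V ζ + conv h (conv h V V) V ζ).coeff k := by
  rw [coeff_add, coeff_sub, coeff_linOp, coeff_emb, coeff_emb, coeff_add, coeff_sub, coeff_smul]

/-- Mode by mode, (1 + Δ)² is a scalar, so expanding the equation needs no continuity of that
operator into 𝓗_{s-4}. -/
theorem hasPowerSum_equation (h : Admissible Q s) {r : ℝ} (hr : 0 < r) {V : ℂ → QPSpace Q s}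
    {a : ℕ → QPSpace Q s} (hV : HasPowerSum r V a) (k : quasilattice Q) :
    HasPowerSum r
      (fun ζ => (linOp (V ζ) - emb (opK V ζ) + emb (conv h (conv h V V) V ζ)).coeff k)
      (fun n => ((symb k : ℂ) • a n - opKCoeff a n +
        convCoeff h (convCoeff h a a) a n).coeff k) := by
  simp only [coeff_equation]
  exact (((hV.map ((symb k : ℂ) • ContinuousLinearMap.id ℂ (QPSpace Q s))).sub
    (hasPowerSum_opK hr hV)).add
    (hasPowerSum_conv h hr (hasPowerSum_conv h hr hV hV) hV)).map (coeffCLM s k)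

/-- Uniqueness of power series coefficients, applied to each Fourier mode, makes both the equation
and the invariance order-by-order statements. -/
theorem isBorelSolution_iff (h : Admissible Q s) {r : ℝ} (hr : 0 < r) {V : ℂ → QPSpace Q s} :
    IsBorelSolution h r V ↔
      ∃ w, IsBorelSeq h w ∧ HasPowerSum r V fun n => ((n ! : ℂ))⁻¹ • w n := by
  have hn : ∀ n : ℕ, (n ! : ℂ) ≠ 0 := fun n => Nat.cast_ne_zero.2 n.factorial_ne_zero
  constructor
  · intro hV
    have hP := hasPowerSum_taylorCoeff hV.analytic.1
    set a := taylorCoeff V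
    have h0 : ((0 ! : ℕ) : ℂ) • a 0 = 0 := by
      rw [← hP.eval_zero hr, hV.analytic.2, smul_zero]
    refine ⟨fun n => (n ! : ℂ) • a n, ⟨h0, fun n => Submodule.smul_mem _ _ ?_, fun n k => ?_⟩, ?_⟩
    · intro k k' hk
      have h1 := (hP.map (coeffCLM s k')).sub (hP.map (coeffCLM s k))
      exact sub_eq_zero.1 (h1.eq_zero hr
        (fun ζ hζ => sub_eq_zero.2 (hV.rotInvariant ζ hζ k k' hk)) n)
    · refine (equation_iff h (fun _ => rfl) h0 n k).1 ?_
      refine (hasPowerSum_equation h hr hP k).eq_zero hr (fun ζ hζ => ?_) n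
      rw [hV.equation ζ hζ, coeff_zero]
    · simpa only [inv_smul_smul₀ (hn _)] using hP
  · rintro ⟨w, hw, hP⟩
    have haw : ∀ n, (n ! : ℂ) • ((n ! : ℂ))⁻¹ • w n = w n := fun n => smul_inv_smul₀ (hn n) _
    refine ⟨⟨hP.analyticOnNhd hr, ?_⟩, fun ζ hζ k k' hk => ?_, fun ζ hζ => QPSpace.ext fun k => ?_⟩
    · rw [hP.eval_zero hr, hw.zero, smul_zero]
    · refine (hP.map (coeffCLM s k') ζ hζ).unique ?_
      convert hP.map (coeffCLM s k) ζ hζ using 4 with n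
      · exact (Submodule.smul_mem _ _ (hw.rot n) : _ ∈ rotSubmodule Q s) k k' hk
      · rfl
    · refine (hasPowerSum_equation h hr hP k ζ hζ).unique ?_
      simp only [(equation_iff h haw hw.zero _ k).2 (hw.eq _ k), smul_zero, coeff_zero]
      exact hasSum_zero

/-! ### The Borel transform -/

/-- The sequence `β^{-1/2} (U_0, 0, 0, 0, U_1, 0, 0, 0, …)`. -/
noncomputable def borelSeq (U : ℕ → QPSpace Q s) : ℕ → QPSpace Q s :=
  dilate ((((√(beta Q))⁻¹ : ℝ) : ℂ) • U)

theorem inv_sqrt_beta_sq (h : Admissible Q s) :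
    (((√(beta Q))⁻¹ : ℝ) : ℂ) ^ 2 * beta Q = 1 := by
  rw [← Complex.ofReal_pow, inv_pow, Real.sq_sqrt (beta_pos h).le, ← Complex.ofReal_mul,
    inv_mul_cancel₀ (beta_pos h).ne', Complex.ofReal_one]

theorem isStepSolution_borelSeq {h : Admissible Q s} {U : ℕ → QPSpace Q s}
    (hU : IsStepSolution h 1 (beta Q : ℂ)⁻¹ U) : IsStepSolution h 4 1 (borelSeq U) := by
  refine (hU.smul ?_).dilate
  rw [one_mul]
  exact eq_inv_of_mul_eq_one_left (inv_sqrt_beta_sq h)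

theorem factorial_pow_four_le (n : ℕ) : n ! ^ 4 ≤ (4 * n + 2)! := by
  have h1 : ∀ m : ℕ, m ! * m ! ≤ (2 * m)! := fun m => by
    rw [two_mul]
    exact Nat.le_of_dvd (Nat.factorial_pos _) (Nat.factorial_mul_factorial_dvd_factorial_add m m)
  calc n ! ^ 4 = (n ! * n !) * (n ! * n !) := by ring
    _ ≤ (2 * n)! * (2 * n)! := Nat.mul_le_mul (h1 n) (h1 n)
    _ ≤ (2 * (2 * n))! := h1 _
    _ ≤ (4 * n + 2)! := Nat.factorial_le (by omega)

theorem borelTerm_eq (U : ℕ → QPSpace Q s) (ζ : ℂ) (n : ℕ) :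
    borelTerm U ζ n =
      ζ ^ (4 * n + 2) • (((4 * n + 2)! : ℂ))⁻¹ • shift (borelSeq U) (4 * n + 2) := by
  rw [shift, borelSeq, dilate_mul, borelTerm, div_eq_mul_inv, mul_smul, Pi.smul_apply]

theorem shift_borelSeq_of_notMem (U : ℕ → QPSpace Q s) {m : ℕ}
    (hm : m ∉ Set.range fun n : ℕ => 4 * n + 2) : shift (borelSeq U) m = 0 := by
  match m with
  | 0 => rfl
  | 1 => rfl
  | m + 2 => exact dilate_of_not_dvd _ fun ⟨n, hn⟩ => hm ⟨n, by simp only; omega⟩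

theorem hasSum_borelTerm {U : ℕ → QPSpace Q s} {K r : ℝ} (hK : 0 < K) (hU : GevreyBound U K)
    (hr : r = K ^ (-(1 / 4) : ℝ)) {ζ : ℂ} (hζ : ζ ∈ Metric.ball (0 : ℂ) r) :
    Summable (borelTerm U ζ) ∧
      HasSum (fun m => ζ ^ m • ((m ! : ℂ))⁻¹ • shift (borelSeq U) m) (borelTransform U ζ) := by
  obtain ⟨γ, hγ, hU⟩ := hU
  -- The radius is exactly the one where Kⁿ is balanced by ζ^{4n}.
  have hKr : K * r ^ 4 = 1 := by
    rw [hr, ← Real.rpow_natCast _ 4, ← Real.rpow_mul hK.le]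
    norm_num [Real.rpow_neg_one, hK.ne']
  set c : ℂ := (((√(beta Q))⁻¹ : ℝ) : ℂ) with hc
  have hsum : Summable fun m => ζ ^ m • ((m ! : ℂ))⁻¹ • shift (borelSeq U) m := by
    refine summable_pow_smul (fun ρ hρ hρr => ⟨‖c‖ * γ * ρ ^ 2, fun m => ?_⟩) hζ
    by_cases hm : m ∈ Set.range fun n : ℕ => 4 * n + 2
    · obtain ⟨n, rfl⟩ := hm
      have hKρ : K * ρ ^ 4 ≤ 1 := by
        rw [← hKr]
        gcongr
      have hfac : ((n ! : ℝ)) ^ 4 / ((4 * n + 2)! : ℝ) ≤ 1 := by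
        rw [div_le_one (by positivity)]
        exact_mod_cast factorial_pow_four_le n
      simp only
      rw [shift, borelSeq, dilate_mul, Pi.smul_apply, norm_smul, norm_smul, norm_inv,
        Complex.norm_natCast]
      calc (((4 * n + 2)! : ℝ))⁻¹ * (‖c‖ * ‖U n‖) * ρ ^ (4 * n + 2)
          ≤ (((4 * n + 2)! : ℝ))⁻¹ * (‖c‖ * (γ * K ^ n * (n ! : ℝ) ^ 4)) * ρ ^ (4 * n + 2) := by
            gcongr
            exact hU n
        _ = ‖c‖ * γ * ρ ^ 2 * (K * ρ ^ 4) ^ n * ((n ! : ℝ) ^ 4 / ((4 * n + 2)! : ℝ)) := by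
            rw [pow_add, pow_mul, mul_pow]
            field_simp
        _ ≤ ‖c‖ * γ * ρ ^ 2 * 1 * 1 := by
            gcongr
            exact pow_le_one₀ (by positivity) hKρ
        _ = ‖c‖ * γ * ρ ^ 2 := by ring
    · rw [shift_borelSeq_of_notMem U hm, smul_zero, norm_zero, zero_mul]
      positivity
  have hinj : Function.Injective fun n : ℕ => 4 * n + 2 := fun i j hij => by
    simp only at hij
    omega
  have hterm : borelTerm U ζ =
      (fun m => ζ ^ m • ((m ! : ℂ))⁻¹ • shift (borelSeq U) m) ∘ fun n => 4 * n + 2 :=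
    funext fun n => borelTerm_eq U ζ n
  have h1 : Summable (borelTerm U ζ) := by
    rw [hterm]
    exact hsum.comp_injective hinj
  refine ⟨h1, (hinj.hasSum_iff fun m hm => ?_).1 ?_⟩
  · rw [shift_borelSeq_of_notMem U hm, smul_zero, smul_zero]
  · rw [← hterm]
    exact h1.hasSum

/-- The leading amplitude a solves a = a³β, and each of its three values belongs to a known
sequence, so uniqueness of the recursion identifies V. -/
theorem isBorelSolution_iff_eqOn (hQ : Q = 8 ∨ Q = 10 ∨ Q = 12) (h : Admissible Q s)
    {U : ℕ → QPSpace Q s} (hU : IsFormalSolution h U) {r : ℝ} (hr : 0 < r)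
    (hB : HasPowerSum r (borelTransform U) fun m => ((m ! : ℂ))⁻¹ • shift (borelSeq U) m)
    (V : ℂ → QPSpace Q s) :
    IsBorelSolution h r V ↔ Set.EqOn V 0 (Metric.ball 0 r) ∨
      Set.EqOn V (borelTransform U) (Metric.ball 0 r) ∨
      Set.EqOn V (-borelTransform U) (Metric.ball 0 r) := by
  obtain ⟨hS, hU0⟩ := isFormalSolution_iff.1 hU
  have hS4 := isStepSolution_borelSeq hS
  set c : ℂ := (((√(beta Q))⁻¹ : ℝ) : ℂ) with hc
  have hcβ : c ^ 2 * beta Q = 1 := inv_sqrt_beta_sq h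
  have hb0 : borelSeq U 0 = c • basicPattern Q s := by
    rw [← hU0]
    exact dilate_mul _ 0
  have hN4 : IsStepSolution h 4 1 ((-1 : ℂ) • borelSeq U) := hS4.smul (by norm_num)
  have hB0 : HasPowerSum r (0 : ℂ → QPSpace Q s)
      fun m => ((m ! : ℂ))⁻¹ • shift (0 : ℕ → QPSpace Q s) m := fun ζ _ => by
    have : ∀ m, shift (0 : ℕ → QPSpace Q s) m = 0 := fun m =>
      match m with
      | 0 => rfl
      | 1 => rfl
      | _ + 2 => rfl
    simp only [this, smul_zero]
    exact hasSum_zero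
  have hBN : HasPowerSum r (-borelTransform U)
      fun m => ((m ! : ℂ))⁻¹ • shift ((-1 : ℂ) • borelSeq U) m := fun ζ hζ => by
    have : ∀ m, shift ((-1 : ℂ) • borelSeq U) m = -shift (borelSeq U) m := fun m =>
      match m with
      | 0 => neg_zero.symm
      | 1 => neg_zero.symm
      | _ + 2 => neg_one_smul ℂ _
    simp only [this, smul_neg]
    exact (hB ζ hζ).neg
  constructor
  · intro hV
    obtain ⟨w, hw, hP⟩ := (isBorelSolution_iff h hr).1 hV
    obtain ⟨u, a, rfl, hu, hu0, ha⟩ := hw.eq_shift hQ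
    rcases mul_eq_zero.1 ha with ha | ha
    · left
      obtain rfl := hu.unique hQ (by norm_num) (a := a) (by rw [ha]; norm_num) .zero hu0
        (by rw [ha, zero_smul]; rfl)
      exact fun ζ hζ => (hP ζ hζ).unique (hB0 ζ hζ)
    · right
      have ha3 : 3 * a ^ 2 * 1 * beta Q ≠ 1 := by
        rw [show 3 * a ^ 2 * 1 * beta Q = 3 by linear_combination -3 * ha]
        norm_num
      -- Both a²β and c²β equal 1.
      have hac : (a - c) * (a + c) = 0 := by
        refine (mul_eq_zero.1 ?_).resolve_right (beta_ne_zero h)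
        linear_combination -ha - hcβ
      rcases mul_eq_zero.1 hac with hac | hac
      · left
        obtain rfl := hu.unique hQ (by norm_num) ha3 hS4 hu0 (by rw [hb0, sub_eq_zero.1 hac])
        exact fun ζ hζ => (hP ζ hζ).unique (hB ζ hζ)
      · right
        obtain rfl := hu.unique hQ (by norm_num) ha3 hN4 hu0 (by
          rw [Pi.smul_apply, hb0, smul_smul, eq_neg_of_add_eq_zero_left hac, neg_one_mul])
        exact fun ζ hζ => (hP ζ hζ).unique (hBN ζ hζ)
  · rw [isBorelSolution_iff h hr]
    rintro (hV | hV | hV)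
    · exact ⟨_, IsStepSolution.zero.isBorelSeq_shift, hB0.congr hV⟩
    · exact ⟨_, hS4.isBorelSeq_shift, hB.congr hV⟩
    · exact ⟨_, hN4.isBorelSeq_shift, hBN.congr hV⟩

end QuasiPattern

theorem theorem2 (Q : ℕ) (s : ℝ) (hQ : Q = 8 ∨ Q = 10 ∨ Q = 12) (h : Admissible Q s) :
    (∃! U : ℕ → QPSpace Q s, IsFormalSolution h U) ∧
    ∀ U : ℕ → QPSpace Q s, IsFormalSolution h U →
      (∃ K : ℝ, 0 < K ∧ GevreyBound U K) ∧
      ∀ K r : ℝ, 0 < K → GevreyBound U K → r = K ^ (-(1 / 4) : ℝ) →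
        (∀ f g : ℂ → QPSpace Q s, IsAnalyticNull r f → IsAnalyticNull r g →
          (∀ ζ ∈ Metric.ball (0 : ℂ) r,
            (Summable fun n => opKTerm f ζ (n + 1)) ∧ Summable (convTerm h f g ζ)) ∧
          IsAnalyticNull r (opK f) ∧ IsAnalyticNull r (conv h f g)) ∧
        (∀ ζ ∈ Metric.ball (0 : ℂ) r, Summable (borelTerm U ζ)) ∧
        IsBorelSolution h r (borelTransform U) ∧
        ∀ V : ℂ → QPSpace Q s, IsBorelSolution h r V ↔
          Set.EqOn V 0 (Metric.ball 0 r) ∨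
            Set.EqOn V (borelTransform U) (Metric.ball 0 r) ∨
            Set.EqOn V (-borelTransform U) (Metric.ball 0 r) := by
  refine ⟨existsUnique_isFormalSolution hQ h, fun U hU => ⟨?_, fun K r hK hG hr => ?_⟩⟩
  -- By uniqueness the Gevrey bound is needed only for the constructed solution.
  · obtain rfl : U = formalSolution h := (existsUnique_isFormalSolution hQ h).unique hU
      (isFormalSolution_iff.2 ⟨isStepSolution_formalSolution hQ h, by rw [formalSolution]⟩)
    exact exists_gevreyBound h
  · have hr0 : 0 < r := hr ▸ Real.rpow_pos_of_pos hK _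
    have hB : HasPowerSum r (borelTransform U) fun m => ((m ! : ℂ))⁻¹ • shift (borelSeq U) m :=
      fun ζ hζ => (hasSum_borelTerm hK hG hr hζ).2
    have hiff := isBorelSolution_iff_eqOn hQ h hU hr0 hB
    exact ⟨fun f g hf hg => operators_analytic h hr0 hf hg,
      fun ζ hζ => (hasSum_borelTerm hK hG hr hζ).1,
      (hiff _).2 (Or.inr (Or.inl fun _ _ => rfl)), hiff⟩
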